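/- Let $k\ge 3$, let $p>2$ be real, and let $\psi:\mathbb C\to\mathbb C$, $\psi(z)=|z|^{p-1}z$ (a homeomorphism). **$C^1$ SS maps and manifolds.** Stratify $\mathbb R^l\times\mathbb C^{n}$ by the subsets $T\subseteq\{1,\dots,n\}$, the stratum of $T$ being the set of $(x,\mathbf a)$ with $a_i\ne0\iff i\in T$. A map between an open subset of one such space and another such space is *$C^1$ stratified smooth* ($C^1$ SS) if it is $C^1$, maps strata into strata through an order-preserving map of the index sets, and is $C^\infty$ on each stratum. A *$C^1$ SS manifold* has charts in such spaces with $C^1$ SS transition maps. A subspace $Y$ of a $C^1$ SS manifold $X$ with a $C^1$ SS atlas of its own is a *$C^1$ SS submanifold* (its structure is induced from $X$) if the inclusion is $C^1$ SS in charts and every chart of $Y$ is locally the restriction of a $C^1$ SS map defined on an open subset of $X$. **The sphere.** $S^2_{new}$ is $S^2=\mathbb C\cup\{\infty\}$ with the charts $w\mapsto\psi^{-1}(w)$ on $S^2\setminus\{1,\infty\}$, $w\mapsto\psi^{-1}(1-w)$ on $S^2\setminus\{0,\infty\}$, $w\mapsto\psi^{-1}(1/w)$ on $S^2\setminus\{0,1\}$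 (with values in the stratified $\mathbb C$), and $w\mapsto w$ on $S^2\setminus\{0,1,\infty\}$ (with values in $\mathbb R^2$, not stratified); $(S^2_{new})^N$ has the product charts. **Cross ratios.** Let $\overline{\mathcal M}_{0,k}$ be the set of isomorphism classes of stable nodal genus zero curves (trees of spheres) with $k$ marked points and let $N=k(k-1)(k-2)(k-3)$. For distinct labels $i_0,i_1,i_2,i_3$, the cross ratio $w_{i_0i_1i_2i_3}:\overline{\mathcal M}_{0,k}\to S^2$ is $$\frac{(z_1-z_2)(z_3-z_0)}{(z_0-z_1)(z_2-z_3)},$$ where $z_0,\dots,z_3$ are the images of the marked points $i_0,\dots,i_3$ on a component of the curve, all others being collapsed, on which no three of these images coincide. Together the cross ratios give a map $\overline{\mathcal M}_{0,k}\to(S^2)^N$, and $\overline{\mathcal M}_{0,k}$ carries the topology that this map induces. **Cross-ratio charts.** A cross-ratio chart centred at $w_0\in\overline{\mathcal M}_{0,k}$ is a homeomorphism $\phi^{-1}$ from an open neighbourhood $O$ of $w_0$ onto an open subset of $\mathbb C^{k-3}$ whose coordinates are $k-3$ cross ratios, such that all cross ratios are $C^\infty$ functions ($S^2$-valued) of these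 coordinates, and: every edge (node) of a curve in $O$ is an edge of $w_0$, edges being identified with the partitions of the labels that they define; some of the coordinates, the gluing parameters $\mathbf a$, correspond bijectively to the edges of $w_0$, and on $O$ each of them vanishes exactly at the curves that have the corresponding edge; the remaining coordinates $\mathbf b$ do not take the values $0,1,\infty$ on $O$. The reparametrized chart is the inverse of $\phi\circ\Psi$, where $\Psi(\tilde{\mathbf a},\tilde{\mathbf b})=(\psi(\tilde{\mathbf a}),\tilde{\mathbf b})$ with $\psi$ applied to each coordinate of $\tilde{\mathbf a}$; it is stratified by $\tilde{\mathbf a}$. **Proposition.** $(S^2_{new})^N$ is a $C^1$ SS manifold. Every point of $\overline{\mathcal M}_{0,k}$ is the centre of a cross-ratio chart. The cross-ratio map is a topological embedding $\overline{\mathcal M}_{0,k}\to(S^2_{new})^N$, and through it $\overline{\mathcal M}_{0,k}$, with the atlas of all reparametrized cross-ratio charts, is a $C^1$ SS submanifold of $(S^2_{new})^N$. In particular, all transition maps between reparametrized cross-ratio charts are $C^1$ SS, together with their inverses. -/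

import Mathlib

open Set Topology

noncomputable section

namespace DeligneMumford

open Classical in
/-- The Moebius involution `w ↦ 1 / w` of the Riemann sphere `S² = ℂ ∪ {∞}`. -/
def sphereInv : OnePoint ℂ → OnePoint ℂ := fun w =>
  w.elim (((0 : ℂ) : OnePoint ℂ)) (fun z => if z = 0 then OnePoint.infty else ((z⁻¹ : ℂ) : OnePoint ℂ))

theorem sphereInv_infty : sphereInv OnePoint.infty = ((0 : ℂ) : OnePoint ℂ) := rfl

theorem sphereInv_zero : sphereInv ((0 : ℂ) : OnePoint ℂ) = OnePoint.infty := by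
  simp [sphereInv]

theorem sphereInv_coe {z : ℂ} (hz : z ≠ 0) :
    sphereInv (z : OnePoint ℂ) = ((z⁻¹ : ℂ) : OnePoint ℂ) := by
  simp [sphereInv, hz]

theorem sphereInv_involutive : Function.Involutive sphereInv := by
  intro w
  induction w using OnePoint.rec with
  | infty => rw [sphereInv_infty, sphereInv_zero]
  | coe z =>
    by_cases hz : z = 0
    · subst hz; rw [sphereInv_zero, sphereInv_infty]
    · rw [sphereInv_coe hz, sphereInv_coe (inv_ne_zero hz), inv_inv]

theorem continuous_sphereInv : Continuous sphereInv := by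
  rw [OnePoint.continuous_iff]
  constructor
  · rw [sphereInv_infty, Filter.coclosedCompact_eq_cocompact]
    have h1 : Filter.Tendsto (fun z : ℂ => ((z⁻¹ : ℂ) : OnePoint ℂ)) (Filter.cocompact ℂ)
        (𝓝 ((0 : ℂ) : OnePoint ℂ)) :=
      (OnePoint.continuous_coe.tendsto 0).comp (Filter.tendsto_inv₀_cobounded.mono_left
        (by rw [Metric.cobounded_eq_cocompact]))
    refine h1.congr' ?_
    have h2 : ({0}ᶜ : Set ℂ) ∈ Filter.cocompact ℂ := isCompact_singleton.compl_mem_cocompact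
    filter_upwards [h2] with z hz
    rw [sphereInv_coe hz]
  · rw [continuous_iff_continuousAt]
    intro z
    by_cases hz : z = 0
    · subst hz
      rw [ContinuousAt, sphereInv_zero, ← nhdsNE_sup_pure, Filter.tendsto_sup]
      constructor
      · have h1 : Filter.Tendsto (fun z : ℂ => ((z⁻¹ : ℂ) : OnePoint ℂ)) (𝓝[≠] 0)
            (𝓝 OnePoint.infty) := by
          refine (OnePoint.tendsto_coe_infty (X := ℂ)).comp ?_
          rw [Filter.coclosedCompact_eq_cocompact, ← Metric.cobounded_eq_cocompact]
          exact Filter.tendsto_inv₀_nhdsNE_zero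
        refine h1.congr' ?_
        filter_upwards [self_mem_nhdsWithin] with z hz
        rw [sphereInv_coe hz]
      · rw [Filter.tendsto_pure_left]
        intro s hs
        rw [sphereInv_zero]
        exact mem_of_mem_nhds hs
    · have h1 : ContinuousAt (fun z : ℂ => ((z⁻¹ : ℂ) : OnePoint ℂ)) z :=
        OnePoint.continuous_coe.continuousAt.comp (continuousAt_inv₀ hz)
      refine h1.congr ?_
      filter_upwards [isOpen_ne.mem_nhds hz] with y hy
      rw [sphereInv_coe hy]

/-- Inversion as a homeomorphism of the sphere. -/
def sphereInvHomeo : OnePoint ℂ ≃ₜ OnePoint ℂ where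
  toEquiv := sphereInv_involutive.toPerm
  continuous_toFun := continuous_sphereInv
  continuous_invFun := continuous_sphereInv


/-! ### `C¹` stratified smooth maps and manifolds

A model space is `ℂ^ι` together with a set `A ⊆ ι` of gluing coordinates. The coordinates in `A`
carry the stratification and those outside `A` are regarded as pairs of real coordinates, so this is
the space `ℝ^(2 |ι ∖ A|) × ℂ^A` stratified by the power set of `A`. -/

/-- The index `T ⊆ A` of the stratum that contains `x`: the gluing coordinates of `x` that are
not zero. -/
def stratumIndex {ι : Type} (A : Set ι) (x : ι → ℂ) : Set A := {i | x i ≠ 0}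

/-- The stratum with index `T ⊆ A`. -/
def stratum {ι : Type} (A : Set ι) (T : Set A) : Set (ι → ℂ) := {x | stratumIndex A x = T}

/-- `f`, on the open set `U` of the model space `(ℂ^ι, A)`, is a `C¹` stratified smooth map to the
model space `(ℂ^κ, B)`: it is `C¹` in the real sense, it maps strata to strata through an
order preserving map of the index sets, and its restriction to each stratum is `C^∞`. -/
structure IsC1SSOn {ι κ : Type} [Fintype ι] [Fintype κ] (A : Set ι) (B : Set κ)
    (f : (ι → ℂ) → (κ → ℂ)) (U : Set (ι → ℂ)) : Prop where
  contDiffOn : ContDiffOn ℝ 1 f U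
  stratified : ∃ F : Set A → Set B, Monotone F ∧ ∀ T, MapsTo f (U ∩ stratum A T) (stratum B (F T))
  smooth : ∀ T : Set A, ContDiffOn ℝ ((⊤ : ℕ∞) : WithTop ℕ∞) f (U ∩ stratum A T)

/-- A chart of `X` with values in an open subset of a model space. -/
structure SSChart (X : Type) [TopologicalSpace X] (ι : Type) where
  chart : OpenPartialHomeomorph X (ι → ℂ)
  gluing : Set ι

/-- The charts in `𝒜` make `X` a `C¹` stratified smooth manifold: they cover `X`, and all
transition maps (hence also their inverses) are `C¹` stratified smooth. -/
structure IsC1SSAtlas {X : Type} [TopologicalSpace X] {ι : Type} [Fintype ι]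
    (𝒜 : Set (SSChart X ι)) : Prop where
  cover : ∀ x, ∃ c ∈ 𝒜, x ∈ c.chart.source
  transition : ∀ c ∈ 𝒜, ∀ c' ∈ 𝒜, IsC1SSOn c.gluing c'.gluing
    (c'.chart ∘ c.chart.symm) (c.chart.symm.trans c'.chart).source

/-- `f : Y → X` is `C¹` stratified smooth in all charts of `ℬ` and `𝒜`. -/
def IsC1SSMap {X Y : Type} [TopologicalSpace X] [TopologicalSpace Y] {ι κ : Type}
    [Fintype ι] [Fintype κ] (ℬ : Set (SSChart Y κ)) (𝒜 : Set (SSChart X ι)) (f : Y → X) : Prop :=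
  ∀ c ∈ ℬ, ∀ c' ∈ 𝒜, IsC1SSOn c.gluing c'.gluing (c'.chart ∘ f ∘ c.chart.symm)
    (c.chart.target ∩ c.chart.symm ⁻¹' (f ⁻¹' c'.chart.source))

/-- `g`, on the open set `U` of `X`, is a `C¹` stratified smooth map to the model space
`(ℂ^κ, B)`. -/
def IsC1SSToModelOn {X : Type} [TopologicalSpace X] {ι κ : Type} [Fintype ι] [Fintype κ]
    (𝒜 : Set (SSChart X ι)) (B : Set κ) (g : X → (κ → ℂ)) (U : Set X) : Prop :=
  ∀ c ∈ 𝒜, IsC1SSOn c.gluing B (g ∘ c.chart.symm) (c.chart.target ∩ c.chart.symm ⁻¹' U)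

/-- `Y`, with inclusion `j : Y → X`, is a `C¹` stratified smooth submanifold of `(X, 𝒜)`, and `ℬ` is
an atlas of its `C¹` stratified smooth structure. That this structure is the one induced from `X`
means that the inclusion is `C¹` stratified smooth and that every chart of `Y` is locally
the restriction of a `C¹` stratified smooth map defined on an open subset of `X`. These two
properties determine the structure near each point of `Y`. -/
structure IsC1SSSubmanifold {X Y : Type} [TopologicalSpace X] [TopologicalSpace Y] {ι κ : Type}
    [Fintype ι] [Fintype κ] (j : Y → X) (𝒜 : Set (SSChart X ι)) (ℬ : Set (SSChart Y κ)) : Prop where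
  isEmbedding : IsEmbedding j
  isC1SSAtlas : IsC1SSAtlas ℬ
  isC1SSMap : IsC1SSMap ℬ 𝒜 j
  extends_locally : ∀ c ∈ ℬ, ∀ y ∈ c.chart.source, ∃ (U : Set X) (g : X → (κ → ℂ)),
    IsOpen U ∧ j y ∈ U ∧ IsC1SSToModelOn 𝒜 c.gluing g U ∧
      ∀ y' ∈ c.chart.source, j y' ∈ U → g (j y') = c.chart y'

/-! ### The reparametrization and the sphere with its new structure -/

/-- The reparametrization `ψ(z) = |z|^(p-1) z`. -/
def psi (p : ℝ) (z : ℂ) : ℂ := ((‖z‖ ^ (p - 1) : ℝ) : ℂ) * z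

theorem norm_psi {p : ℝ} (hp : 0 < p) (z : ℂ) : ‖psi p z‖ = ‖z‖ ^ p := by
  by_cases hz : z = 0
  · subst hz; simp [psi, Real.zero_rpow hp.ne']
  · have h : 0 < ‖z‖ := norm_pos_iff.mpr hz
    rw [psi, norm_mul, Complex.norm_real, Real.norm_of_nonneg (Real.rpow_nonneg h.le _)]
    nth_rewrite 2 [← Real.rpow_one ‖z‖]
    rw [← Real.rpow_add h]
    congr 1
    ring

theorem psi_psi_inv {p q : ℝ} (hq : 0 < q) (hpq : p * q = 1) (z : ℂ) : psi p (psi q z) = z := by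
  by_cases hz : z = 0
  · subst hz; simp [psi]
  · have h : 0 < ‖z‖ := norm_pos_iff.mpr hz
    have h1 : psi p (psi q z) = ((‖psi q z‖ ^ (p - 1) : ℝ) : ℂ) * (((‖z‖ ^ (q - 1) : ℝ) : ℂ) * z) :=
      rfl
    rw [h1, norm_psi hq, ← mul_assoc, ← Complex.ofReal_mul, ← Real.rpow_mul h.le,
      ← Real.rpow_add h]
    have h2 : q * (p - 1) + (q - 1) = 0 := by linarith
    rw [h2]
    simp

theorem continuous_psi {p : ℝ} (hp : 0 < p) : Continuous (psi p) := by
  rw [continuous_iff_continuousAt]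
  intro z
  by_cases hz : z = 0
  · subst hz
    have h0 : psi p 0 = 0 := by simp [psi]
    rw [ContinuousAt, h0, tendsto_zero_iff_norm_tendsto_zero]
    simp only [norm_psi hp]
    have h1 : Filter.Tendsto (fun z : ℂ => ‖z‖ ^ p) (𝓝 0) (𝓝 (‖(0 : ℂ)‖ ^ p)) :=
      (continuous_norm.tendsto 0).rpow_const (Or.inr hp.le)
    simpa [Real.zero_rpow hp.ne'] using h1
  · have h : ‖z‖ ≠ 0 := norm_ne_zero_iff.mpr hz
    unfold psi
    exact (Complex.continuous_ofReal.continuousAt.comp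
      (continuous_norm.continuousAt.rpow_const (Or.inl h))).mul continuousAt_id

/-- `ψ` as a homeomorphism of `ℂ`; its inverse is `z ↦ |z|^(1/p-1) z`. -/
def psiHomeo (p : ℝ) (hp : 0 < p) : ℂ ≃ₜ ℂ where
  toFun := psi p
  invFun := psi p⁻¹
  left_inv := psi_psi_inv hp (inv_mul_cancel₀ hp.ne')
  right_inv := psi_psi_inv (inv_pos.mpr hp) (mul_inv_cancel₀ hp.ne')
  continuous_toFun := continuous_psi hp
  continuous_invFun := continuous_psi (inv_pos.mpr hp)

/-- The affine chart `w ↦ w` of the sphere, with domain `S² ∖ {∞}`. -/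
def affineChart : OpenPartialHomeomorph (OnePoint ℂ) ℂ :=
  (OnePoint.isOpenEmbedding_coe (X := ℂ)).toOpenPartialHomeomorph.symm

/-- The Moebius involution `w ↦ 1 - w` of the sphere. -/
def sphereFlip : OnePoint ℂ ≃ₜ OnePoint ℂ := (Homeomorph.subLeft (1 : ℂ)).onePointCongr

/-- The three special points `0`, `1`, `∞` of the sphere, and `generic` for all others. -/
inductive SphereKind : Type
  | zero
  | one
  | infty
  | generic

/-- The charts of the new structure on the sphere. Around `0` it is `w ↦ ψ⁻¹(w)` on
`S² ∖ {1, ∞}`, that is the inverse of `φ ∘ ψ` with `φ` the standard conformal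
parametrization; around `1` it is `w ↦ ψ⁻¹(1 - w)` on `S² ∖ {0, ∞}` and around `∞` it
is `w ↦ ψ⁻¹(1 / w)` on `S² ∖ {0, 1}`. On `S² ∖ {0, 1, ∞}` it is the standard
chart `w ↦ w`. -/
def sphereNewChart (p : ℝ) (hp : 0 < p) : SphereKind → OpenPartialHomeomorph (OnePoint ℂ) ℂ
  | .zero => (affineChart.trans
      (OpenPartialHomeomorph.ofSet {1}ᶜ isOpen_compl_singleton)).transHomeomorph (psiHomeo p hp).symm
  | .one => ((sphereFlip.toOpenPartialHomeomorph.trans affineChart).trans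
      (OpenPartialHomeomorph.ofSet {1}ᶜ isOpen_compl_singleton)).transHomeomorph (psiHomeo p hp).symm
  | .infty => ((sphereInvHomeo.toOpenPartialHomeomorph.trans affineChart).trans
      (OpenPartialHomeomorph.ofSet {1}ᶜ isOpen_compl_singleton)).transHomeomorph (psiHomeo p hp).symm
  | .generic => affineChart.trans
      (OpenPartialHomeomorph.ofSet {0, 1}ᶜ (Set.toFinite {0, 1}).isClosed.isOpen_compl)

/-- The product atlas of `(S²_new)^ι`: a chart of `S²_new` is chosen for each factor, and the
gluing (stratified) coordinates are those around `0`, `1` or `∞`. -/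
def sphereNewPowAtlas (p : ℝ) (hp : 0 < p) (ι : Type) [Fintype ι] :
    Set (SSChart (ι → OnePoint ℂ) ι) :=
  range fun τ : ι → SphereKind =>
    ⟨OpenPartialHomeomorph.pi fun i => sphereNewChart p hp (τ i), {i | τ i ≠ .generic}⟩

/-- Smoothness of a map with values in the sphere with its standard smooth structure, in the two
charts `w` and `1 / w`. -/
def IsSmoothToSphereOn {E : Type} [NormedAddCommGroup E] [NormedSpace ℝ E] (f : E → OnePoint ℂ)
    (s : Set E) : Prop :=
  ContinuousOn f s ∧ ∀ x ∈ s,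
    (f x ≠ OnePoint.infty ∧
      ContDiffWithinAt ℝ ((⊤ : ℕ∞) : WithTop ℕ∞) (fun y => affineChart (f y)) s x) ∨
    (f x ≠ ((0 : ℂ) : OnePoint ℂ) ∧
      ContDiffWithinAt ℝ ((⊤ : ℕ∞) : WithTop ℕ∞) (fun y => affineChart (sphereInv (f y))) s x)

/-! ### The Deligne-Mumford space and its cross ratios -/

/-- A stable nodal curve of genus zero with `k` marked points: a tree of `n` spheres. The vertices
of the tree are the components and its edges are the nodes. For an edge `αβ`, `node α β` is the
position of that node on the component `α` (its value for non-adjacent `α`, `β` is irrelevant). The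
marked point `i` lies on the component `comp i` at the position `pos i`. -/
structure StableCurve (k : ℕ) where
  n : ℕ
  tree : SimpleGraph (Fin n)
  isTree : tree.IsTree
  node : Fin n → Fin n → OnePoint ℂ
  comp : Fin k → Fin n
  pos : Fin k → OnePoint ℂ
  node_injective : ∀ α β γ, tree.Adj α β → tree.Adj α γ → node α β = node α γ → β = γ
  pos_injective : ∀ i j, comp i = comp j → pos i = pos j → i = j
  node_ne_pos : ∀ α β i, tree.Adj α β → comp i = α → node α β ≠ pos i
  stable : ∀ α, 3 ≤ {β | tree.Adj α β}.ncard + {i | comp i = α}.ncard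

namespace StableCurve

variable {k : ℕ}

/-- Two stable curves are isomorphic if there are an isomorphism of the trees and a Moebius
transformation on each component which match all nodes and all marked points. -/
def Iso (C D : StableCurve k) : Prop :=
  ∃ (f : C.tree ≃g D.tree) (g : Fin C.n → GL (Fin 2) ℂ),
    (∀ α β, C.tree.Adj α β → g α • C.node α β = D.node (f α) (f β)) ∧
    (∀ i, D.comp i = f (C.comp i)) ∧
    ∀ i, g (C.comp i) • C.pos i = D.pos i

theorem Iso.refl (C : StableCurve k) : Iso C C :=
  ⟨RelIso.refl _, fun _ => 1, fun _ _ _ => by simp, fun _ => rfl, fun _ => by simp⟩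

theorem Iso.symm {C D : StableCurve k} (h : Iso C D) : Iso D C := by
  obtain ⟨f, g, h1, h2, h3⟩ := h
  refine ⟨f.symm, fun α => (g (f.symm α))⁻¹, fun α β hαβ => ?_, fun i => ?_, fun i => ?_⟩
  · have h4 := h1 (f.symm α) (f.symm β) (f.symm.map_rel_iff.mpr hαβ)
    rw [inv_smul_eq_iff, h4]
    simp
  · rw [h2 i]; simp
  · rw [inv_smul_eq_iff, ← h3 i, h2 i]; simp

theorem Iso.trans {C D E : StableCurve k} (h : Iso C D) (h' : Iso D E) : Iso C E := by
  obtain ⟨f, g, h1, h2, h3⟩ := h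
  obtain ⟨f', g', h1', h2', h3'⟩ := h'
  refine ⟨f.trans f', fun α => g' (f α) * g α, fun α β hαβ => ?_, fun i => ?_, fun i => ?_⟩
  · rw [mul_smul, h1 α β hαβ, h1' _ _ (f.map_rel_iff.mpr hαβ)]
    rfl
  · rw [h2' i, h2 i]; rfl
  · rw [mul_smul, h3 i, ← h2 i, h3' i]

instance setoid (k : ℕ) : Setoid (StableCurve k) where
  r := Iso
  iseqv := ⟨Iso.refl, Iso.symm, Iso.trans⟩

/-- For an edge `αβ`, the labels of the marked points on the side of `β`. -/
def side (C : StableCurve k) (α β : Fin C.n) : Set (Fin k) :=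
  {i | C.tree.dist β (C.comp i) < C.tree.dist α (C.comp i)}

/-- The edges (nodes) of a stable curve. An edge is recorded by the partition of the set of
labels into its two sides, which determines it. -/
def edges (C : StableCurve k) : Set (Set (Set (Fin k))) :=
  {P | ∃ α β, C.tree.Adj α β ∧ P = {C.side α β, C.side β α}}

open Classical in
/-- The special point of the component `α` in the direction of the marked point `i`, that is the
image of that marked point when all other components are collapsed: the marked
point itself if it lies on `α`, otherwise the node that leads to it. -/
def proj (C : StableCurve k) (α : Fin C.n) (i : Fin k) : OnePoint ℂ :=
  if h : ∃ β, C.tree.Adj α β ∧ i ∈ C.side α β then C.node α h.choose else C.pos i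

end StableCurve

/-- Homogeneous coordinates of a point of the sphere. -/
def homog (z : OnePoint ℂ) : ℂ × ℂ := z.elim (1, 0) fun z => (z, 1)

/-- The difference `z - w` in homogeneous coordinates. -/
def homogSub (z w : OnePoint ℂ) : ℂ :=
  (homog z).1 * (homog w).2 - (homog w).1 * (homog z).2

open Classical in
/-- The cross ratio `((z₁ - z₂) (z₃ - z₀)) / ((z₀ - z₁) (z₂ - z₃))` of four points of
the sphere, no three of which coincide. -/
def crossRatio (z : Fin 4 → OnePoint ℂ) : OnePoint ℂ :=
  if homogSub (z 0) (z 1) * homogSub (z 2) (z 3) = 0 then OnePoint.infty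
  else (((homogSub (z 1) (z 2) * homogSub (z 3) (z 0)) /
    (homogSub (z 0) (z 1) * homogSub (z 2) (z 3)) : ℂ) : OnePoint ℂ)

/-- `w` is the cross ratio of the marked points `q 0, q 1, q 2, q 3` of the stable curve `C`: it is
the cross ratio of their images on a component on which no three of these images coincide. (Such a
component exists, and the value does not depend on it.) -/
def StableCurve.IsCrossRatio {k : ℕ} (C : StableCurve k) (q : Fin 4 ↪ Fin k) (w : OnePoint ℂ) :
    Prop :=
  ∃ α, (∀ a b c : Fin 4, a ≠ b → b ≠ c → a ≠ c →
      ¬ (C.proj α (q a) = C.proj α (q b) ∧ C.proj α (q b) = C.proj α (q c))) ∧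
    w = crossRatio fun a => C.proj α (q a)

/-- The Deligne-Mumford space of stable curves of genus zero with `k` marked points, up to
isomorphism. -/
def DM (k : ℕ) : Type := Quotient (StableCurve.setoid k)

/-- The isomorphism class of a stable curve. -/
def DM.mk {k : ℕ} (C : StableCurve k) : DM k := Quotient.mk _ C

/-- The edges of (the tree of) a point of the Deligne-Mumford space. They do not depend on the
representative. -/
def DM.edges {k : ℕ} (x : DM k) : Set (Set (Set (Fin k))) :=
  {P | ∃ C : StableCurve k, DM.mk C = x ∧ P ∈ C.edges}

/-- The map to the product of spheres given by all cross ratios, indexed by the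
`k (k - 1) (k - 2) (k - 3)` quadruples of distinct labels. The component at `q` is the unique `w`
that is the cross ratio of a curve that represents `x`. -/
def crossRatioMap (k : ℕ) (x : DM k) : (Fin 4 ↪ Fin k) → OnePoint ℂ := fun q =>
  Classical.epsilon fun w => ∃ C : StableCurve k, DM.mk C = x ∧ C.IsCrossRatio q w

/-- The topology of the Deligne-Mumford space is the one given by the cross ratios. -/
instance (k : ℕ) : TopologicalSpace (DM k) := .induced (crossRatioMap k) inferInstance

/-- A chart of the Deligne-Mumford space by `k - 3` cross ratios around a point `center`, in the
standard smooth structure. -/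
structure CrossRatioChart (k : ℕ) where
  center : DM k
  chart : OpenPartialHomeomorph (DM k) (Fin (k - 3) → ℂ)
  center_mem : center ∈ chart.source
  /-- The coordinates are cross ratios. -/
  quad : Fin (k - 3) → (Fin 4 ↪ Fin k)
  chart_eq : ∀ x ∈ chart.source, ∀ m, crossRatioMap k x (quad m) = ((chart x m : ℂ) : OnePoint ℂ)
  /-- All cross ratios are smooth functions of the coordinates. -/
  smooth : ∀ q, IsSmoothToSphereOn (fun v => crossRatioMap k (chart.symm v) q) chart.target
  /-- The coordinates that are gluing parameters; they correspond to the edges of the center. -/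
  gluing : Set (Fin (k - 3))
  edge : Fin (k - 3) → Set (Set (Fin k))
  edge_bijOn : BijOn edge gluing center.edges
  /-- The domain is so small that all its points arise from the center by resolving nodes. -/
  edges_subset : ∀ x ∈ chart.source, x.edges ⊆ center.edges
  /-- A gluing parameter vanishes exactly at the curves that have the corresponding edge. -/
  gluing_eq_zero_iff : ∀ m ∈ gluing, ∀ x ∈ chart.source,
    crossRatioMap k x (quad m) = ((0 : ℂ) : OnePoint ℂ) ↔ edge m ∈ x.edges
  /-- The other coordinates stay away from `0`, `1`, `∞`. -/
  generic : ∀ m, m ∉ gluing → ∀ x ∈ chart.source,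
    crossRatioMap k x (quad m) ∉
      ({((0 : ℂ) : OnePoint ℂ), ((1 : ℂ) : OnePoint ℂ), OnePoint.infty} : Set (OnePoint ℂ))

open Classical in
/-- The reparametrization `Ψ` of `ℂ^ι`: it is `ψ` in the gluing coordinates and the identity in the
others. -/
def Psi (p : ℝ) (hp : 0 < p) {ι : Type} (A : Set ι) : (ι → ℂ) ≃ₜ (ι → ℂ) :=
  Homeomorph.piCongrRight fun i => if i ∈ A then psiHomeo p hp else Homeomorph.refl ℂ

/-- The reparametrized chart: if `φ` is the parametrization given by a cross ratio chart, this is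
the inverse of `φ ∘ Ψ`. -/
def CrossRatioChart.reparam {k : ℕ} (c : CrossRatioChart k) (p : ℝ) (hp : 0 < p) :
    SSChart (DM k) (Fin (k - 3)) :=
  ⟨c.chart.transHomeomorph (Psi p hp c.gluing).symm, c.gluing⟩

/-- All reparametrized cross ratio charts; these are the charts of the new structure. -/
def DMNewAtlas (k : ℕ) (p : ℝ) (hp : 0 < p) : Set (SSChart (DM k) (Fin (k - 3))) :=
  range fun c : CrossRatioChart k => c.reparam p hp

end DeligneMumford

end

/-! A stable curve is encoded by its family of views: each component `α` sees every label at a point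
of the sphere, the other components being collapsed. Three properties (`IsFamily`) govern such
families: two components are separated by a node, every component sees three distinct points, and
any three labels are separated by some component. Conversely, every finite nonempty family with
these properties is the family of a stable curve (`IsFamily.exists_stableCurve`), and Moebius
equivalent families belong to isomorphic curves. In the coordinate that puts three separated labels
at `0`, `1`, `∞`, a view consists of cross ratios; hence the cross ratios determine the curve
(`crossRatioMap_injective`). Edges can also be recognised from the vanishing of cross ratios
(`IsSplit`), and any two views satisfy one polynomial identity, `Related.four_term`.

Charts are built by induction on the number of labels. Some label `j` has, in the view of three
other labels `a`, `b`, `c`, a position `X` that is occupied by no other label, or by `a` only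
(`exists_isolated`). The new chart consists of `X` and a chart around the curve without `j`. The
four-term identity is linear in the position of `j` in any other view, and its solution is a vector
that does not vanish near the centre, so all positions of `j` depend smoothly on the coordinates.
The new edges are the lifts of the old ones and, in the second case, the edge that cuts off `{a,
j}`, which is present exactly when `X = 0`.

For stratified smoothness the main fact is `LocalChart.unitMultiple_prod`: near a point where it is
finite, a cross ratio is the product of the gluing parameters of the edges that separate its labels,
times a smooth nonvanishing factor `u`. Since `ψ` is multiplicative, `ψ⁻¹` of the cross ratio
composed with `Ψ` is the same monomial in the new gluing parameters times `ψ⁻¹ ∘ u ∘ Ψ`. This is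
`C¹` and smooth on strata, because `Ψ` is and `ψ⁻¹` is smooth away from `0`. The special values `1`
and `∞` reduce to `0`, as the Moebius maps that permute `0`, `1`, `∞` permute the cross ratios. The
vanishing locus of a cross ratio is a union of coordinate hyperplanes, so strata go to strata
monotonically. `Tame` collects these properties, and `isC1SSOn_sphereCoord` derives from them the
transition maps, the inclusion and the local extensions of charts. -/

noncomputable section

namespace DeligneMumford

section

/-! ### Homogeneous coordinates on the sphere -/

open Classical in
/-- The point of the sphere with homogeneous coordinates `[u : v]`. -/
def toSphere (u v : ℂ) : OnePoint ℂ := if v = 0 then OnePoint.infty else ((u / v : ℂ) : OnePoint ℂ)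

theorem toSphere_zero_right (u : ℂ) : toSphere u 0 = OnePoint.infty := by simp [toSphere]

theorem toSphere_of_ne {u v : ℂ} (hv : v ≠ 0) : toSphere u v = ((u / v : ℂ) : OnePoint ℂ) := by
  simp [toSphere, hv]

theorem toSphere_one (u : ℂ) : toSphere u 1 = (u : OnePoint ℂ) := by simp [toSphere]

@[simp] theorem homog_infty : homog OnePoint.infty = (1, 0) := rfl

@[simp] theorem homog_coe (z : ℂ) : homog (z : OnePoint ℂ) = (z, 1) := rfl

theorem homog_ne_zero (z : OnePoint ℂ) : (homog z).1 ≠ 0 ∨ (homog z).2 ≠ 0 := by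
  induction z using OnePoint.rec with
  | infty => left; simp
  | coe z => right; simp

theorem toSphere_homog (z : OnePoint ℂ) : toSphere (homog z).1 (homog z).2 = z := by
  induction z using OnePoint.rec with
  | infty => simp [toSphere]
  | coe z => simp [toSphere]

theorem homog_toSphere {u v : ℂ} (h : u ≠ 0 ∨ v ≠ 0) :
    ∃ s : ℂ, s ≠ 0 ∧ (homog (toSphere u v)).1 = s * u ∧ (homog (toSphere u v)).2 = s * v := by
  by_cases hv : v = 0
  · subst hv
    have hu : u ≠ 0 := by simpa using h
    exact ⟨u⁻¹, inv_ne_zero hu, by simp [toSphere, hu], by simp [toSphere]⟩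
  · exact ⟨v⁻¹, inv_ne_zero hv, by simp [toSphere, hv, div_eq_inv_mul], by simp [toSphere, hv]⟩

theorem toSphere_smul {s : ℂ} (hs : s ≠ 0) (u v : ℂ) :
    toSphere (s * u) (s * v) = toSphere u v := by
  by_cases hv : v = 0
  · simp [toSphere, hv]
  · simp [toSphere, hv, hs, mul_div_mul_left]

theorem toSphere_eq_iff {u v u' v' : ℂ} (h : u ≠ 0 ∨ v ≠ 0) (h' : u' ≠ 0 ∨ v' ≠ 0) :
    toSphere u v = toSphere u' v' ↔ u * v' = u' * v := by
  by_cases hv : v = 0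
  · subst hv
    have hu : u ≠ 0 := by simpa using h
    by_cases hv' : v' = 0
    · simp [toSphere, hv']
    · simp [toSphere, hv', hu]
  · by_cases hv' : v' = 0
    · subst hv'
      have hu : u' ≠ 0 := by simpa using h'
      simp [toSphere, hv, hu]
    · simp only [toSphere, hv, hv', if_false, OnePoint.coe_eq_coe]
      rw [div_eq_div_iff hv hv']

theorem toSphere_eq_zero_iff {u v : ℂ} (h : u ≠ 0 ∨ v ≠ 0) :
    toSphere u v = ((0 : ℂ) : OnePoint ℂ) ↔ u = 0 := by
  rw [← toSphere_one, toSphere_eq_iff h (by simp)]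
  simp

theorem toSphere_eq_infty_iff {u v : ℂ} : toSphere u v = OnePoint.infty ↔ v = 0 := by
  by_cases hv : v = 0 <;> simp [toSphere, hv]

@[simp] theorem homogSub_self (z : OnePoint ℂ) : homogSub z z = 0 := by simp [homogSub]

theorem homogSub_swap (z w : OnePoint ℂ) : homogSub z w = -homogSub w z := by
  unfold homogSub; ring

theorem homogSub_eq_zero_iff {z w : OnePoint ℂ} : homogSub z w = 0 ↔ z = w := by
  refine ⟨fun h => ?_, fun h => by rw [h, homogSub_self]⟩
  rw [← toSphere_homog z, ← toSphere_homog w, toSphere_eq_iff (homog_ne_zero z) (homog_ne_zero w)]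
  unfold homogSub at h
  linear_combination h

theorem homogSub_ne_zero {z w : OnePoint ℂ} (h : z ≠ w) : homogSub z w ≠ 0 :=
  fun h' => h (homogSub_eq_zero_iff.mp h')

theorem homogSub_coe (z w : ℂ) : homogSub (z : OnePoint ℂ) (w : OnePoint ℂ) = z - w := by
  simp [homogSub]

/-! ### Moebius transformations -/

theorem smul_toSphere (g : GL (Fin 2) ℂ) (z : OnePoint ℂ) :
    g • z = toSphere (g 0 0 * (homog z).1 + g 0 1 * (homog z).2)
      (g 1 0 * (homog z).1 + g 1 1 * (homog z).2) := by
  induction z using OnePoint.rec with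
  | infty => simp only [OnePoint.smul_infty_eq_ite, toSphere, homog_infty]; simp
  | coe z => simp only [OnePoint.smul_some_eq_ite, toSphere, homog_coe]; simp

theorem gl_det_ne_zero (g : GL (Fin 2) ℂ) : g 0 0 * g 1 1 - g 0 1 * g 1 0 ≠ 0 := by
  have := g.det_ne_zero
  rwa [Matrix.det_fin_two] at this

theorem homog_smul (g : GL (Fin 2) ℂ) (z : OnePoint ℂ) : ∃ s : ℂ, s ≠ 0 ∧
    (homog (g • z)).1 = s * (g 0 0 * (homog z).1 + g 0 1 * (homog z).2) ∧
    (homog (g • z)).2 = s * (g 1 0 * (homog z).1 + g 1 1 * (homog z).2) := by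
  rw [smul_toSphere]
  apply homog_toSphere
  by_contra! h
  have hd := gl_det_ne_zero g
  rcases homog_ne_zero z with hz | hz
  · apply hd
    apply mul_right_cancel₀ hz
    linear_combination g 1 1 * h.1 - g 0 1 * h.2
  · apply hd
    apply mul_right_cancel₀ hz
    linear_combination g 0 0 * h.2 - g 1 0 * h.1

/-- The factor `δ` is the determinant of `g`, and `s` corrects for the normalisation of `homog`. In
a cross ratio each point occurs once in the numerator and once in the denominator, so all these
factors cancel. -/
theorem homogSub_smul (g : GL (Fin 2) ℂ) : ∃ (δ : ℂ) (s : OnePoint ℂ → ℂ), δ ≠ 0 ∧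
    (∀ z, s z ≠ 0) ∧ ∀ z w, homogSub (g • z) (g • w) = δ * s z * s w * homogSub z w := by
  choose s hs h1 h2 using homog_smul g
  refine ⟨_, s, gl_det_ne_zero g, hs, fun z w => ?_⟩
  unfold homogSub
  rw [h1, h2, h1, h2]
  ring

/-- The cross ratio as a function of four points. -/
def cr (a b c d : OnePoint ℂ) : OnePoint ℂ :=
  toSphere (homogSub b c * homogSub d a) (homogSub a b * homogSub c d)

/-- No three of the four points coincide. -/
def NoThree (a b c d : OnePoint ℂ) : Prop :=
  ¬ (a = b ∧ b = c) ∧ ¬ (a = b ∧ b = d) ∧ ¬ (a = c ∧ c = d) ∧ ¬ (b = c ∧ c = d)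

theorem noThree_iff (z : Fin 4 → OnePoint ℂ) :
    (∀ a b c : Fin 4, a ≠ b → b ≠ c → a ≠ c → ¬ (z a = z b ∧ z b = z c)) ↔
      NoThree (z 0) (z 1) (z 2) (z 3) := by
  constructor
  · intro h
    exact ⟨h 0 1 2 (by decide) (by decide) (by decide), h 0 1 3 (by decide) (by decide) (by decide),
      h 0 2 3 (by decide) (by decide) (by decide), h 1 2 3 (by decide) (by decide) (by decide)⟩
  · rintro ⟨h1, h2, h3, h4⟩ a b c hab hbc hac
    fin_cases a <;> fin_cases b <;> fin_cases c <;>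
      first
        | exact absurd rfl hab
        | exact absurd rfl hbc
        | exact absurd rfl hac
        | (simp only [Fin.mk_one, Fin.zero_eta, Fin.reduceFinMk] at *; grind)

theorem noThree_of_distinct {a b c : OnePoint ℂ} (hab : a ≠ b) (hbc : b ≠ c) (hac : a ≠ c)
    (d : OnePoint ℂ) : NoThree a b c d := by
  unfold NoThree; grind

/-- Each bracket of the numerator shares a point with each bracket of the denominator, so if both
products vanish, three points coincide. -/
theorem NoThree.ne_zero {a b c d : OnePoint ℂ} (h : NoThree a b c d) :
    homogSub b c * homogSub d a ≠ 0 ∨ homogSub a b * homogSub c d ≠ 0 := by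
  by_contra! h'
  simp only [mul_eq_zero, homogSub_eq_zero_iff] at h'
  unfold NoThree at h
  grind

theorem NoThree.cr_eq_zero_iff {a b c d : OnePoint ℂ} (h : NoThree a b c d) :
    cr a b c d = ((0 : ℂ) : OnePoint ℂ) ↔ b = c ∨ a = d := by
  rw [cr, toSphere_eq_zero_iff h.ne_zero, mul_eq_zero, homogSub_eq_zero_iff, homogSub_eq_zero_iff,
    eq_comm (a := d)]

theorem cr_eq_infty_iff {a b c d : OnePoint ℂ} :
    cr a b c d = OnePoint.infty ↔ a = b ∨ c = d := by
  rw [cr, toSphere_eq_infty_iff, mul_eq_zero, homogSub_eq_zero_iff, homogSub_eq_zero_iff]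

theorem NoThree.cr_eq_iff {a b c d a' b' c' d' : OnePoint ℂ} (h : NoThree a b c d)
    (h' : NoThree a' b' c' d') : cr a b c d = cr a' b' c' d' ↔
      homogSub b c * homogSub d a * (homogSub a' b' * homogSub c' d') =
        homogSub b' c' * homogSub d' a' * (homogSub a b * homogSub c d) :=
  toSphere_eq_iff h.ne_zero h'.ne_zero

/-- Numerator and denominator are linear in the homogeneous coordinates of the fourth point; up to
sign, the determinant of the coefficients is the product of the three brackets of `a`, `b`, `c`. -/
theorem exists_gl_cr {a b c : OnePoint ℂ} (hab : a ≠ b) (hbc : b ≠ c) (hac : a ≠ c) :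
    ∃ g : GL (Fin 2) ℂ, ∀ z, cr a b c z = g • z := by
  have h1 := homogSub_ne_zero hab
  have h2 := homogSub_ne_zero hbc
  have h3 := homogSub_ne_zero hac
  let A : Matrix (Fin 2) (Fin 2) ℂ :=
    !![homogSub b c * (homog a).2, -(homogSub b c * (homog a).1);
      -(homogSub a b * (homog c).2), homogSub a b * (homog c).1]
  have hA : A.det ≠ 0 := by
    have : A.det = -(homogSub b c * homogSub a b * homogSub a c) := by
      simp only [A, Matrix.det_fin_two_of]
      rw [show homogSub a c = (homog a).1 * (homog c).2 - (homog c).1 * (homog a).2 from rfl]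
      ring
    rw [this]
    exact neg_ne_zero.mpr (mul_ne_zero (mul_ne_zero h2 h1) h3)
  refine ⟨Matrix.GeneralLinearGroup.mkOfDetNeZero A hA, fun z => ?_⟩
  rw [smul_toSphere, cr]
  have e1 : homogSub b c * homogSub z a = homogSub b c * (homog a).2 * (homog z).1 +
      -(homogSub b c * (homog a).1) * (homog z).2 := by
    rw [show homogSub z a = (homog z).1 * (homog a).2 - (homog a).1 * (homog z).2 from rfl]; ring
  have e2 : homogSub a b * homogSub c z = -(homogSub a b * (homog c).2) * (homog z).1 +
      homogSub a b * (homog c).1 * (homog z).2 := by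
    rw [show homogSub c z = (homog c).1 * (homog z).2 - (homog z).1 * (homog c).2 from rfl]; ring
  rw [e1, e2]
  simp [Matrix.GeneralLinearGroup.mkOfDetNeZero, A]

theorem cr_self_left {a b c : OnePoint ℂ} (hab : a ≠ b) (hbc : b ≠ c) (hac : a ≠ c) :
    cr a b c a = ((0 : ℂ) : OnePoint ℂ) :=
  ((noThree_of_distinct hab hbc hac a).cr_eq_zero_iff).mpr (Or.inr rfl)

theorem cr_self_right (a b c : OnePoint ℂ) : cr a b c c = OnePoint.infty :=
  cr_eq_infty_iff.mpr (Or.inr rfl)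

theorem cr_self_mid {a b c : OnePoint ℂ} (hab : a ≠ b) (hbc : b ≠ c) (hac : a ≠ c) :
    cr a b c b = ((1 : ℂ) : OnePoint ℂ) := by
  rw [← toSphere_one, cr, toSphere_eq_iff (noThree_of_distinct hab hbc hac b).ne_zero (by simp)]
  rw [homogSub_swap c b, homogSub_swap b a]; ring

theorem cr_zero_one_infty (z : OnePoint ℂ) :
    cr ((0 : ℂ) : OnePoint ℂ) ((1 : ℂ) : OnePoint ℂ) OnePoint.infty z = z := by
  conv_rhs => rw [← toSphere_homog z, ← toSphere_smul (neg_ne_zero.mpr one_ne_zero)]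
  simp [cr, homogSub]

theorem cr_inj {a b c z w : OnePoint ℂ} (hab : a ≠ b) (hbc : b ≠ c) (hac : a ≠ c) :
    cr a b c z = cr a b c w ↔ z = w := by
  obtain ⟨g, hg⟩ := exists_gl_cr hab hbc hac
  rw [hg, hg]
  exact (MulAction.injective g).eq_iff

/-! ### Two views of the same labels -/

variable {L : Type*}

/-- The positions `P` and `P'` of the labels on two components of a curve: there is a nonzero
bilinear form that vanishes at all pairs `(P l, P' l)`. If it has rank two, then `P` and `P'` differ by
a Moebius transformation, and if it has rank one, then each label sits at the node of one of the
two components. -/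
def Related (P P' : L → OnePoint ℂ) : Prop :=
  (∃ g : GL (Fin 2) ℂ, ∀ l, P' l = g • P l) ∨ ∃ n n', ∀ l, P l = n ∨ P' l = n'

theorem Related.smul {P P' : L → OnePoint ℂ} (h : Related P P') (g g' : GL (Fin 2) ℂ) :
    Related (fun l => g • P l) (fun l => g' • P' l) := by
  rcases h with ⟨g₀, hg⟩ | ⟨n, n', h⟩
  · exact Or.inl ⟨g' * g₀ * g⁻¹, fun l => by simp [hg, mul_smul]⟩
  · exact Or.inr ⟨g • n, g' • n', fun l => (h l).imp (congrArg _) (congrArg _)⟩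

/-- This is equality of cross ratios with denominators cleared, so it needs no assumption on
coincidences. Under a Moebius map both sides get the same factors. In the rank one case both sides
vanish unless `a`, `c` are at the node in one view and `b`, `d` at the node in the other, and then
the brackets agree up to order. -/
theorem Related.four_term {P P' : L → OnePoint ℂ} (h : Related P P') (a b c d : L) :
    homogSub (P b) (P c) * homogSub (P d) (P a) * (homogSub (P' a) (P' b) * homogSub (P' c) (P' d)) =
      homogSub (P' b) (P' c) * homogSub (P' d) (P' a) *
        (homogSub (P a) (P b) * homogSub (P c) (P d)) := by
  rcases h with ⟨g, hg⟩ | ⟨n, n', h⟩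
  · obtain ⟨δ, s, hδ, hs, h⟩ := homogSub_smul g
    simp only [hg, h]
    ring
  · have e := fun (x y : OnePoint ℂ) => homogSub_swap x y
    rcases h a with ha | ha <;> rcases h b with hb | hb <;> rcases h c with hc | hc <;>
      rcases h d with hd | hd <;> simp only [ha, hb, hc, hd, homogSub_self, mul_zero, zero_mul] <;>
      (try rw [e (P a) n]) <;> (try rw [e (P b) n]) <;> (try rw [e (P c) n]) <;>
      (try rw [e (P d) n]) <;> (try rw [e (P' a) n']) <;> (try rw [e (P' b) n']) <;>
      (try rw [e (P' c) n']) <;> (try rw [e (P' d) n']) <;> ring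

theorem Related.cr_eq {P P' : L → OnePoint ℂ} (h : Related P P') {a b c d : L}
    (h1 : NoThree (P a) (P b) (P c) (P d)) (h2 : NoThree (P' a) (P' b) (P' c) (P' d)) :
    cr (P a) (P b) (P c) (P d) = cr (P' a) (P' b) (P' c) (P' d) :=
  (h1.cr_eq_iff h2).mpr (h.four_term a b c d)

end

section

/-! ### Branches of a tree -/

section Tree

variable {V : Type*} {G : SimpleGraph V}

/-- A walk can enter `S` only across the edge from `α` to `β`. -/
theorem length_of_crossing (hG : G.Connected) {S : Set V} {α β : V}
    (hS : ∀ u v, G.Adj u v → u ∉ S → v ∈ S → u = α ∧ v = β) {u v : V} (p : G.Walk u v)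
    (hu : u ∉ S) (hv : v ∈ S) : G.dist u α + 1 + G.dist β v ≤ p.length := by
  induction p with
  | nil => exact absurd hv hu
  | @cons u w v h p ih =>
    rw [SimpleGraph.Walk.length_cons]
    by_cases hw : w ∈ S
    · obtain ⟨rfl, rfl⟩ := hS _ _ h hu hw
      have := SimpleGraph.dist_le p
      simp only [SimpleGraph.dist_self]
      omega
    · have h1 := ih hw hv
      have h2 : G.dist u α ≤ G.dist u w + G.dist w α := hG.dist_triangle
      rw [SimpleGraph.dist_eq_one_iff_adj.mpr h] at h2
      omega

theorem dist_of_crossing (hG : G.Connected) {S : Set V} {α β : V}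
    (hS : ∀ u v, G.Adj u v → u ∉ S → v ∈ S → u = α ∧ v = β) {u v : V}
    (hu : u ∉ S) (hv : v ∈ S) : G.dist u α + 1 + G.dist β v ≤ G.dist u v := by
  obtain ⟨p, hp⟩ := hG.exists_walk_length_eq_dist u v
  rw [← hp]
  exact length_of_crossing hG hS p hu hv

variable (G) in
/-- The vertices on the side of `β` of the edge `αβ`. -/
def branch (α β : V) : Set V := {γ | G.dist β γ < G.dist α γ}

/-- Identifies a branch with any set whose only entering edge is `αβ`. It serves for the components
left by deleting an edge, for sets of components in one direction of a family, and for images under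
tree isomorphisms. -/
theorem branch_eq_of_crossing (hG : G.Connected) {S : Set V} {α β : V} (hα : α ∉ S) (hβ : β ∈ S)
    (hS : ∀ u v, G.Adj u v → u ∉ S → v ∈ S → u = α ∧ v = β) : branch G α β = S := by
  ext γ
  by_cases hγ : γ ∈ S
  · have := dist_of_crossing hG hS hα hγ
    simp only [branch, mem_ofPred_eq, hγ, iff_true]
    omega
  · have hS' : ∀ u v, G.Adj u v → u ∉ Sᶜ → v ∈ Sᶜ → u = β ∧ v = α := fun u v h hu hv =>
      (hS v u h.symm hv (notMem_compl_iff.mp hu)).symm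
    have := dist_of_crossing hG hS' (notMem_compl_iff.mpr hβ) (mem_compl hγ)
    simp only [branch, mem_ofPred_eq, hγ, iff_false]
    omega

theorem branch_crossing (hG : G.IsTree) {α β : V} (h : G.Adj α β) {u v : V} (huv : G.Adj u v)
    (hu : u ∉ branch G α β) (hv : v ∈ branch G α β) : u = α ∧ v = β := by
  -- An edge of a tree is a bridge, so the part connected to `β` after its deletion does not contain
  -- `α`.
  set S : Set V := {γ | (G.deleteEdges {s(α, β)}).Reachable β γ} with hSdef
  have hβ : β ∈ S := SimpleGraph.Reachable.refl _
  have hα : α ∉ S := by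
    have h1 := SimpleGraph.isAcyclic_iff_forall_adj_isBridge.mp hG.isAcyclic h
    rw [SimpleGraph.isBridge_iff] at h1
    intro h2
    exact h1 (SimpleGraph.Reachable.symm h2)
  have hS : ∀ u v, G.Adj u v → u ∉ S → v ∈ S → u = α ∧ v = β := by
    intro u v huv hu hv
    by_cases he : s(u, v) = s(α, β)
    · rcases Sym2.eq_iff.mp he with h1 | h1
      · exact h1
      · exact absurd (h1.1 ▸ hβ) hu
    · refine absurd (SimpleGraph.Reachable.trans hv (SimpleGraph.Adj.reachable ?_)) hu
      rw [SimpleGraph.deleteEdges_adj]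
      exact ⟨huv.symm, by rwa [Sym2.eq_swap (a := v), mem_singleton_iff]⟩
  rw [branch_eq_of_crossing hG.connected hα hβ hS] at hu hv
  exact hS u v huv hu hv

theorem mem_branch_self {α β : V} (h : G.Adj α β) : β ∈ branch G α β := by
  simp [branch, SimpleGraph.dist_eq_one_iff_adj.mpr h]

theorem notMem_branch_self (α β : V) : α ∉ branch G α β := by
  simp [branch]

theorem notMem_branch_iff (hG : G.IsTree) {α β : V} (h : G.Adj α β) {γ : V} :
    γ ∉ branch G α β ↔ γ ∈ branch G β α := by
  have := hG.dist_ne_of_adj γ h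
  rw [SimpleGraph.dist_comm, SimpleGraph.dist_comm (u := γ)] at this
  simp only [branch, mem_ofPred_eq]
  omega

theorem dist_branch (hG : G.IsTree) {α β : V} (h : G.Adj α β) {u v : V}
    (hu : u ∉ branch G α β) (hv : v ∈ branch G α β) :
    G.dist u v = G.dist u α + 1 + G.dist β v := by
  have h1 := dist_of_crossing hG.connected (fun u v huv => branch_crossing hG h huv) hu hv
  have h2 : G.dist u v ≤ G.dist u α + G.dist α v := hG.connected.dist_triangle
  have h3 : G.dist α v ≤ G.dist α β + G.dist β v := hG.connected.dist_triangle
  rw [SimpleGraph.dist_eq_one_iff_adj.mpr h] at h3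
  omega

theorem exists_branch (hG : G.Connected) {α γ : V} (h : γ ≠ α) :
    ∃ β, G.Adj α β ∧ γ ∈ branch G α β := by
  obtain ⟨p, hp⟩ := hG.exists_walk_length_eq_dist α γ
  cases p with
  | nil => exact absurd rfl h
  | cons h p =>
    refine ⟨_, h, ?_⟩
    have := SimpleGraph.dist_le p
    rw [SimpleGraph.Walk.length_cons] at hp
    simp only [branch, mem_ofPred_eq]
    omega

theorem branch_unique (hG : G.IsTree) {α β β' γ : V} (h : G.Adj α β) (h' : G.Adj α β')
    (hγ : γ ∈ branch G α β) (hγ' : γ ∈ branch G α β') : β = β' := by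
  by_contra hne
  have h1 : β' ∉ branch G α β := fun h1 =>
    hne (branch_crossing hG h h' (notMem_branch_self α β) h1).2.symm
  have h2 := dist_branch hG h h1 hγ
  have h3 := dist_branch hG h (notMem_branch_self α β) hγ
  have h4 : G.dist β' γ < G.dist α γ := hγ'
  rw [SimpleGraph.dist_self] at h3
  omega

variable (G) in
open Classical in
/-- The neighbour of `α` in the direction of `γ`. -/
def next (α γ : V) : V := if h : ∃ β, G.Adj α β ∧ γ ∈ branch G α β then h.choose else α

theorem next_spec (hG : G.IsTree) {α γ : V} (h : γ ≠ α) :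
    G.Adj α (next G α γ) ∧ γ ∈ branch G α (next G α γ) := by
  have h1 := exists_branch hG.connected h
  rw [next, dif_pos h1]
  exact h1.choose_spec

theorem next_eq (hG : G.IsTree) {α β γ : V} (h : G.Adj α β) (hγ : γ ∈ branch G α β) :
    next G α γ = β := by
  have h1 : γ ≠ α := fun h1 => notMem_branch_self α β (h1 ▸ hγ)
  exact branch_unique hG (next_spec hG h1).1 h (next_spec hG h1).2 hγ

theorem next_of_adj (hG : G.IsTree) {α β : V} (h : G.Adj α β) : next G α β = β :=
  next_eq hG h (mem_branch_self h)

theorem mem_branch_iff_next (hG : G.IsTree) {α β γ : V} (h : G.Adj α β) :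
    γ ∈ branch G α β ↔ γ ≠ α ∧ next G α γ = β := by
  refine ⟨fun hγ => ⟨fun h1 => notMem_branch_self α β (h1 ▸ hγ), next_eq hG h hγ⟩, ?_⟩
  rintro ⟨h1, rfl⟩
  exact (next_spec hG h1).2

/-- Since `γ` is outside the branch at `α` that contains `β`, the path from `β` to `γ` passes
through `α`. -/
theorem next_eq_of_next_ne (hG : G.IsTree) {α β γ : V} (hβ : β ≠ α)
    (h : γ = α ∨ next G α γ ≠ next G α β) : γ ≠ β ∧ next G β γ = next G β α := by
  obtain ⟨h1, h2⟩ := next_spec hG hβ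
  have h3 : γ ∉ branch G α (next G α β) := fun h4 => by
    rw [mem_branch_iff_next hG h1] at h4
    rcases h with h | h
    · exact h4.1 h
    · exact h h4.2
  have h5 : γ ≠ β := fun h5 => h3 (h5 ▸ h2)
  refine ⟨h5, ?_⟩
  obtain ⟨h6, h7⟩ := next_spec hG hβ.symm
  refine next_eq hG h6 ?_
  have e1 := dist_branch hG h1 h3 h2
  have e2 := dist_branch hG h1 (notMem_branch_self α _) h2
  have e3 : G.dist (next G β α) γ ≤ G.dist (next G β α) α + G.dist α γ :=
    hG.connected.dist_triangle
  have e4 : G.dist (next G β α) α < G.dist β α := h7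
  rw [SimpleGraph.dist_self] at e2
  rw [SimpleGraph.dist_comm] at e1 e2
  rw [SimpleGraph.dist_comm (u := α) (v := γ)] at e3
  simp only [branch, mem_ofPred_eq]
  omega

theorem next_eq_next_of_adj (hG : G.IsTree) {α β γ : V} (h : G.Adj α β) (hα : α ≠ γ) (hβ : β ≠ γ) :
    next G γ α = next G γ β := by
  by_contra hne
  obtain ⟨h1, h2⟩ := next_spec hG hα
  have h3 : β ∉ branch G γ (next G γ α) := fun h3 => by
    rw [mem_branch_iff_next hG h1] at h3
    exact hne h3.2.symm
  exact hβ (branch_crossing hG h1 h.symm h3 h2).1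

/-- The witness is the neighbour of `α` towards `β`, which lies strictly between the two. -/
theorem next_ne_of_not_adj (hG : G.IsTree) {α β : V} (hne : α ≠ β) (h : ¬ G.Adj α β) :
    ∃ γ, γ ≠ α ∧ γ ≠ β ∧ G.Adj γ α ∧ next G γ α ≠ next G γ β := by
  obtain ⟨h1, h2⟩ := next_spec hG hne.symm
  refine ⟨next G α β, h1.ne', fun h3 => h (by rwa [h3] at h1), h1.symm, fun h4 => ?_⟩
  rw [next_of_adj hG h1.symm] at h4
  have h5 : β ≠ next G α β := fun h3 => h (by rwa [← h3] at h1)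
  have h6 := (next_spec hG h5).2
  rw [← h4] at h6
  exact ((notMem_branch_iff hG h1).mpr h6) h2

end Tree

end

section

/-! ### Families of views -/

/-- The three points are pairwise distinct. -/
def Distinct3 {X : Type*} (a b c : X) : Prop := a ≠ b ∧ b ≠ c ∧ a ≠ c

/-- `P α l` is the position of the label `l` seen from the component `α`. These are the properties
of such positions on a stable curve: two components are separated by a node, each component has three
special points, and any three labels are separated by some component. -/
structure IsFamily {V L : Type*} (P : V → L → OnePoint ℂ) : Prop where
  cross : ∀ α β, α ≠ β → ∃ n n', ∀ l, P α l = n ∨ P β l = n'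
  three : ∀ α, ∃ a b c, Distinct3 (P α a) (P α b) (P α c)
  median : ∀ a b c, Distinct3 a b c → ∃ α, Distinct3 (P α a) (P α b) (P α c)

theorem Distinct3.exists_ne {L X : Type*} {f : L → X} {a b c : L} (h : Distinct3 (f a) (f b) (f c))
    (x y : X) : ∃ l, f l ≠ x ∧ f l ≠ y := by
  unfold Distinct3 at h
  by_contra! h'
  have h1 := h' a
  have h2 := h' b
  have h3 := h' c
  by_cases f a = x <;> by_cases f b = x <;> grind

theorem Distinct3.exists_pair_ne {L X : Type*} {f : L → X} {a b c : L}
    (h : Distinct3 (f a) (f b) (f c)) (x : X) : ∃ l l', f l ≠ x ∧ f l' ≠ x ∧ f l ≠ f l' := by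
  unfold Distinct3 at h
  by_contra! h'
  have h1 := h' a b
  have h2 := h' b c
  have h3 := h' a c
  by_cases f a = x <;> by_cases f b = x <;> grind

theorem Distinct3.of_map {L X : Type*} {f : L → X} {a b c : L} (h : Distinct3 (f a) (f b) (f c)) :
    Distinct3 a b c :=
  ⟨fun e => h.1 (e ▸ rfl), fun e => h.2.1 (e ▸ rfl), fun e => h.2.2 (e ▸ rfl)⟩

/-- If `n ≠ m`, a label off both forces `n' = m'`, and a label off `n'` would then sit at both `n`
and `m`. -/
theorem cross_unique {L X : Type*} {f g : L → X} (hf : ∃ a b c, Distinct3 (f a) (f b) (f c))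
    (hg : ∃ a b c, Distinct3 (g a) (g b) (g c)) {n n' m m' : X} (h : ∀ l, f l = n ∨ g l = n')
    (h' : ∀ l, f l = m ∨ g l = m') : n = m := by
  by_contra hne
  obtain ⟨a, b, c, hf⟩ := hf
  obtain ⟨a', b', c', hg⟩ := hg
  obtain ⟨l, h1, h2⟩ := hf.exists_ne n m
  obtain ⟨l', h3, -⟩ := hg.exists_ne n' n'
  have e1 := h l
  have e2 := h' l
  have e3 := h l'
  have e4 := h' l'
  grind

section Family

variable {V L : Type*} {P : V → L → OnePoint ℂ}

variable (P) in
/-- The position on `α` of the node that leads to `β`. -/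
def dir (α β : V) : OnePoint ℂ := Classical.epsilon fun n => ∃ n', ∀ l, P α l = n ∨ P β l = n'

namespace IsFamily

variable (h : IsFamily P)
include h

theorem dir_eq {α β : V} {n n' : OnePoint ℂ} (hn : ∀ l, P α l = n ∨ P β l = n') :
    dir P α β = n := by
  obtain ⟨m', hm⟩ : ∃ n', ∀ l, P α l = dir P α β ∨ P β l = n' :=
    Classical.epsilon_spec (p := fun n => ∃ n', ∀ l, P α l = n ∨ P β l = n') ⟨n, n', hn⟩
  exact cross_unique (h.three α) (h.three β) hm hn

theorem dir_spec {α β : V} (hne : α ≠ β) (l : L) : P α l = dir P α β ∨ P β l = dir P β α := by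
  obtain ⟨n, n', hn⟩ := h.cross α β hne
  rw [h.dir_eq hn, h.dir_eq (α := β) (β := α) (fun l => (hn l).symm)]
  exact hn l

theorem eq_dir {α β : V} (hne : α ≠ β) {l : L} (hl : P α l ≠ dir P α β) : P β l = dir P β α :=
  (h.dir_spec hne l).resolve_left hl

theorem exists_ne (α : V) (x y : OnePoint ℂ) : ∃ l, P α l ≠ x ∧ P α l ≠ y := by
  obtain ⟨a, b, c, habc⟩ := h.three α
  exact habc.exists_ne x y

theorem exists_pair_ne (α : V) (x : OnePoint ℂ) :
    ∃ l l', P α l ≠ x ∧ P α l' ≠ x ∧ P α l ≠ P α l' := by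
  obtain ⟨a, b, c, habc⟩ := h.three α
  exact habc.exists_pair_ne x

theorem related (α β : V) : Related (P α) (P β) := by
  by_cases hne : α = β
  · subst hne
    exact Or.inl ⟨1, fun l => by simp⟩
  · exact Or.inr (h.cross α β hne)

/-- A label that `γ` sees at neither of its two nodes sits at `dir P α γ` on `α` and at `dir P β γ`
on `β`. Were the conclusion false, it would also sit at `dir P β α`, and following a label that is
elsewhere on `β` gives a contradiction. -/
theorem dir_eq_of_dir_ne {α β γ : V} (hγ : γ ≠ α) (hγ' : γ ≠ β) (hne : α ≠ β)
    (hd : dir P γ α ≠ dir P γ β) : dir P α γ = dir P α β := by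
  obtain ⟨l, h1, h2⟩ := h.exists_ne γ (dir P γ α) (dir P γ β)
  have h3 := h.eq_dir hγ h1
  have h4 := h.eq_dir hγ' h2
  by_contra h5
  have h6 := h.eq_dir hne (l := l) (by rwa [h3])
  obtain ⟨l', h7, h8⟩ := h.exists_ne β (dir P β α) (dir P β α)
  have h9 := h.eq_dir hne.symm h7
  have h10 := h.eq_dir hγ.symm (l := l') (by rw [h9]; exact fun e => h5 e.symm)
  have h11 := h.eq_dir hγ' (l := l') (by rwa [h10])
  exact h7 (h11.trans (h4.symm.trans h6))

/-- For distinct components, `cross` would confine all labels on `α` to the two points `n` and `g⁻¹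
• n'`. -/
theorem eq_of_smul {α β : V} {g : GL (Fin 2) ℂ} (hg : ∀ l, P β l = g • P α l) : α = β := by
  by_contra hne
  obtain ⟨n, n', hn⟩ := h.cross α β hne
  obtain ⟨l, h1, h2⟩ := h.exists_ne α n (g⁻¹ • n')
  rcases hn l with h3 | h3
  · exact h1 h3
  · exact h2 (by rw [← h3, hg, inv_smul_smul])

theorem exists_noThree (q : Fin 4 ↪ L) :
    ∃ α, NoThree (P α (q 0)) (P α (q 1)) (P α (q 2)) (P α (q 3)) := by
  obtain ⟨α, h1, h2, h3⟩ := h.median (q 0) (q 1) (q 2)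
    ⟨q.injective.ne (by decide), q.injective.ne (by decide), q.injective.ne (by decide)⟩
  exact ⟨α, noThree_of_distinct h1 h2 h3 _⟩

theorem cr_eq {α β : V} {a b c d : L} (h1 : NoThree (P α a) (P α b) (P α c) (P α d))
    (h2 : NoThree (P β a) (P β b) (P β c) (P β d)) :
    cr (P α a) (P α b) (P α c) (P α d) = cr (P β a) (P β b) (P β c) (P β d) :=
  (h.related α β).cr_eq h1 h2

end IsFamily

end Family

/-! ### The family of a stable curve -/

namespace StableCurve

variable {k : ℕ} (C : StableCurve k)

theorem side_eq (α β : Fin C.n) : C.side α β = {i | C.comp i ∈ branch C.tree α β} := rfl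

theorem proj_of_comp_eq {α : Fin C.n} {i : Fin k} (h : C.comp i = α) : C.proj α i = C.pos i := by
  rw [proj, dif_neg]
  rintro ⟨β, -, hβ⟩
  rw [side_eq, mem_ofPred_eq, h] at hβ
  exact notMem_branch_self α β hβ

theorem proj_of_mem_side {α β : Fin C.n} {i : Fin k} (h : C.tree.Adj α β) (hi : i ∈ C.side α β) :
    C.proj α i = C.node α β := by
  have h1 : ∃ β, C.tree.Adj α β ∧ i ∈ C.side α β := ⟨β, h, hi⟩
  rw [proj, dif_pos h1]
  rw [branch_unique C.isTree h1.choose_spec.1 h h1.choose_spec.2 hi]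

theorem proj_of_comp_ne {α : Fin C.n} {i : Fin k} (h : C.comp i ≠ α) :
    C.proj α i = C.node α (next C.tree α (C.comp i)) :=
  have h1 := next_spec C.isTree h
  C.proj_of_mem_side h1.1 h1.2

theorem node_eq_iff {α β γ : Fin C.n} (h : C.tree.Adj α β) (h' : C.tree.Adj α γ) :
    C.node α β = C.node α γ ↔ β = γ :=
  ⟨C.node_injective α β γ h h', fun e => e ▸ rfl⟩

theorem proj_eq_node_iff {α β : Fin C.n} {i : Fin k} (h : C.tree.Adj α β) :
    C.proj α i = C.node α β ↔ i ∈ C.side α β := by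
  refine ⟨fun h1 => ?_, C.proj_of_mem_side h⟩
  by_cases h2 : C.comp i = α
  · rw [C.proj_of_comp_eq h2] at h1
    exact absurd h1.symm (C.node_ne_pos α β i h h2)
  · rw [C.proj_of_comp_ne h2] at h1
    have h3 := next_spec C.isTree h2
    rw [C.node_eq_iff h3.1 h] at h1
    rw [← h1]
    exact h3.2

theorem proj_cross {α β : Fin C.n} (h : α ≠ β) (i : Fin k) :
    C.proj α i = C.node α (next C.tree α β) ∨ C.proj β i = C.node β (next C.tree β α) := by
  by_cases h1 : C.comp i ≠ α ∧ next C.tree α (C.comp i) = next C.tree α β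
  · left
    rw [C.proj_of_comp_ne h1.1, h1.2]
  · right
    have h2 : C.comp i = α ∨ next C.tree α (C.comp i) ≠ next C.tree α β := by tauto
    obtain ⟨h3, h4⟩ := next_eq_of_next_ne C.isTree h.symm h2
    rw [C.proj_of_comp_ne h3, h4]

/-- A vertex of the branch at maximal distance from `α` is a leaf, and by stability a leaf carries a
marked point. -/
theorem exists_mem_side {α β : Fin C.n} (h : C.tree.Adj α β) : ∃ i, i ∈ C.side α β := by
  obtain ⟨γ, hγ, hmax⟩ := (Set.toFinite (branch C.tree α β)).exists_maximalFor
    (fun γ => C.tree.dist α γ) _ ⟨β, mem_branch_self h⟩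
  have hγα : γ ≠ α := fun e => notMem_branch_self α β (e ▸ hγ)
  have h1 : {δ | C.tree.Adj γ δ} ⊆ {next C.tree γ α} := by
    intro δ hδ
    rw [mem_singleton_iff]
    refine (next_eq C.isTree hδ ?_).symm
    by_contra h2
    rw [notMem_branch_iff C.isTree hδ] at h2
    have h3 : C.tree.dist γ α < C.tree.dist δ α := h2
    rw [SimpleGraph.dist_comm, SimpleGraph.dist_comm (u := δ)] at h3
    have h4 : δ ∈ branch C.tree α β := by
      by_contra h4
      have h5 := branch_crossing C.isTree h hδ.symm h4 hγ
      rw [h5.1] at h3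
      simp at h3
    have h5 := hmax h4 h3.le
    dsimp only at h5
    omega
  have h2 : {δ | C.tree.Adj γ δ}.ncard ≤ 1 := by
    refine (Set.ncard_le_ncard h1).trans ?_
    simp
  have h3 := C.stable γ
  have h4 : {i | C.comp i = γ}.Nonempty := by
    rw [← Set.ncard_pos]
    omega
  obtain ⟨i, hi⟩ := h4
  refine ⟨i, ?_⟩
  rw [side_eq, mem_ofPred_eq, show C.comp i = γ from hi]
  exact hγ

/-- By `exists_mem_side` every node of `α` is the position of some label, so the three special
points required by stability are all seen. -/
theorem proj_three (α : Fin C.n) :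
    ∃ a b c, Distinct3 (C.proj α a) (C.proj α b) (C.proj α c) := by
  have h1 : Set.InjOn (C.node α) {β | C.tree.Adj α β} := fun β hβ γ hγ e =>
    C.node_injective α β γ hβ hγ e
  have h2 : Set.InjOn C.pos {i | C.comp i = α} := fun i hi j hj e =>
    C.pos_injective i j (hi.trans hj.symm) e
  have h3 : Disjoint (C.node α '' {β | C.tree.Adj α β}) (C.pos '' {i | C.comp i = α}) := by
    rw [Set.disjoint_left]
    rintro _ ⟨β, hβ, rfl⟩ ⟨i, hi, e⟩
    exact C.node_ne_pos α β i hβ hi e.symm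
  have h4 : C.node α '' {β | C.tree.Adj α β} ∪ C.pos '' {i | C.comp i = α} ⊆
      range (C.proj α) := by
    rintro _ (⟨β, hβ, rfl⟩ | ⟨i, hi, rfl⟩)
    · obtain ⟨i, hi⟩ := C.exists_mem_side hβ
      exact ⟨i, C.proj_of_mem_side hβ hi⟩
    · exact ⟨i, C.proj_of_comp_eq hi⟩
  have h5 : 2 < (range (C.proj α)).ncard := by
    have h6 := Set.ncard_le_ncard h4 (Set.finite_range _)
    rw [Set.ncard_union_eq h3 (Set.toFinite _) (Set.toFinite _), h1.ncard_image,
      h2.ncard_image] at h6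
    exact lt_of_lt_of_le (C.stable α) h6
  obtain ⟨x, y, z, ⟨a, rfl⟩, ⟨b, rfl⟩, ⟨c, rfl⟩, h6, h7, h8⟩ :=
    (Set.two_lt_ncard_iff (Set.finite_range _)).mp h5
  exact ⟨a, b, c, h6, h8, h7⟩

theorem dist_next_lt {α β : Fin C.n} {i j : Fin k} (h : C.tree.Adj α β) (hi : i ∈ C.side α β)
    (hj : j ∈ C.side α β) (l : Fin k) :
    C.tree.dist β (C.comp i) + C.tree.dist β (C.comp j) + C.tree.dist β (C.comp l) <
      C.tree.dist α (C.comp i) + C.tree.dist α (C.comp j) + C.tree.dist α (C.comp l) := by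
  have h1 : C.tree.dist β (C.comp i) < C.tree.dist α (C.comp i) := hi
  have h2 : C.tree.dist β (C.comp j) < C.tree.dist α (C.comp j) := hj
  have h3 : C.tree.dist β (C.comp l) ≤ C.tree.dist β α + C.tree.dist α (C.comp l) :=
    C.isTree.connected.dist_triangle
  rw [SimpleGraph.dist_eq_one_iff_adj.mpr h.symm] at h3
  omega

theorem exists_side_of_proj_eq {α : Fin C.n} {i j : Fin k} (hij : i ≠ j)
    (h : C.proj α i = C.proj α j) :
    ∃ β, C.tree.Adj α β ∧ C.node α β = C.proj α i ∧ i ∈ C.side α β ∧ j ∈ C.side α β := by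
  by_cases hi : C.comp i = α
  · by_cases hj : C.comp j = α
    · rw [C.proj_of_comp_eq hi, C.proj_of_comp_eq hj] at h
      exact absurd (C.pos_injective i j (hi.trans hj.symm) h) hij
    · rw [C.proj_of_comp_eq hi, C.proj_of_comp_ne hj] at h
      exact absurd h.symm (C.node_ne_pos _ _ _ (next_spec C.isTree hj).1 hi)
  · have h1 := next_spec C.isTree hi
    refine ⟨_, h1.1, (C.proj_of_comp_ne hi).symm, h1.2, ?_⟩
    rw [← C.proj_eq_node_iff h1.1, ← h, C.proj_of_comp_ne hi]

theorem isFamily : IsFamily C.proj where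
  cross α β h := ⟨_, _, C.proj_cross h⟩
  three := C.proj_three
  median a b c habc := by
    -- The median minimises the sum of the distances to the three components. If two labels
    -- coincided there, a step across their common node would lower two distances by one and raise
    -- the third by at most one.
    obtain ⟨α, -, hmin⟩ := (Set.toFinite (univ : Set (Fin C.n))).exists_minimalFor
      (fun α => C.tree.dist α (C.comp a) + C.tree.dist α (C.comp b) + C.tree.dist α (C.comp c)) _
      ⟨C.comp a, trivial⟩
    refine ⟨α, fun e => ?_, fun e => ?_, fun e => ?_⟩
    · obtain ⟨β, h1, -, h2, h3⟩ := C.exists_side_of_proj_eq habc.1 e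
      have h4 := C.dist_next_lt h1 h2 h3 c
      have := hmin (mem_univ β) (by dsimp only; omega)
      dsimp only at this
      omega
    · obtain ⟨β, h1, -, h2, h3⟩ := C.exists_side_of_proj_eq habc.2.1 e
      have h4 := C.dist_next_lt h1 h2 h3 a
      have := hmin (mem_univ β) (by dsimp only; omega)
      dsimp only at this
      omega
    · obtain ⟨β, h1, -, h2, h3⟩ := C.exists_side_of_proj_eq habc.2.2 e
      have h4 := C.dist_next_lt h1 h2 h3 b
      have := hmin (mem_univ β) (by dsimp only; omega)
      dsimp only at this
      omega

theorem dir_eq_node {α β : Fin C.n} (h : α ≠ β) : dir C.proj α β = C.node α (next C.tree α β) :=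
  C.isFamily.dir_eq (C.proj_cross h)

theorem dir_eq_node_of_adj {α β : Fin C.n} (h : C.tree.Adj α β) :
    dir C.proj α β = C.node α β := by
  rw [C.dir_eq_node h.ne, next_of_adj C.isTree h]

/-- The right-hand side involves the views only, so the family determines the tree; the same
condition defines `familyGraph`. -/
theorem adj_iff {α β : Fin C.n} : C.tree.Adj α β ↔
    α ≠ β ∧ ∀ γ, γ ≠ α → γ ≠ β → dir C.proj γ α = dir C.proj γ β := by
  refine ⟨fun h => ⟨h.ne, fun γ h1 h2 => ?_⟩, fun h => ?_⟩
  · rw [C.dir_eq_node h1, C.dir_eq_node h2, next_eq_next_of_adj C.isTree h h1.symm h2.symm]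
  · by_contra h1
    obtain ⟨γ, h2, h3, h4, h5⟩ := next_ne_of_not_adj C.isTree h.1 h1
    have h6 := h.2 γ h2 h3
    rw [C.dir_eq_node h2, C.dir_eq_node h3,
      C.node_eq_iff (next_spec C.isTree h2.symm).1 (next_spec C.isTree h3.symm).1] at h6
    exact h5 h6

theorem comp_eq_iff {α : Fin C.n} {i : Fin k} :
    C.comp i = α ↔ ∀ β, β ≠ α → C.proj α i ≠ dir C.proj α β := by
  refine ⟨fun h β hβ => ?_, fun h => ?_⟩
  · rw [C.proj_of_comp_eq h, C.dir_eq_node hβ.symm]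
    exact (C.node_ne_pos _ _ _ (next_spec C.isTree hβ).1 h).symm
  · by_contra h1
    refine h _ h1 ?_
    rw [C.proj_of_comp_ne h1, C.dir_eq_node (Ne.symm h1)]

end StableCurve

end

section

/-! ### The stable curve of a family -/

section FamilyTree

variable {V L : Type*} {P : V → L → OnePoint ℂ}

variable (P) in
/-- The components strictly between `α` and `β`. -/
def between (α β : V) : Set V := {γ | γ ≠ α ∧ γ ≠ β ∧ dir P γ α ≠ dir P γ β}

variable (P) in
/-- Two components are adjacent if there is no component between them. -/
def familyGraph : SimpleGraph V where
  Adj α β := α ≠ β ∧ ∀ γ, γ ≠ α → γ ≠ β → dir P γ α = dir P γ β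
  symm := ⟨fun _ _ h => ⟨h.1.symm, fun γ h1 h2 => (h.2 γ h2 h1).symm⟩⟩
  loopless := ⟨fun _ h => h.1 rfl⟩

theorem familyGraph_adj_iff {α β : V} :
    (familyGraph P).Adj α β ↔ α ≠ β ∧ between P α β = ∅ := by
  refine and_congr_right fun _ => ?_
  rw [Set.eq_empty_iff_forall_notMem]
  refine forall_congr' fun γ => ?_
  simp only [between, mem_ofPred_eq]
  tauto

namespace IsFamily

variable (h : IsFamily P)
include h

/-- Makes the interval between two components a measure for the inductions that follow. -/
theorem between_ssubset {α β γ : V} (hne : α ≠ β) (hγ : γ ∈ between P α β) :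
    between P α γ ⊂ between P α β := by
  obtain ⟨h1, h2, h3⟩ := hγ
  refine (Set.ssubset_iff_of_subset ?_).mpr ⟨γ, ⟨h1, h2, h3⟩, fun h4 => h4.2.1 rfl⟩
  rintro δ ⟨h4, h5, h6⟩
  refine ⟨h4, ?_, fun h7 => ?_⟩
  · rintro rfl
    exact h6 (h.dir_eq_of_dir_ne h2 h1 hne.symm h3.symm).symm
  · by_cases h8 : δ = β
    · subst h8
      exact h6 (h.dir_eq_of_dir_ne h2 h1 hne.symm h3.symm).symm
    · have h9 := h.dir_eq_of_dir_ne h4 h5 h1.symm h6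
      have h10 := h.dir_eq_of_dir_ne h5 h4 h1 h6.symm
      rw [h7] at h6
      have h11 := h.dir_eq_of_dir_ne h5 h8 h2 h6.symm
      exact h3 (h10.symm.trans h11)

/-- Among the components in the direction of `β`, one with minimal interval from `α` is adjacent: a
component strictly between would have the same direction and a smaller interval. -/
theorem exists_adj [Finite V] {α β : V} (hne : α ≠ β) :
    ∃ γ, (familyGraph P).Adj α γ ∧ dir P α γ = dir P α β := by
  obtain ⟨γ, ⟨h1, h2⟩, hmin⟩ := (Set.toFinite {γ | α ≠ γ ∧ dir P α γ = dir P α β}).exists_minimalFor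
    (fun γ => between P α γ) _ ⟨β, hne, rfl⟩
  refine ⟨γ, familyGraph_adj_iff.mpr ⟨h1, ?_⟩, h2⟩
  by_contra h3
  obtain ⟨δ, hδ⟩ := Set.nonempty_iff_ne_empty.mpr h3
  have h4 := h.between_ssubset h1 hδ
  exact h4.not_subset (hmin ⟨hδ.1.symm, (h.dir_eq_of_dir_ne hδ.1 hδ.2.1 h1 hδ.2.2).trans h2⟩
    h4.subset)

theorem familyGraph_reachable [Finite V] (α β : V) : (familyGraph P).Reachable α β := by
  suffices H : ∀ n, ∀ β, (between P α β).ncard = n → (familyGraph P).Reachable α β from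
    H _ β rfl
  intro n
  induction n using Nat.strong_induction_on generalizing α with
  | _ n ih =>
    intro β hn
    by_cases hne : α = β
    · exact hne ▸ SimpleGraph.Reachable.refl _
    by_cases hb : between P α β = ∅
    · exact (familyGraph_adj_iff.mpr ⟨hne, hb⟩).reachable
    obtain ⟨γ, hγ⟩ := Set.nonempty_iff_ne_empty.mpr hb
    have h1 := Set.ncard_lt_ncard (h.between_ssubset hne hγ) (Set.toFinite _)
    have h2 := Set.ncard_lt_ncard (h.between_ssubset (Ne.symm hne) (γ := γ)
      ⟨hγ.2.1, hγ.1, hγ.2.2.symm⟩) (Set.toFinite _)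
    have e : between P β α = between P α β := by
      ext δ
      simp only [between, mem_ofPred_eq]
      tauto
    rw [e] at h2
    exact (ih _ (hn ▸ h1) α γ rfl).trans (ih _ (hn ▸ h2) β γ rfl).symm

/-- Labels that `α` sees away from the direction of `μ` coincide on `μ`; as `μ` separates `b` from
`c`, it must lie in the direction `x`. -/
theorem dir_of_median {α μ : V} {a b c : L} (hμ : Distinct3 (P μ a) (P μ b) (P μ c)) {x : OnePoint ℂ}
    (ha : P α a ≠ x) (hb : P α b = x) (hc : P α c = x) :
    α ≠ μ ∧ dir P α μ = x ∧ P μ a = dir P μ α := by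
  have hne : α ≠ μ := by
    rintro rfl
    exact hμ.2.1 (hb.trans hc.symm)
  have h1 : dir P α μ = x := by
    by_contra h2
    have h3 := h.eq_dir hne (l := b) (by rw [hb]; exact Ne.symm h2)
    have h4 := h.eq_dir hne (l := c) (by rw [hc]; exact Ne.symm h2)
    exact hμ.2.1 (h3.trans h4.symm)
  exact ⟨hne, h1, h.eq_dir hne (by rwa [h1])⟩

/-- If `α` had distinct neighbours `β`, `γ` in one direction, take labels `a`, `b`, `c` on `α`, `β`,
`γ` off the nodes towards the other two. The component `μ` that separates them sees `a` towards `α`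
and `b` towards `β`, and these directions agree because `α` and `β` are adjacent. -/
theorem familyGraph_dir_injective {α β γ : V} (hβ : (familyGraph P).Adj α β)
    (hγ : (familyGraph P).Adj α γ) (hd : dir P α β = dir P α γ) : β = γ := by
  by_contra hne
  have h1 := hβ.2 γ hγ.1.symm (Ne.symm hne)
  have h2 := hγ.2 β hβ.1.symm hne
  obtain ⟨a, ha, -⟩ := h.exists_ne α (dir P α β) (dir P α β)
  obtain ⟨b, hb, -⟩ := h.exists_ne β (dir P β α) (dir P β α)
  obtain ⟨c, hc, -⟩ := h.exists_ne γ (dir P γ α) (dir P γ α)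
  have a1 := h.eq_dir hβ.1 ha
  have a2 := h.eq_dir hγ.1 (l := a) (by rwa [← hd])
  have b1 := h.eq_dir hβ.1.symm hb
  have b2 := h.eq_dir hne (l := b) (by rwa [← h2])
  have c1 := h.eq_dir hγ.1.symm hc
  have c2 := h.eq_dir (Ne.symm hne) (l := c) (by rwa [← h1])
  obtain ⟨μ, hμ⟩ := h.median a b c
    ⟨fun e => ha (e ▸ b1), fun e => hb (e ▸ c2.trans h2.symm), fun e => ha (e ▸ c1.trans hd.symm)⟩
  obtain ⟨m1, m2, m3⟩ := h.dir_of_median hμ ha b1 (c1.trans hd.symm)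
  obtain ⟨m4, m5, m6⟩ := h.dir_of_median (α := β) (a := b) (b := a) (c := c)
    ⟨hμ.1.symm, hμ.2.2, hμ.2.1⟩ hb a1 (c2.trans h2.symm)
  exact hμ.1 (m3.trans ((hβ.2 μ m1.symm m4.symm).trans m6.symm))

theorem familyGraph_crossing {α β u v : V} (hβ : (familyGraph P).Adj α β)
    (huv : (familyGraph P).Adj u v) (hu : u ∉ {γ | γ ≠ α ∧ dir P α γ = dir P α β})
    (hv : v ∈ {γ | γ ≠ α ∧ dir P α γ = dir P α β}) : u = α ∧ v = β := by
  have h1 : u = α := by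
    by_contra h1
    refine hu ⟨h1, ?_⟩
    rw [← hv.2]
    exact huv.2 α (Ne.symm h1) hv.1.symm
  subst h1
  exact ⟨rfl, h.familyGraph_dir_injective huv hβ hv.2⟩

theorem familyGraph_isTree [Finite V] [Nonempty V] : (familyGraph P).IsTree := by
  refine ⟨⟨h.familyGraph_reachable⟩, ?_⟩
  rw [SimpleGraph.isAcyclic_iff_forall_adj_isBridge]
  intro α β hαβ
  rw [SimpleGraph.isBridge_iff]
  rintro ⟨p⟩
  -- Without the edge `αβ` no walk enters the set of components that `α` sees in the direction of
  -- `β`.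
  have key : ∀ {u v : V} (p : ((familyGraph P).deleteEdges {s(α, β)}).Walk u v),
      u ∉ {γ | γ ≠ α ∧ dir P α γ = dir P α β} → v ∉ {γ | γ ≠ α ∧ dir P α γ = dir P α β} := by
    intro u v p
    induction p with
    | nil => exact id
    | cons huv p ih =>
      intro hu
      refine ih fun hv => ?_
      rw [SimpleGraph.deleteEdges_adj] at huv
      obtain ⟨rfl, rfl⟩ := h.familyGraph_crossing hαβ huv.1 hu hv
      exact huv.2 rfl
  exact key p (fun h1 => h1.1 rfl) ⟨hαβ.1.symm, rfl⟩

theorem familyGraph_mem_branch [Finite V] [Nonempty V] {α β γ : V}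
    (hαβ : (familyGraph P).Adj α β) :
    γ ∈ branch (familyGraph P) α β ↔ γ ≠ α ∧ dir P α γ = dir P α β := by
  rw [branch_eq_of_crossing h.familyGraph_isTree.connected (S := {γ | γ ≠ α ∧ dir P α γ = dir P α β})
    (fun h1 => h1.1 rfl) ⟨hαβ.1.symm, rfl⟩ fun u v huv => h.familyGraph_crossing hαβ huv]
  rfl

/-- A home of `i` is a component on which the set of labels seen at the position of `i` is minimal.
If `i` were at the node towards `β` there, a smaller set would occur on `β`, or, when `β` sees `i`
back towards `α`, on the component that separates `i` from a label on either side. -/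
theorem exists_home [Finite V] [Finite L] [Nonempty V] (i : L) :
    ∃ α, ∀ β, β ≠ α → P α i ≠ dir P α β := by
  obtain ⟨α, -, hmin⟩ := (Set.toFinite (univ : Set V)).exists_minimalFor
    (fun α => {l | P α l = P α i}) _ ⟨Classical.arbitrary V, trivial⟩
  refine ⟨α, fun β hβ h1 => ?_⟩
  have key : ∀ μ, {l | P μ l = P μ i} ⊂ {l | P α l = P α i} → False := fun μ hμ =>
    hμ.not_subset (hmin (mem_univ μ) hμ.subset)
  by_cases h2 : P β i = dir P β α
  · obtain ⟨a, ha, -⟩ := h.exists_ne α (dir P α β) (dir P α β)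
    obtain ⟨b, hb, -⟩ := h.exists_ne β (dir P β α) (dir P β α)
    have a1 := h.eq_dir hβ.symm ha
    have b1 := h.eq_dir hβ hb
    obtain ⟨μ, hμ⟩ := h.median a b i ⟨fun e => ha (e ▸ b1), fun e => hb (e ▸ h2),
      fun e => ha (e ▸ h1)⟩
    obtain ⟨m1, m2, m3⟩ := h.dir_of_median hμ ha b1 h1
    refine key μ ((Set.ssubset_iff_of_subset fun l hl => ?_).mpr ⟨b, b1.trans h1.symm, ?_⟩)
    · have h4 := h.eq_dir m1.symm (l := l) (by
        rw [show P μ l = P μ i from hl, ← m3]; exact hμ.2.2.symm)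
      exact h4.trans (m2.trans h1.symm)
    · exact hμ.2.1
  · refine key β ((Set.ssubset_iff_of_subset fun l hl => ?_).mpr ?_)
    · have h4 := h.eq_dir hβ (l := l) (by rw [show P β l = P β i from hl]; exact h2)
      exact h4.trans h1.symm
    · obtain ⟨b, hb, hb'⟩ := h.exists_ne β (dir P β α) (P β i)
      exact ⟨b, (h.eq_dir hβ hb).trans h1.symm, hb'⟩

theorem eq_of_home_eq {i j : L} {α : V} (hα : ∀ γ, γ ≠ α → P α i ≠ dir P α γ)
    (hij : P α i = P α j) : i = j := by
  by_contra hne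
  obtain ⟨c, hc, -⟩ := h.exists_ne α (P α i) (P α i)
  obtain ⟨μ, hμ⟩ := h.median c i j ⟨fun e => hc (e ▸ rfl), hne, fun e => hc (e ▸ hij.symm)⟩
  obtain ⟨m1, m2, m3⟩ := h.dir_of_median hμ hc rfl hij.symm
  exact hα μ m1.symm m2.symm

end IsFamily

end FamilyTree

section

open Classical in
/-- A family over `Fin n` is the family of positions on a stable curve. -/
theorem IsFamily.exists_stableCurve_fin {k n : ℕ} {P : Fin n → Fin k → OnePoint ℂ} (h : IsFamily P)
    (hn : Nonempty (Fin n)) :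
    ∃ C : StableCurve k, ∃ e : Fin n ≃ Fin C.n, ∀ α, C.proj (e α) = P α := by
  choose home hhome using fun i => h.exists_home i
  have hpos : ∀ α i, home i ≠ α → P α i = dir P α (home i) := fun α i hne =>
    h.eq_dir hne (hhome i α (Ne.symm hne))
  let C : StableCurve k :=
    { n := n
      tree := familyGraph P
      isTree := h.familyGraph_isTree
      node := dir P
      comp := home
      pos := fun i => P (home i) i
      node_injective := fun α β γ => h.familyGraph_dir_injective
      pos_injective := fun i j hc he =>
        h.eq_of_home_eq (hhome i) (by rw [he, ← hc])
      node_ne_pos := fun α β i hαβ hi e => hhome i β (by rw [hi]; exact hαβ.1.symm) (by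
        rw [← e, hi])
      stable := fun α => by
        obtain ⟨a, b, c, h1, h2, h3⟩ := h.three α
        have h4 : range (P α) ⊆ dir P α '' {β | (familyGraph P).Adj α β} ∪
            (fun i => P (home i) i) '' {i | home i = α} := by
          rintro _ ⟨i, rfl⟩
          by_cases hi : home i = α
          · exact Or.inr ⟨i, hi, by simp only [hi]⟩
          · obtain ⟨β, h5, h6⟩ := h.exists_adj (Ne.symm hi)
            exact Or.inl ⟨β, h5, h6.trans (hpos α i hi).symm⟩
        have h5 : 2 < (range (P α)).ncard := (Set.two_lt_ncard_iff (Set.finite_range _)).mpr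
          ⟨_, _, _, ⟨a, rfl⟩, ⟨b, rfl⟩, ⟨c, rfl⟩, h1, h3, h2⟩
        have h6 := Set.ncard_le_ncard h4 (Set.toFinite _)
        have h7 := Set.ncard_union_le (dir P α '' {β | (familyGraph P).Adj α β})
          ((fun i => P (home i) i) '' {i | home i = α})
        have h8 := Set.ncard_image_le (f := dir P α) (Set.toFinite {β | (familyGraph P).Adj α β})
        have h9 := Set.ncard_image_le (f := fun i => P (home i) i) (Set.toFinite {i | home i = α})
        omega }
  refine ⟨C, Equiv.refl _, fun α => funext fun i => ?_⟩
  by_cases hi : home i = α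
  · refine (C.proj_of_comp_eq (i := i) (α := α) hi).trans ?_
    change P (home i) i = P α i
    rw [hi]
  · obtain ⟨β, h5, h6⟩ := h.exists_adj (Ne.symm hi)
    have h7 : i ∈ C.side α β := (h.familyGraph_mem_branch h5).mpr ⟨hi, h6.symm⟩
    refine (C.proj_of_mem_side (α := α) (β := β) h5 h7).trans ?_
    change dir P α β = _
    rw [hpos α i hi, h6]

theorem IsFamily.exists_stableCurve {k : ℕ} {V : Type*} [Finite V] [hV : Nonempty V]
    {P : V → Fin k → OnePoint ℂ} (h : IsFamily P) :
    ∃ C : StableCurve k, ∃ e : V ≃ Fin C.n, ∀ α, C.proj (e α) = P α := by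
  obtain ⟨n, ⟨e⟩⟩ := Finite.exists_equiv_fin V
  have h1 : IsFamily fun α => P (e.symm α) := by
    refine ⟨fun α β hne => h.cross _ _ (e.symm.injective.ne hne), fun α => h.three _,
      fun a b c habc => ?_⟩
    obtain ⟨α, hα⟩ := h.median a b c habc
    exact ⟨e α, by simpa using hα⟩
  obtain ⟨C, e', he⟩ := h1.exists_stableCurve_fin (hV.map e)
  exact ⟨C, e.trans e', fun α => by simp [he]⟩

end

/-! ### Curves with equivalent families are isomorphic -/

theorem dir_smul {V W L : Type*} {P : V → L → OnePoint ℂ} {Q : W → L → OnePoint ℂ}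
    (hP : IsFamily P) (hQ : IsFamily Q) {f : V → W} {g : V → GL (Fin 2) ℂ}
    (hg : ∀ α l, Q (f α) l = g α • P α l) {α β : V} (hne : α ≠ β) :
    dir Q (f α) (f β) = g α • dir P α β := by
  refine hQ.dir_eq (n' := g β • dir P β α) fun l => ?_
  rw [hg, hg]
  exact (hP.dir_spec hne l).imp (congrArg _) (congrArg _)

/-- The Moebius maps carry directions to directions, and directions determine adjacency, nodes and
the components of the marked points. -/
theorem StableCurve.iso_of_proj {k : ℕ} {C D : StableCurve k} (f : Fin C.n ≃ Fin D.n)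
    (g : Fin C.n → GL (Fin 2) ℂ) (h : ∀ α l, D.proj (f α) l = g α • C.proj α l) :
    StableCurve.Iso C D := by
  have hdir : ∀ {α β : Fin C.n}, α ≠ β → dir D.proj (f α) (f β) = g α • dir C.proj α β :=
    fun hne => dir_smul C.isFamily D.isFamily h hne
  have hadj : ∀ {α β : Fin C.n}, D.tree.Adj (f α) (f β) ↔ C.tree.Adj α β := by
    intro α β
    rw [C.adj_iff, D.adj_iff, f.injective.ne_iff, ← f.forall_congr_right]
    simp only [f.injective.ne_iff]
    refine and_congr_right fun _ => forall_congr' fun γ => forall_congr' fun h1 =>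
      forall_congr' fun h2 => ?_
    rw [hdir h1, hdir h2]
    exact (MulAction.injective (g γ)).eq_iff
  have hcomp : ∀ i, D.comp i = f (C.comp i) := by
    intro i
    rw [D.comp_eq_iff, ← f.forall_congr_right]
    intro β hβ
    have hβ' : β ≠ C.comp i := fun e => hβ (e ▸ rfl)
    rw [hdir hβ'.symm, h]
    exact fun e => C.comp_eq_iff.mp rfl β hβ' (MulAction.injective (g _) e)
  refine ⟨⟨f, hadj⟩, g, fun α β hαβ => ?_, hcomp, fun i => ?_⟩
  · have h1 := hdir hαβ.ne
    rw [C.dir_eq_node_of_adj hαβ, D.dir_eq_node_of_adj (hadj.mpr hαβ)] at h1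
    exact h1.symm
  · rw [← C.proj_of_comp_eq (i := i) rfl, ← h, ← hcomp i, D.proj_of_comp_eq rfl]

theorem StableCurve.Iso.exists_proj {k : ℕ} {C D : StableCurve k} (h : StableCurve.Iso C D) :
    ∃ (f : Fin C.n ≃ Fin D.n) (g : Fin C.n → GL (Fin 2) ℂ),
      ∀ α l, D.proj (f α) l = g α • C.proj α l := by
  obtain ⟨f, g, h1, h2, h3⟩ := h
  have hmem : ∀ {α β γ : Fin C.n}, C.tree.Adj α β →
      (f γ ∈ branch D.tree (f α) (f β) ↔ γ ∈ branch C.tree α β) := by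
    intro α β γ hαβ
    rw [branch_eq_of_crossing D.isTree.connected (S := f '' branch C.tree α β)]
    · exact f.injective.mem_set_image
    · rw [f.injective.mem_set_image]
      exact notMem_branch_self α β
    · exact ⟨β, mem_branch_self hαβ, rfl⟩
    · intro u v huv hu hv
      obtain ⟨u, rfl⟩ := f.surjective u
      obtain ⟨v, rfl⟩ := f.surjective v
      rw [f.injective.mem_set_image] at hu hv
      obtain ⟨rfl, rfl⟩ := branch_crossing C.isTree hαβ (f.map_rel_iff.mp huv) hu hv
      exact ⟨rfl, rfl⟩
  refine ⟨f.toEquiv, g, fun α i => ?_⟩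
  change D.proj (f α) i = _
  by_cases hi : C.comp i = α
  · subst hi
    rw [D.proj_of_comp_eq (h2 i), C.proj_of_comp_eq rfl, h3]
  · have h4 := next_spec C.isTree hi
    have h5 : i ∈ D.side (f α) (f (next C.tree α (C.comp i))) := by
      rw [D.side_eq, mem_ofPred_eq, h2, hmem h4.1]
      exact h4.2
    rw [D.proj_of_mem_side (f.map_rel_iff.mpr h4.1) h5, C.proj_of_comp_ne hi, h1 _ _ h4.1]

end

section

/-! ### The cross ratio map -/

section

variable {k : ℕ}

theorem StableCurve.isCrossRatio_iff {C : StableCurve k} {q : Fin 4 ↪ Fin k} {w : OnePoint ℂ} :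
    C.IsCrossRatio q w ↔ ∃ α, NoThree (C.proj α (q 0)) (C.proj α (q 1)) (C.proj α (q 2))
      (C.proj α (q 3)) ∧
      w = cr (C.proj α (q 0)) (C.proj α (q 1)) (C.proj α (q 2)) (C.proj α (q 3)) := by
  unfold StableCurve.IsCrossRatio
  refine exists_congr fun α => and_congr ?_ Iff.rfl
  exact noThree_iff fun a => C.proj α (q a)

/-- The value chosen by `epsilon` depends neither on the representative nor on the component, since
all the views are pairwise `Related`. -/
theorem crossRatioMap_eq {C : StableCurve k} {q : Fin 4 ↪ Fin k} {α : Fin C.n}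
    (h : NoThree (C.proj α (q 0)) (C.proj α (q 1)) (C.proj α (q 2)) (C.proj α (q 3))) :
    crossRatioMap k (DM.mk C) q =
      cr (C.proj α (q 0)) (C.proj α (q 1)) (C.proj α (q 2)) (C.proj α (q 3)) := by
  obtain ⟨D, hD, hw⟩ : ∃ D : StableCurve k, DM.mk D = DM.mk C ∧
      D.IsCrossRatio q (crossRatioMap k (DM.mk C) q) :=
    Classical.epsilon_spec
      (p := fun w => ∃ D : StableCurve k, DM.mk D = DM.mk C ∧ D.IsCrossRatio q w)
      ⟨_, C, rfl, StableCurve.isCrossRatio_iff.mpr ⟨α, h, rfl⟩⟩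
  obtain ⟨β, hβ, e⟩ := StableCurve.isCrossRatio_iff.mp hw
  have hiso : StableCurve.Iso C D := Quotient.exact hD.symm
  obtain ⟨f, g, hg⟩ := hiso.exists_proj
  obtain ⟨γ, rfl⟩ := f.surjective β
  rw [e]
  simp only [hg] at hβ ⊢
  refine (Related.cr_eq (P := C.proj α) (P' := fun l => g γ • C.proj γ l) ?_ h hβ).symm
  simpa using (C.isFamily.related α γ).smul 1 (g γ)

theorem DM.exists_rep (x : DM k) : ∃ C, DM.mk C = x := Quotient.exists_rep x

open Classical in
/-- The position of the label `l`, seen from the component that separates the labels `a`, `b`, `c`,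
in the coordinate in which these labels are at `0`, `1`, `∞`. -/
def view (x : DM k) (a b c l : Fin k) : OnePoint ℂ :=
  if h : Function.Injective ![a, b, c, l] then crossRatioMap k x ⟨_, h⟩
  else if l = a then ((0 : ℂ) : OnePoint ℂ) else if l = b then ((1 : ℂ) : OnePoint ℂ)
  else OnePoint.infty

theorem injective_four {a b c l : Fin k} (h : Distinct3 a b c) (ha : l ≠ a) (hb : l ≠ b)
    (hc : l ≠ c) : Function.Injective ![a, b, c, l] := by
  obtain ⟨h1, h2, h3⟩ := h
  intro i j hij
  fin_cases i <;> fin_cases j <;> simp_all [eq_comm]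

theorem crossRatioMap_eq_view (x : DM k) (q : Fin 4 ↪ Fin k) :
    crossRatioMap k x q = view x (q 0) (q 1) (q 2) (q 3) := by
  have e : (![q 0, q 1, q 2, q 3] : Fin 4 → Fin k) = q := by
    funext i; fin_cases i <;> rfl
  rw [view, dif_pos (by rw [e]; exact q.injective)]
  congr 1
  ext i : 1
  exact congrFun e.symm i

theorem view_eq_cr {C : StableCurve k} {α : Fin C.n} {a b c : Fin k}
    (h : Distinct3 (C.proj α a) (C.proj α b) (C.proj α c)) (l : Fin k) :
    view (DM.mk C) a b c l = cr (C.proj α a) (C.proj α b) (C.proj α c) (C.proj α l) := by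
  have habc := h.of_map
  unfold view
  split_ifs with h1 h2 h3
  · rw [crossRatioMap_eq (α := α)]
    · rfl
    · exact noThree_of_distinct h.1 h.2.1 h.2.2 _
  · rw [h2, cr_self_left h.1 h.2.1 h.2.2]
  · rw [h3, cr_self_mid h.1 h.2.1 h.2.2]
  · have h4 : l = c := by
      by_contra h4
      exact h1 (injective_four habc h2 h3 h4)
    rw [h4, cr_self_right]

theorem exists_view_eq_smul {C : StableCurve k} {α : Fin C.n} {a b c : Fin k}
    (h : Distinct3 (C.proj α a) (C.proj α b) (C.proj α c)) :
    ∃ g : GL (Fin 2) ℂ, ∀ l, view (DM.mk C) a b c l = g • C.proj α l := by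
  obtain ⟨g, hg⟩ := exists_gl_cr h.1 h.2.1 h.2.2
  exact ⟨g, fun l => by rw [view_eq_cr h, hg]⟩

theorem view_left (x : DM k) {a b c : Fin k} (h : Distinct3 a b c) :
    view x a b c a = ((0 : ℂ) : OnePoint ℂ) := by
  obtain ⟨C, rfl⟩ := x.exists_rep
  obtain ⟨α, hα⟩ := C.isFamily.median a b c h
  rw [view_eq_cr hα, cr_self_left hα.1 hα.2.1 hα.2.2]

theorem view_mid (x : DM k) {a b c : Fin k} (h : Distinct3 a b c) :
    view x a b c b = ((1 : ℂ) : OnePoint ℂ) := by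
  obtain ⟨C, rfl⟩ := x.exists_rep
  obtain ⟨α, hα⟩ := C.isFamily.median a b c h
  rw [view_eq_cr hα, cr_self_mid hα.1 hα.2.1 hα.2.2]

theorem view_right (x : DM k) {a b c : Fin k} (h : Distinct3 a b c) :
    view x a b c c = OnePoint.infty := by
  obtain ⟨C, rfl⟩ := x.exists_rep
  obtain ⟨α, hα⟩ := C.isFamily.median a b c h
  rw [view_eq_cr hα, cr_self_right]

theorem view_distinct (x : DM k) {a b c : Fin k} (h : Distinct3 a b c) :
    Distinct3 (view x a b c a) (view x a b c b) (view x a b c c) := by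
  rw [view_left x h, view_mid x h, view_right x h]
  refine ⟨?_, ?_, ?_⟩ <;> simp

theorem view_related (x : DM k) {a b c a' b' c' : Fin k} (h : Distinct3 a b c)
    (h' : Distinct3 a' b' c') : Related (view x a b c) (view x a' b' c') := by
  obtain ⟨C, rfl⟩ := x.exists_rep
  obtain ⟨α, hα⟩ := C.isFamily.median a b c h
  obtain ⟨β, hβ⟩ := C.isFamily.median a' b' c' h'
  obtain ⟨g, hg⟩ := exists_view_eq_smul hα
  obtain ⟨g', hg'⟩ := exists_view_eq_smul hβ
  rw [funext hg, funext hg']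
  exact (C.isFamily.related α β).smul g g'

/-- All cross ratios can be computed on any component on which no three of the points coincide. -/
theorem view_eq (x : DM k) {a b c l a' b' c' : Fin k} (h : Distinct3 a b c)
    (h' : Distinct3 a' b' c') (hn : NoThree (view x a' b' c' a) (view x a' b' c' b)
      (view x a' b' c' c) (view x a' b' c' l)) :
    view x a b c l = cr (view x a' b' c' a) (view x a' b' c' b) (view x a' b' c' c)
      (view x a' b' c' l) := by
  have hd := view_distinct x h
  rw [← (view_related x h h').cr_eq (noThree_of_distinct hd.1 hd.2.1 hd.2.2 _) hn]
  rw [view_left x h, view_mid x h, view_right x h, cr_zero_one_infty]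

/-- Each component is recovered, up to a Moebius map, from the view of three labels that it
separates. This matches the components of the two curves, bijectively because distinct components
have inequivalent views. -/
theorem crossRatioMap_injective : Function.Injective (crossRatioMap k) := by
  intro x y hxy
  have hview : ∀ a b c l, view x a b c l = view y a b c l := by
    intro a b c l
    unfold view
    rw [hxy]
  obtain ⟨C, rfl⟩ := x.exists_rep
  obtain ⟨D, rfl⟩ := y.exists_rep
  have key : ∀ {C D : StableCurve k}, (∀ a b c l, view (DM.mk C) a b c l = view (DM.mk D) a b c l) →
      ∀ α : Fin C.n, ∃ (β : Fin D.n) (g : GL (Fin 2) ℂ), ∀ l, D.proj β l = g • C.proj α l := by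
    intro C D hview α
    obtain ⟨a, b, c, hα⟩ := C.isFamily.three α
    obtain ⟨β, hβ⟩ := D.isFamily.median a b c hα.of_map
    obtain ⟨g, hg⟩ := exists_view_eq_smul hα
    obtain ⟨g', hg'⟩ := exists_view_eq_smul hβ
    refine ⟨β, g'⁻¹ * g, fun l => ?_⟩
    rw [mul_smul, ← hg, hview, hg', inv_smul_smul]
  choose f g hg using key hview
  choose f' g' hg' using key fun a b c l => (hview a b c l).symm
  let e : Fin C.n ≃ Fin D.n :=
    { toFun := f
      invFun := f'
      left_inv := fun α => (C.isFamily.eq_of_smul (g := g' (f α) * g α) fun l => by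
        rw [hg', hg, mul_smul]).symm
      right_inv := fun β => (D.isFamily.eq_of_smul (g := g (f' β) * g' β) fun l => by
        rw [hg, hg', mul_smul]).symm }
  exact Quotient.sound (StableCurve.iso_of_proj e g hg)

theorem crossRatioMap_isEmbedding : IsEmbedding (crossRatioMap k) :=
  ⟨⟨rfl⟩, crossRatioMap_injective⟩

theorem DM.ext_view {x y : DM k} (h : ∀ a b c l, Distinct3 a b c → view x a b c l = view y a b c l) :
    x = y := by
  refine crossRatioMap_injective (funext fun q => ?_)
  rw [crossRatioMap_eq_view, crossRatioMap_eq_view]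
  exact h _ _ _ _ ⟨q.injective.ne (by decide), q.injective.ne (by decide), q.injective.ne (by decide)⟩

theorem continuous_view {a b c : Fin k} (l : Fin k) :
    Continuous fun x : DM k => view x a b c l := by
  unfold view
  split_ifs
  · exact (continuous_apply _).comp crossRatioMap_isEmbedding.continuous
  all_goals exact continuous_const

/-! ### Splits -/

theorem cr_swap (a b c d : OnePoint ℂ) : cr b a d c = cr a b c d := by
  unfold cr
  rw [homogSub_swap a d, homogSub_swap c b, homogSub_swap b a, homogSub_swap d c]
  congr 1 <;> ring

/-- The subset `A` of the labels is one side of an edge of `x`. -/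
structure IsSplit (x : DM k) (A : Set (Fin k)) : Prop where
  left : ∃ i ∈ A, ∃ j ∈ A, i ≠ j
  right : ∃ i ∉ A, ∃ j ∉ A, i ≠ j
  view_eq_zero : ∀ i ∈ A, ∀ i' ∈ A, ∀ j ∉ A, ∀ j' ∉ A, i ≠ i' → j ≠ j' →
    view x i j j' i' = ((0 : ℂ) : OnePoint ℂ)

theorem view_swap (x : DM k) {a b c d : Fin k} (h1 : Distinct3 a b c) (h2 : Distinct3 b a d) :
    view x b a d c = view x a b c d := by
  obtain ⟨C, rfl⟩ := x.exists_rep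
  obtain ⟨α, hα⟩ := C.isFamily.median a b c h1
  have h := noThree_of_distinct hα.1 hα.2.1 hα.2.2 (C.proj α d)
  obtain ⟨g, hg⟩ := exists_view_eq_smul hα
  have h3 : NoThree (view (DM.mk C) a b c b) (view (DM.mk C) a b c a) (view (DM.mk C) a b c d)
      (view (DM.mk C) a b c c) := by
    simp only [hg]
    unfold NoThree at h ⊢
    simp only [(MulAction.injective g).eq_iff]
    grind
  rw [view_eq _ h2 h1 h3, cr_swap, view_left _ h1, view_mid _ h1, view_right _ h1,
    cr_zero_one_infty]

theorem IsSplit.compl {x : DM k} {A : Set (Fin k)} (h : IsSplit x A) : IsSplit x Aᶜ := by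
  refine ⟨h.right, by simpa using h.left, fun i hi i' hi' j hj j' hj' hii hjj => ?_⟩
  have hj := notMem_compl_iff.mp hj
  have hj' := notMem_compl_iff.mp hj'
  have e : ∀ u ∈ A, ∀ v ∈ Aᶜ, u ≠ v := fun u hu v hv h => hv (h ▸ hu)
  rw [view_swap x ⟨e j hj i hi, hii, e j hj i' hi'⟩
    ⟨(e j hj i hi).symm, hjj, (e j' hj' i hi).symm⟩]
  exact h.view_eq_zero j hj j' hj' i hi i' hi' hjj hii

theorem IsSplit.of_mem {x : DM k} {A : Set (Fin k)} {e : Set (Set (Fin k))} (h : IsSplit x A)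
    (he : e = {A, Aᶜ}) {B : Set (Fin k)} (hB : B ∈ e) : IsSplit x B ∧ e = {B, Bᶜ} := by
  subst he
  rcases hB with rfl | hB
  · exact ⟨h, rfl⟩
  · rw [mem_singleton_iff.mp hB]
    exact ⟨h.compl, by rw [compl_compl, Set.pair_comm]⟩

theorem StableCurve.isSplit_side (C : StableCurve k) {α β : Fin C.n} (h : C.tree.Adj α β) :
    IsSplit (DM.mk C) (C.side α β) := by
  have hc : ∀ {i}, i ∉ C.side α β ↔ i ∈ C.side β α := notMem_branch_iff C.isTree h
  have hd := C.dir_eq_node_of_adj h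
  have hd' := C.dir_eq_node_of_adj h.symm
  refine ⟨?_, ?_, fun i hi i' hi' j hj j' hj' hii hjj => ?_⟩
  · obtain ⟨l, l', h1, h2, h3⟩ := C.isFamily.exists_pair_ne β (dir C.proj β α)
    refine ⟨l, ?_, l', ?_, fun e => h3 (e ▸ rfl)⟩
    · by_contra h4
      exact h1 (by rw [hd', C.proj_eq_node_iff h.symm]; exact hc.mp h4)
    · by_contra h4
      exact h2 (by rw [hd', C.proj_eq_node_iff h.symm]; exact hc.mp h4)
  · obtain ⟨l, l', h1, h2, h3⟩ := C.isFamily.exists_pair_ne α (dir C.proj α β)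
    rw [hd, Ne, C.proj_eq_node_iff h] at h1 h2
    exact ⟨l, h1, l', h2, fun e => h3 (e ▸ rfl)⟩
  · rw [← C.proj_eq_node_iff h] at hi hi' hj hj'
    have hd : Distinct3 i j j' := ⟨fun e => hj (e ▸ hi), hjj, fun e => hj' (e ▸ hi)⟩
    have h1 : NoThree (C.proj α i) (C.proj α j) (C.proj α j') (C.proj α i') := by
      unfold NoThree
      grind
    have h2 : Function.Injective ![i, j, j', i'] :=
      injective_four hd hii.symm (fun e => hj (e ▸ hi')) (fun e => hj' (e ▸ hi'))
    have h3 := crossRatioMap_eq_view (DM.mk C) ⟨_, h2⟩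
    rw [crossRatioMap_eq (α := α) h1] at h3
    refine (Eq.trans h3.symm ?_)
    exact h1.cr_eq_zero_iff.mpr (Or.inr (hi.trans hi'.symm))

theorem view_eq_zero_of_cross {C : StableCurve k} {α : Fin C.n} {a b c d : Fin k}
    (hd : Distinct3 a b c) (h : NoThree (C.proj α a) (C.proj α b) (C.proj α c) (C.proj α d))
    (h0 : view (DM.mk C) a b c d = ((0 : ℂ) : OnePoint ℂ)) :
    C.proj α b = C.proj α c ∨ C.proj α a = C.proj α d := by
  obtain ⟨β, hβ⟩ := C.isFamily.median a b c hd
  rw [view_eq_cr hβ, C.isFamily.cr_eq (noThree_of_distinct hβ.1 hβ.2.1 hβ.2.2 _) h] at h0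
  exact h.cr_eq_zero_iff.mp h0

/-- The vanishing cross ratios force every component to collapse `A` or `Aᶜ` to a point. A walk from
a component that keeps `Aᶜ` apart to one that keeps `A` apart enters the set `S` of components
collapsing `Aᶜ`, and it does so across the required edge. -/
theorem StableCurve.exists_side_of_isSplit (C : StableCurve k) {A : Set (Fin k)}
    (h : IsSplit (DM.mk C) A) : ∃ α β, C.tree.Adj α β ∧ C.side α β = A := by
  let S : Set (Fin C.n) := {γ | ∀ b ∉ A, ∀ b' ∉ A, C.proj γ b = C.proj γ b'}
  have hS : ∀ γ ∉ S, ∀ a ∈ A, ∀ a' ∈ A, C.proj γ a = C.proj γ a' := by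
    intro γ hγ a ha a' ha'
    by_contra hne
    apply hγ
    intro b hb b' hb'
    by_contra hne'
    have e : ∀ u ∈ A, ∀ v ∉ A, u ≠ v := fun u hu v hv h => hv (h ▸ hu)
    have hjj : b ≠ b' := fun e => hne' (e ▸ rfl)
    rcases view_eq_zero_of_cross (α := γ) ⟨e a ha b hb, hjj, e a ha b' hb'⟩
      (by unfold NoThree; grind)
      (h.view_eq_zero a ha a' ha' b hb b' hb' (fun e => hne (e ▸ rfl)) hjj) with h1 | h1
    · exact hne' h1
    · exact hne h1
  obtain ⟨a, ha, a', ha', haa⟩ := h.left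
  obtain ⟨b, hb, b', hb', hbb⟩ := h.right
  have e : ∀ u ∈ A, ∀ v ∉ A, u ≠ v := fun u hu v hv h => hv (h ▸ hu)
  obtain ⟨β₀, hβ₀⟩ := C.isFamily.median a a' b ⟨haa, e a' ha' b hb, e a ha b hb⟩
  have hβS : β₀ ∈ S := by
    by_contra h1
    exact hβ₀.1 (hS _ h1 a ha a' ha')
  obtain ⟨α₀, hα₀⟩ := C.isFamily.median b b' a ⟨hbb, (e a ha b' hb').symm, (e a ha b hb).symm⟩
  have hαS : α₀ ∉ S := fun h1 => hα₀.1 (h1 b hb b' hb')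
  obtain ⟨p⟩ := C.isTree.connected α₀ β₀
  obtain ⟨d, -, hd1, hd2⟩ := p.exists_boundary_dart Sᶜ hαS (not_not.mpr hβS)
  have hd2 := notMem_compl_iff.mp hd2
  refine ⟨d.fst, d.snd, d.adj, ?_⟩
  have hne := d.adj.ne
  have n1 : ∀ u ∈ A, C.proj d.fst u = C.node d.fst d.snd := by
    have h2 : ∃ u ∈ A, C.proj d.snd u ≠ dir C.proj d.snd d.fst := by
      by_contra! h2
      obtain ⟨l, hl, hl'⟩ := C.isFamily.exists_ne d.snd (C.proj d.snd b) (dir C.proj d.snd d.fst)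
      by_cases hlA : l ∈ A
      · exact hl' (h2 l hlA)
      · exact hl (hd2 l hlA b hb)
    obtain ⟨u, hu, h3⟩ := h2
    intro v hv
    rw [hS _ hd1 v hv u hu, C.isFamily.eq_dir hne.symm h3, C.dir_eq_node_of_adj d.adj]
  have n2 : ∀ u ∉ A, C.proj d.snd u = C.node d.snd d.fst := by
    have h2 : ∃ u ∉ A, C.proj d.fst u ≠ dir C.proj d.fst d.snd := by
      by_contra! h2
      obtain ⟨l, hl, hl'⟩ := C.isFamily.exists_ne d.fst (C.proj d.fst a) (dir C.proj d.fst d.snd)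
      by_cases hlA : l ∈ A
      · exact hl (hS _ hd1 l hlA a ha)
      · exact hl' (h2 l hlA)
    obtain ⟨u, hu, h3⟩ := h2
    intro v hv
    rw [hd2 v hv u hu, C.isFamily.eq_dir hne h3, C.dir_eq_node_of_adj d.adj.symm]
  ext l
  constructor
  · intro hl
    by_contra hlA
    have h4 := (C.proj_eq_node_iff d.adj.symm).mp (n2 l hlA)
    exact (notMem_branch_iff C.isTree d.adj).mpr h4 hl
  · intro hl
    exact (C.proj_eq_node_iff d.adj).mp (n1 l hl)

theorem StableCurve.side_compl (C : StableCurve k) {α β : Fin C.n} (h : C.tree.Adj α β) :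
    (C.side α β)ᶜ = C.side β α := by
  ext i
  exact notMem_branch_iff C.isTree h

theorem StableCurve.mem_edges_iff (C : StableCurve k) {e : Set (Set (Fin k))} :
    e ∈ C.edges ↔ ∃ A, e = {A, Aᶜ} ∧ IsSplit (DM.mk C) A := by
  constructor
  · rintro ⟨α, β, h, rfl⟩
    exact ⟨C.side α β, by rw [C.side_compl h], C.isSplit_side h⟩
  · rintro ⟨A, rfl, hA⟩
    obtain ⟨α, β, h, rfl⟩ := C.exists_side_of_isSplit hA
    exact ⟨α, β, h, by rw [C.side_compl h]⟩

/-- As `IsSplit` involves only views, the edges are determined by the cross ratios. -/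
theorem DM.mem_edges_iff {x : DM k} {e : Set (Set (Fin k))} :
    e ∈ x.edges ↔ ∃ A, e = {A, Aᶜ} ∧ IsSplit x A := by
  constructor
  · rintro ⟨C, rfl, h⟩
    exact C.mem_edges_iff.mp h
  · intro h
    obtain ⟨C, rfl⟩ := x.exists_rep
    exact ⟨C, rfl, C.mem_edges_iff.mpr h⟩

/-- A cross ratio vanishes if and only if some edge separates its labels accordingly. -/
theorem view_eq_zero_iff {x : DM k} {a b c d : Fin k} (h : Distinct3 a b c) (hda : d ≠ a) :
    view x a b c d = ((0 : ℂ) : OnePoint ℂ) ↔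
      ∃ A, IsSplit x A ∧ a ∈ A ∧ d ∈ A ∧ b ∉ A ∧ c ∉ A := by
  constructor
  · intro h0
    obtain ⟨C, rfl⟩ := x.exists_rep
    obtain ⟨α, hα⟩ := C.isFamily.median a b c h
    have h1 := noThree_of_distinct hα.1 hα.2.1 hα.2.2 (C.proj α d)
    have h2 := (view_eq_zero_of_cross h h1 h0).resolve_left hα.2.1
    obtain ⟨β, h3, h4, h5, h6⟩ := C.exists_side_of_proj_eq hda.symm h2
    refine ⟨C.side α β, C.isSplit_side h3, h5, h6, ?_, ?_⟩
    · rw [← C.proj_eq_node_iff h3, h4]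
      exact hα.1.symm
    · rw [← C.proj_eq_node_iff h3, h4]
      exact hα.2.2.symm
  · rintro ⟨A, hA, h1, h2, h3, h4⟩
    exact hA.view_eq_zero a h1 d h2 b h3 c h4 hda.symm h.2.1

end

end

section

/-! ### Forgetting and adding a label -/

section

variable {k : ℕ}

theorem Distinct3.rotate {X : Type*} {a b c : X} (h : Distinct3 a b c) : Distinct3 b c a :=
  ⟨h.2.1, h.2.2.symm, h.1.symm⟩

theorem Distinct3.swap {X : Type*} {a b c : X} (h : Distinct3 a b c) : Distinct3 b a c :=
  ⟨h.1.symm, h.2.2, h.2.1⟩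

theorem Distinct3.map {X Y : Type*} {f : X → Y} (hf : Function.Injective f) {a b c : X}
    (h : Distinct3 a b c) : Distinct3 (f a) (f b) (f c) :=
  ⟨hf.ne h.1, hf.ne h.2.1, hf.ne h.2.2⟩

theorem IsFamily.exists_DM {V : Type*} [Finite V] [Nonempty V] {P : V → Fin k → OnePoint ℂ}
    (h : IsFamily P) : ∃ x : DM k, ∀ α a b c l, Distinct3 (P α a) (P α b) (P α c) →
      view x a b c l = cr (P α a) (P α b) (P α c) (P α l) := by
  obtain ⟨C, e, he⟩ := h.exists_stableCurve
  refine ⟨DM.mk C, fun α a b c l hd => ?_⟩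
  rw [← he] at hd ⊢
  exact view_eq_cr hd l

/-- The subtype performs the stabilisation: components that no longer see three distinct points are
dropped. -/
theorem IsFamily.comp {V L L' : Type*} {P : V → L → OnePoint ℂ} (h : IsFamily P) {f : L' → L}
    (hf : Function.Injective f) :
    IsFamily fun (α : {α // ∃ a b c, Distinct3 (P α (f a)) (P α (f b)) (P α (f c))}) l =>
      P α.1 (f l) where
  cross α β hne := by
    obtain ⟨n, n', hn⟩ := h.cross α.1 β.1 (Subtype.coe_injective.ne hne)
    exact ⟨n, n', fun l => hn _⟩
  three α := α.2
  median a b c habc := by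
    obtain ⟨α, hα⟩ := h.median _ _ _ (habc.map hf)
    exact ⟨⟨α, a, b, c, hα⟩, hα⟩

theorem exists_forget (hk : 3 ≤ k) {m : ℕ} (f : Fin k ↪ Fin m) (x : DM m) :
    ∃ y : DM k, ∀ a b c l, Distinct3 a b c → view y a b c l = view x (f a) (f b) (f c) (f l) := by
  obtain ⟨C, rfl⟩ := x.exists_rep
  have h := C.isFamily.comp f.injective
  have hne : Nonempty {α // ∃ a b c, Distinct3 (C.proj α (f a)) (C.proj α (f b))
      (C.proj α (f c))} := by
    have h3 : Distinct3 (⟨0, by omega⟩ : Fin k) ⟨1, by omega⟩ ⟨2, by omega⟩ := by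
      refine ⟨?_, ?_, ?_⟩ <;> simp [Fin.ext_iff]
    obtain ⟨α, -⟩ := h.median _ _ _ h3
    exact ⟨α⟩
  obtain ⟨y, hy⟩ := h.exists_DM
  refine ⟨y, fun a b c l habc => ?_⟩
  obtain ⟨α, hα⟩ := h.median a b c habc
  rw [hy α a b c l hα, view_eq_cr hα]

open Classical in
/-- The map that forgets all labels outside the range of `f`. -/
def forget {m : ℕ} (hk : 3 ≤ k) (f : Fin k ↪ Fin m) (x : DM m) : DM k := (exists_forget hk f x).choose

theorem view_forget {m : ℕ} (hk : 3 ≤ k) (f : Fin k ↪ Fin m) (x : DM m) {a b c : Fin k}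
    (l : Fin k) (h : Distinct3 a b c) :
    view (forget hk f x) a b c l = view x (f a) (f b) (f c) (f l) :=
  (exists_forget hk f x).choose_spec a b c l h

theorem distinct3_quad {m : ℕ} (q : Fin 4 ↪ Fin m) : Distinct3 (q 0) (q 1) (q 2) :=
  ⟨q.injective.ne (by decide), q.injective.ne (by decide), q.injective.ne (by decide)⟩

theorem crossRatioMap_forget {m : ℕ} (hk : 3 ≤ k) (f : Fin k ↪ Fin m) (x : DM m)
    (q : Fin 4 ↪ Fin k) :
    crossRatioMap k (forget hk f x) q = crossRatioMap m x (q.trans f) := by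
  rw [crossRatioMap_eq_view, crossRatioMap_eq_view, view_forget hk f x _ (distinct3_quad q)]
  rfl

theorem continuous_forget {m : ℕ} (hk : 3 ≤ k) (f : Fin k ↪ Fin m) : Continuous (forget hk f) := by
  rw [crossRatioMap_isEmbedding.continuous_iff]
  refine continuous_pi fun q => ?_
  simp only [Function.comp_apply, crossRatioMap_forget]
  exact (continuous_apply _).comp crossRatioMap_isEmbedding.continuous

theorem eq_or_eq_succAbove {n : ℕ} (j l : Fin (n + 1)) : j = l ∨ ∃ i, l = j.succAbove i :=
  (Fin.eq_self_or_eq_succAbove j l).imp_left Eq.symm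

/-- The new label `j` is put at the unoccupied point `z` of `γ`, and all other components see it in
the direction of `γ`. -/
theorem IsFamily.insert_generic {V : Type*} {P : V → Fin k → OnePoint ℂ} (h : IsFamily P)
    (j : Fin (k + 1)) (γ : V) (z : OnePoint ℂ) (hz : ∀ l, z ≠ P γ l) [DecidableEq V] :
    IsFamily fun α => (j.insertNth (if α = γ then z else dir P α γ) (P α) :
      Fin (k + 1) → OnePoint ℂ) where
  cross α β hne := by
    refine ⟨dir P α β, dir P β α, fun l => ?_⟩
    rcases eq_or_eq_succAbove j l with rfl | ⟨l, rfl⟩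
    · simp only [Fin.insertNth_apply_same]
      by_cases hα : α = γ
      · subst hα
        right
        rw [if_neg hne.symm]
      · by_cases hβ : β = γ
        · subst hβ
          left
          rw [if_neg hα]
        · rw [if_neg hα, if_neg hβ]
          by_contra! h1
          exact h1.2 (h.dir_eq_of_dir_ne hne hα hβ (Ne.symm h1.1)).symm
    · simpa only [Fin.insertNth_apply_succAbove] using h.dir_spec hne l
  three α := by
    obtain ⟨a, b, c, habc⟩ := h.three α
    exact ⟨j.succAbove a, j.succAbove b, j.succAbove c, by
      simpa only [Fin.insertNth_apply_succAbove] using habc⟩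
  median := by
    have key : ∀ u v : Fin k, u ≠ v → ∃ α, Distinct3 (if α = γ then z else dir P α γ) (P α u)
        (P α v) := by
      intro u v huv
      by_cases h1 : P γ u = P γ v
      · obtain ⟨w, hw, -⟩ := h.exists_ne γ (P γ u) (P γ u)
        obtain ⟨μ, hμ⟩ := h.median w u v ⟨fun e => hw (e ▸ rfl), huv, fun e => hw (e ▸ h1.symm)⟩
        obtain ⟨m1, m2, m3⟩ := h.dir_of_median hμ hw rfl h1.symm
        refine ⟨μ, ?_⟩
        rw [if_neg m1.symm, ← m3]
        exact hμ
      · refine ⟨γ, ?_⟩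
        rw [if_pos rfl]
        exact ⟨hz u, h1, hz v⟩
    intro a b c habc
    rcases eq_or_eq_succAbove j a with rfl | ⟨a, rfl⟩ <;>
    rcases eq_or_eq_succAbove j b with rfl | ⟨b, rfl⟩ <;>
    rcases eq_or_eq_succAbove j c with rfl | ⟨c, rfl⟩ <;>
    simp only [Fin.insertNth_apply_same, Fin.insertNth_apply_succAbove]
    · exact absurd rfl habc.1
    · exact absurd rfl habc.1
    · exact absurd rfl habc.2.2
    · exact key b c (fun e => habc.2.1 (e ▸ rfl))
    · exact absurd rfl habc.2.1
    · obtain ⟨α, hα⟩ := key a c (fun e => habc.2.2 (e ▸ rfl))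
      exact ⟨α, hα.swap⟩
    · obtain ⟨α, hα⟩ := key a b (fun e => habc.1 (e ▸ rfl))
      exact ⟨α, hα.rotate⟩
    · exact h.median a b c ⟨fun e => habc.1 (e ▸ rfl), fun e => habc.2.1 (e ▸ rfl),
        fun e => habc.2.2 (e ▸ rfl)⟩

/-- The new label `j` is put where `i` is: the component `none` has `i` at `0`, `j` at `1` and all
other labels at `∞`, and the old components see `j` at the position of `i`. -/
theorem IsFamily.insert_bubble {V : Type*} [Nonempty V] {P : V → Fin k → OnePoint ℂ}
    (h : IsFamily P) (j : Fin (k + 1)) (i : Fin k) :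
    IsFamily fun α : Option V => (j.insertNth (α.elim ((1 : ℂ) : OnePoint ℂ) fun α => P α i)
      (fun l => α.elim (if l = i then ((0 : ℂ) : OnePoint ℂ) else OnePoint.infty) fun α => P α l) :
      Fin (k + 1) → OnePoint ℂ) where
  cross := by
    have key : ∀ (α : V) (l : Fin (k + 1)),
        (j.insertNth ((1 : ℂ) : OnePoint ℂ) (fun l => if l = i then ((0 : ℂ) : OnePoint ℂ) else
          OnePoint.infty) : Fin (k + 1) → OnePoint ℂ) l = OnePoint.infty ∨
        (j.insertNth (P α i) (P α) : Fin (k + 1) → OnePoint ℂ) l = P α i := by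
      intro α l
      rcases eq_or_eq_succAbove j l with rfl | ⟨l, rfl⟩
      · simp only [Fin.insertNth_apply_same]; right; trivial
      · simp only [Fin.insertNth_apply_succAbove]
        by_cases hl : l = i
        · right; rw [hl]
        · left; rw [if_neg hl]
    rintro (_ | α) (_ | β) hne
    · exact absurd rfl hne
    · exact ⟨_, _, key β⟩
    · exact ⟨_, _, fun l => (key α l).symm⟩
    · obtain ⟨n, n', hn⟩ := h.cross α β (fun e => hne (e ▸ rfl))
      refine ⟨n, n', fun l => ?_⟩
      rcases eq_or_eq_succAbove j l with rfl | ⟨l, rfl⟩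
      · simp only [Fin.insertNth_apply_same]
        exact hn i
      · simp only [Fin.insertNth_apply_succAbove]
        exact hn l
  three := by
    rintro (_ | α)
    · obtain ⟨a, b, c, habc⟩ := h.three (Classical.arbitrary V)
      obtain ⟨u, hu, -⟩ := habc.of_map.exists_ne (f := id) i i
      refine ⟨j.succAbove i, j, j.succAbove u, ?_⟩
      simp only [Fin.insertNth_apply_same, Fin.insertNth_apply_succAbove, Option.elim]
      rw [if_pos trivial, if_neg (show u ≠ i from hu)]
      refine ⟨?_, ?_, ?_⟩ <;> simp
    · obtain ⟨a, b, c, habc⟩ := h.three α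
      exact ⟨j.succAbove a, j.succAbove b, j.succAbove c, by
        simpa only [Fin.insertNth_apply_succAbove, Option.elim] using habc⟩
  median := by
    have key : ∀ u v : Fin k, u ≠ v → ∃ α : Option V, Distinct3
        (α.elim ((1 : ℂ) : OnePoint ℂ) fun α => P α i)
        (α.elim (if u = i then ((0 : ℂ) : OnePoint ℂ) else OnePoint.infty) fun α => P α u)
        (α.elim (if v = i then ((0 : ℂ) : OnePoint ℂ) else OnePoint.infty) fun α => P α v) := by
      intro u v huv
      by_cases hu : u = i
      · refine ⟨none, ?_⟩
        simp only [Option.elim]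
        rw [if_pos hu, if_neg (fun e => huv (hu.trans e.symm))]
        refine ⟨?_, ?_, ?_⟩ <;> simp
      · by_cases hv : v = i
        · refine ⟨none, ?_⟩
          simp only [Option.elim]
          rw [if_pos hv, if_neg hu]
          refine ⟨?_, ?_, ?_⟩ <;> simp
        · obtain ⟨α, hα⟩ := h.median i u v ⟨Ne.symm hu, huv, Ne.symm hv⟩
          exact ⟨some α, hα⟩
    intro a b c habc
    rcases eq_or_eq_succAbove j a with rfl | ⟨a, rfl⟩ <;>
    rcases eq_or_eq_succAbove j b with rfl | ⟨b, rfl⟩ <;>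
    rcases eq_or_eq_succAbove j c with rfl | ⟨c, rfl⟩ <;>
    simp only [Fin.insertNth_apply_same, Fin.insertNth_apply_succAbove]
    · exact absurd rfl habc.1
    · exact absurd rfl habc.1
    · exact absurd rfl habc.2.2
    · exact key b c (fun e => habc.2.1 (e ▸ rfl))
    · exact absurd rfl habc.2.1
    · obtain ⟨α, hα⟩ := key a c (fun e => habc.2.2 (e ▸ rfl))
      exact ⟨α, hα.swap⟩
    · obtain ⟨α, hα⟩ := key a b (fun e => habc.1 (e ▸ rfl))
      exact ⟨α, hα.rotate⟩
    · obtain ⟨α, hα⟩ := h.median a b c ⟨fun e => habc.1 (e ▸ rfl), fun e => habc.2.1 (e ▸ rfl),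
        fun e => habc.2.2 (e ▸ rfl)⟩
      exact ⟨some α, hα⟩

open Classical in
/-- A label can be added at each position that is not occupied, and at the position of a label. -/
theorem exists_add_label (hk : 3 ≤ k) (j : Fin (k + 1)) (y : DM k) {a b c : Fin k}
    (habc : Distinct3 a b c) (z : OnePoint ℂ)
    (hz : (∀ l, z ≠ view y a b c l) ∨ z = ((0 : ℂ) : OnePoint ℂ)) :
    ∃ x : DM (k + 1), forget hk j.succAboveEmb x = y ∧
      view x (j.succAbove a) (j.succAbove b) (j.succAbove c) j = z := by
  obtain ⟨C, rfl⟩ := y.exists_rep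
  obtain ⟨γ, hγ⟩ := C.isFamily.median a b c habc
  have : Nonempty (Fin C.n) := ⟨γ⟩
  have key : ∀ x : DM (k + 1), (∀ α : Fin C.n, ∀ a b c l : Fin k,
      Distinct3 (C.proj α a) (C.proj α b) (C.proj α c) →
      view x (j.succAbove a) (j.succAbove b) (j.succAbove c) (j.succAbove l) =
        cr (C.proj α a) (C.proj α b) (C.proj α c) (C.proj α l)) →
      forget hk j.succAboveEmb x = DM.mk C := by
    intro x hx
    refine DM.ext_view fun a b c l h => ?_
    obtain ⟨α, hα⟩ := C.isFamily.median a b c h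
    rw [view_forget hk _ _ _ h, view_eq_cr hα]
    exact hx α a b c l hα
  rcases hz with hz | rfl
  · obtain ⟨g, hg⟩ := exists_view_eq_smul hγ
    have hz' : ∀ l, g⁻¹ • z ≠ C.proj γ l := fun l e => hz l (by rw [hg, ← e, smul_inv_smul])
    obtain ⟨x, hx⟩ := (C.isFamily.insert_generic j γ (g⁻¹ • z) hz').exists_DM
    refine ⟨x, key x fun α a b c l hα => ?_, ?_⟩
    · have h1 := hx α (j.succAbove a) (j.succAbove b) (j.succAbove c) (j.succAbove l)
      simp only [Fin.insertNth_apply_succAbove] at h1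
      exact h1 hα
    · have h1 := hx γ (j.succAbove a) (j.succAbove b) (j.succAbove c) j
      simp only [Fin.insertNth_apply_succAbove, Fin.insertNth_apply_same, if_true] at h1
      rw [h1 hγ]
      obtain ⟨g', hg'⟩ := exists_gl_cr hγ.1 hγ.2.1 hγ.2.2
      have h2 : ∀ l, g' • C.proj γ l = g • C.proj γ l := fun l => by
        rw [← hg', ← hg, view_eq_cr hγ]
      -- Both maps agree at three distinct points, hence also at the unoccupied point `g⁻¹ • z`.
      have h3 : ∀ w : OnePoint ℂ, g' • w = g • w := by
        intro w
        have e := cr_inj (a := g • C.proj γ a) (b := g • C.proj γ b) (c := g • C.proj γ c)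
          (z := g' • w) (w := g • w) ((MulAction.injective g).ne hγ.1)
          ((MulAction.injective g).ne hγ.2.1) ((MulAction.injective g).ne hγ.2.2)
        refine e.mp ?_
        have r1 : Related (fun z : OnePoint ℂ => z) fun z => g • z := Or.inl ⟨g, fun _ => rfl⟩
        have r2 : Related (fun z : OnePoint ℂ => z) fun z => g' • z := Or.inl ⟨g', fun _ => rfl⟩
        have n0 := noThree_of_distinct hγ.1 hγ.2.1 hγ.2.2 w
        have n1 : ∀ g : GL (Fin 2) ℂ, NoThree (g • C.proj γ a) (g • C.proj γ b) (g • C.proj γ c)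
            (g • w) := fun g => noThree_of_distinct ((MulAction.injective g).ne hγ.1)
          ((MulAction.injective g).ne hγ.2.1) ((MulAction.injective g).ne hγ.2.2) _
        rw [← r1.cr_eq n0 (n1 g), ← h2, ← h2, ← h2, ← r2.cr_eq n0 (n1 g')]
      rw [hg', h3, smul_inv_smul]
  · obtain ⟨x, hx⟩ := (C.isFamily.insert_bubble j a).exists_DM
    refine ⟨x, key x fun α a b c l hα => ?_, ?_⟩
    · have h1 := hx (some α) (j.succAbove a) (j.succAbove b) (j.succAbove c) (j.succAbove l)
      simp only [Fin.insertNth_apply_succAbove, Option.elim] at h1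
      exact h1 hα
    · have h1 := hx (some γ) (j.succAbove a) (j.succAbove b) (j.succAbove c) j
      simp only [Fin.insertNth_apply_succAbove, Fin.insertNth_apply_same, Option.elim] at h1
      rw [h1 hγ, cr_self_left hγ.1 hγ.2.1 hγ.2.2]

end

end

section

/-! ### Smooth maps to the sphere -/

theorem affineChart_coe (z : ℂ) : affineChart (z : OnePoint ℂ) = z :=
  (OnePoint.isOpenEmbedding_coe (X := ℂ)).toOpenPartialHomeomorph_left_inv

theorem coe_affineChart {w : OnePoint ℂ} (hw : w ≠ OnePoint.infty) :
    ((affineChart w : ℂ) : OnePoint ℂ) = w := by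
  induction w using OnePoint.rec with
  | infty => exact absurd rfl hw
  | coe z => rw [affineChart_coe]

/-- The determinant of two vectors. -/
def br (u v : ℂ × ℂ) : ℂ := u.1 * v.2 - v.1 * u.2

theorem br_homog (z w : OnePoint ℂ) : br (homog z) (homog w) = homogSub z w := rfl

theorem br_smul (s t : ℂ) (u v : ℂ × ℂ) : br (s • u) (t • v) = s * t * br u v := by
  simp only [br, Prod.smul_fst, Prod.smul_snd, smul_eq_mul]; ring

/-- The point of the sphere with the given homogeneous coordinates. -/
def point (u : ℂ × ℂ) : OnePoint ℂ := toSphere u.1 u.2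

theorem ne_zero_prod_iff {u : ℂ × ℂ} : u ≠ 0 ↔ u.1 ≠ 0 ∨ u.2 ≠ 0 := by
  rw [Ne, Prod.ext_iff, not_and_or]; rfl

theorem point_homog (z : OnePoint ℂ) : point (homog z) = z := toSphere_homog z

theorem homog_ne (z : OnePoint ℂ) : homog z ≠ 0 := ne_zero_prod_iff.mpr (homog_ne_zero z)

theorem homog_point {u : ℂ × ℂ} (hu : u ≠ 0) : ∃ s : ℂ, s ≠ 0 ∧ homog (point u) = s • u := by
  obtain ⟨s, hs, h1, h2⟩ := homog_toSphere (ne_zero_prod_iff.mp hu)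
  exact ⟨s, hs, Prod.ext h1 h2⟩

theorem point_smul {s : ℂ} (hs : s ≠ 0) (u : ℂ × ℂ) : point (s • u) = point u :=
  toSphere_smul hs _ _

theorem point_eq_iff {u v : ℂ × ℂ} (hu : u ≠ 0) (hv : v ≠ 0) : point u = point v ↔ br u v = 0 := by
  rw [point, point, toSphere_eq_iff (ne_zero_prod_iff.mp hu) (ne_zero_prod_iff.mp hv), br,
    sub_eq_zero]

theorem point_swap {u : ℂ × ℂ} (hu : u ≠ 0) : point u = sphereInv (point u.swap) := by
  rcases ne_zero_prod_iff.mp hu with h | h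
  · by_cases h2 : u.2 = 0
    · simp [point, toSphere, h2, h, sphereInv_zero]
    · simp only [point, toSphere, Prod.fst_swap, Prod.snd_swap, h, h2, if_false]
      rw [sphereInv_coe (div_ne_zero h2 h), inv_div]
  · by_cases h1 : u.1 = 0
    · simp [point, toSphere, h1, h, sphereInv_infty]
    · simp only [point, toSphere, Prod.fst_swap, Prod.snd_swap, h, h1, if_false]
      rw [sphereInv_coe (div_ne_zero h h1), inv_div]

section Smooth

variable {E F : Type*} [NormedAddCommGroup E] [NormedSpace ℝ E] [NormedAddCommGroup F]
  [NormedSpace ℝ F]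

/-- Smoothness at a point of a map to the sphere, in terms of homogeneous coordinates. -/
def SmoothAt (f : E → OnePoint ℂ) (x : E) : Prop :=
  ∃ u : E → ℂ × ℂ, ContDiffAt ℝ ((⊤ : ℕ∞) : WithTop ℕ∞) u x ∧ u x ≠ 0 ∧ ∀ᶠ y in 𝓝 x, f y = point (u y)

theorem SmoothAt.congr {f g : E → OnePoint ℂ} {x : E} (h : SmoothAt f x) (hg : g =ᶠ[𝓝 x] f) :
    SmoothAt g x := by
  obtain ⟨u, h1, h2, h3⟩ := h
  exact ⟨u, h1, h2, hg.trans h3⟩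

theorem SmoothAt.comp {f : E → OnePoint ℂ} {g : F → E} (x : F) (h : SmoothAt f (g x))
    (hg : ContDiffAt ℝ ((⊤ : ℕ∞) : WithTop ℕ∞) g x) : SmoothAt (fun y => f (g y)) x := by
  obtain ⟨u, h1, h2, h3⟩ := h
  exact ⟨fun y => u (g y), h1.comp x hg, h2, hg.continuousAt.eventually h3⟩

theorem smoothAt_const (w : OnePoint ℂ) (x : E) : SmoothAt (fun _ => w) x :=
  ⟨fun _ => homog w, contDiffAt_const, homog_ne w, Filter.Eventually.of_forall fun _ =>
    (point_homog w).symm⟩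

theorem smoothAt_coe {f : E → ℂ} {x : E} (h : ContDiffAt ℝ ((⊤ : ℕ∞) : WithTop ℕ∞) f x) :
    SmoothAt (fun y => (f y : OnePoint ℂ)) x :=
  ⟨fun y => (f y, 1), h.prodMk contDiffAt_const, ne_zero_prod_iff.mpr (Or.inr one_ne_zero),
    Filter.Eventually.of_forall fun _ => (toSphere_one _).symm⟩

theorem contDiffAt_br {u v : E → ℂ × ℂ} {x : E} {n : WithTop ℕ∞} (hu : ContDiffAt ℝ n u x)
    (hv : ContDiffAt ℝ n v x) : ContDiffAt ℝ n (fun y => br (u y) (v y)) x :=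
  (hu.fst.mul hv.snd).sub (hv.fst.mul hu.snd)

theorem SmoothAt.contDiffAt {f : E → OnePoint ℂ} {x : E} (h : SmoothAt f x)
    (hx : f x ≠ OnePoint.infty) :
    ContDiffAt ℝ ((⊤ : ℕ∞) : WithTop ℕ∞) (fun y => affineChart (f y)) x := by
  obtain ⟨u, h1, h2, h3⟩ := h
  have h4 : (u x).2 ≠ 0 := fun h4 => hx (by
    rw [h3.self_of_nhds, point, h4, toSphere_zero_right])
  refine (h1.fst.mul (h1.snd.inv h4)).congr_of_eventuallyEq ?_
  filter_upwards [h3, h1.continuousAt.snd.eventually_ne h4] with y h5 h6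
  rw [h5, point, toSphere_of_ne h6, affineChart_coe, div_eq_mul_inv]
  rfl

theorem SmoothAt.sphereInv {f : E → OnePoint ℂ} {x : E} (h : SmoothAt f x) :
    SmoothAt (fun y => sphereInv (f y)) x := by
  obtain ⟨u, h1, h2, h3⟩ := h
  refine ⟨fun y => (u y).swap, h1.snd.prodMk h1.fst, fun h4 => h2 (Prod.swap_injective h4), ?_⟩
  filter_upwards [h3, h1.continuousAt.eventually_ne h2] with y h5 h6
  rw [h5, point_swap h6, sphereInv_involutive]

theorem SmoothAt.continuousAt {f : E → OnePoint ℂ} {x : E} (h : SmoothAt f x) :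
    ContinuousAt f x := by
  have key : ∀ {f : E → OnePoint ℂ}, SmoothAt f x → f x ≠ OnePoint.infty → ContinuousAt f x := by
    intro f h hx
    have h1 := OnePoint.continuous_coe.continuousAt.comp (h.contDiffAt hx).continuousAt
    refine h1.congr ?_
    obtain ⟨u, h1, h2, h3⟩ := h
    have h4 : (u x).2 ≠ 0 := fun h4 => hx (by
      rw [h3.self_of_nhds, point, h4, toSphere_zero_right])
    filter_upwards [h3, h1.continuousAt.snd.eventually_ne h4] with y h5 h6
    refine coe_affineChart ?_
    rw [h5, point, Ne, toSphere_eq_infty_iff]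
    exact h6
  by_cases hx : f x = OnePoint.infty
  · have h1 := key h.sphereInv (by simp only [hx, sphereInv_infty]; exact OnePoint.coe_ne_infty _)
    have h2 := continuous_sphereInv.continuousAt.comp h1
    refine h2.congr (Filter.Eventually.of_forall fun y => ?_)
    exact sphereInv_involutive _
  · exact key h hx

theorem isSmoothToSphereOn_iff {E : Type} [NormedAddCommGroup E] [NormedSpace ℝ E]
    {f : E → OnePoint ℂ} {s : Set E} (hs : IsOpen s) :
    IsSmoothToSphereOn f s ↔ ∀ x ∈ s, SmoothAt f x := by
  constructor
  · rintro ⟨h1, h2⟩ x hx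
    have hc := h1.continuousAt (hs.mem_nhds hx)
    rcases h2 x hx with ⟨h3, h4⟩ | ⟨h3, h4⟩
    · refine (smoothAt_coe (h4.contDiffAt (hs.mem_nhds hx))).congr ?_
      filter_upwards [hc.eventually_ne h3] with y hy
      exact (coe_affineChart hy).symm
    · refine (smoothAt_coe (h4.contDiffAt (hs.mem_nhds hx))).sphereInv.congr ?_
      filter_upwards [hc.eventually_ne h3] with y hy
      rw [coe_affineChart, sphereInv_involutive]
      intro e
      exact hy (by rw [← sphereInv_involutive (f y), e, sphereInv_infty])
  · intro h
    refine ⟨fun x hx => (h x hx).continuousAt.continuousWithinAt, fun x hx => ?_⟩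
    by_cases h1 : f x = OnePoint.infty
    · refine Or.inr ⟨?_, ((h x hx).sphereInv.contDiffAt ?_).contDiffWithinAt⟩
      · rw [h1]; exact OnePoint.infty_ne_coe _
      · rw [h1, sphereInv_infty]; exact OnePoint.coe_ne_infty _
    · exact Or.inl ⟨h1, ((h x hx).contDiffAt h1).contDiffWithinAt⟩

/-- Numerator and denominator are homogeneous coordinates of the cross ratio, not both zero by
`NoThree`; the scalings of the four vectors multiply both by one factor. -/
theorem SmoothAt.cr {f₀ f₁ f₂ f₃ : E → OnePoint ℂ} {x : E} (h₀ : SmoothAt f₀ x)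
    (h₁ : SmoothAt f₁ x) (h₂ : SmoothAt f₂ x) (h₃ : SmoothAt f₃ x)
    (hn : NoThree (f₀ x) (f₁ x) (f₂ x) (f₃ x)) :
    SmoothAt (fun y => cr (f₀ y) (f₁ y) (f₂ y) (f₃ y)) x := by
  obtain ⟨u₀, a₀, b₀, c₀⟩ := h₀
  obtain ⟨u₁, a₁, b₁, c₁⟩ := h₁
  obtain ⟨u₂, a₂, b₂, c₂⟩ := h₂
  obtain ⟨u₃, a₃, b₃, c₃⟩ := h₃
  have key : ∀ {v₀ v₁ v₂ v₃ : ℂ × ℂ}, v₀ ≠ 0 → v₁ ≠ 0 → v₂ ≠ 0 → v₃ ≠ 0 → ∃ s : ℂ, s ≠ 0 ∧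
      homogSub (point v₁) (point v₂) * homogSub (point v₃) (point v₀) =
        s * (br v₁ v₂ * br v₃ v₀) ∧
      homogSub (point v₀) (point v₁) * homogSub (point v₂) (point v₃) =
        s * (br v₀ v₁ * br v₂ v₃) := by
    intro v₀ v₁ v₂ v₃ e₀ e₁ e₂ e₃
    obtain ⟨s₀, t₀, r₀⟩ := homog_point e₀
    obtain ⟨s₁, t₁, r₁⟩ := homog_point e₁
    obtain ⟨s₂, t₂, r₂⟩ := homog_point e₂
    obtain ⟨s₃, t₃, r₃⟩ := homog_point e₃
    refine ⟨s₀ * s₁ * s₂ * s₃, by simp [t₀, t₁, t₂, t₃], ?_, ?_⟩ <;>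
    · simp only [← br_homog, r₀, r₁, r₂, r₃, br_smul]; ring
  refine ⟨fun y => (br (u₁ y) (u₂ y) * br (u₃ y) (u₀ y), br (u₀ y) (u₁ y) * br (u₂ y) (u₃ y)),
    ((contDiffAt_br a₁ a₂).mul (contDiffAt_br a₃ a₀)).prodMk
      ((contDiffAt_br a₀ a₁).mul (contDiffAt_br a₂ a₃)), ?_, ?_⟩
  · have h1 := hn.ne_zero
    rw [c₀.self_of_nhds, c₁.self_of_nhds, c₂.self_of_nhds, c₃.self_of_nhds] at h1
    obtain ⟨s, hs, e1, e2⟩ := key b₀ b₁ b₂ b₃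
    rw [e1, e2] at h1
    rw [ne_zero_prod_iff]
    exact h1.imp right_ne_zero_of_mul right_ne_zero_of_mul
  · filter_upwards [c₀, c₁, c₂, c₃, a₀.continuousAt.eventually_ne b₀,
      a₁.continuousAt.eventually_ne b₁, a₂.continuousAt.eventually_ne b₂,
      a₃.continuousAt.eventually_ne b₃] with y d₀ d₁ d₂ d₃ e₀ e₁ e₂ e₃
    obtain ⟨s, hs, e1, e2⟩ := key e₀ e₁ e₂ e₃
    rw [d₀, d₁, d₂, d₃, DeligneMumford.cr, e1, e2, toSphere_smul hs]
    rfl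

/-! ### Solving the bilinear relation between two views -/

/-- Homogeneous coordinates of the position of a label in the second view, if it is at `X` in the first
view and three labels are at `a`, `b`, `c` in the first and at `a'`, `b'`, `c'` in the second
view. -/
def solveVec (X a b c a' b' c' : ℂ × ℂ) : ℂ × ℂ :=
  (br b' c' * br a b * br c X) • a' + (br b c * br X a * br a' b') • c'

/-- The vector `solveVec` in terms of points of the sphere. -/
def solve (X a b c a' b' c' : OnePoint ℂ) : ℂ × ℂ :=
  solveVec (homog X) (homog a) (homog b) (homog c) (homog a') (homog b') (homog c')

theorem solve_point {X a b c a' b' c' : ℂ × ℂ} (hX : X ≠ 0) (ha : a ≠ 0) (hb : b ≠ 0) (hc : c ≠ 0)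
    (ha' : a' ≠ 0) (hb' : b' ≠ 0) (hc' : c' ≠ 0) : ∃ s : ℂ, s ≠ 0 ∧
    solve (point X) (point a) (point b) (point c) (point a') (point b') (point c') =
      s • solveVec X a b c a' b' c' := by
  obtain ⟨s₀, t₀, r₀⟩ := homog_point hX
  obtain ⟨s₁, t₁, r₁⟩ := homog_point ha
  obtain ⟨s₂, t₂, r₂⟩ := homog_point hb
  obtain ⟨s₃, t₃, r₃⟩ := homog_point hc
  obtain ⟨s₄, t₄, r₄⟩ := homog_point ha'
  obtain ⟨s₅, t₅, r₅⟩ := homog_point hb'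
  obtain ⟨s₆, t₆, r₆⟩ := homog_point hc'
  refine ⟨s₀ * s₁ * s₂ * s₃ * s₄ * s₅ * s₆, by simp [*], ?_⟩
  simp only [solve, solveVec, r₀, r₁, r₂, r₃, r₄, r₅, r₆, br_smul]
  ext
  · simp only [Prod.smul_fst, Prod.fst_add, smul_eq_mul]; ring
  · simp only [Prod.smul_snd, Prod.snd_add, smul_eq_mul]; ring

theorem SmoothAt.solve {X a b c a' b' c' : E → OnePoint ℂ} {x : E} (hX : SmoothAt X x)
    (ha : SmoothAt a x) (hb : SmoothAt b x) (hc : SmoothAt c x) (ha' : SmoothAt a' x)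
    (hb' : SmoothAt b' x) (hc' : SmoothAt c' x)
    (h : solve (X x) (a x) (b x) (c x) (a' x) (b' x) (c' x) ≠ 0) :
    SmoothAt (fun y => point (solve (X y) (a y) (b y) (c y) (a' y) (b' y) (c' y))) x ∧
      ∀ᶠ y in 𝓝 x, DeligneMumford.solve (X y) (a y) (b y) (c y) (a' y) (b' y) (c' y) ≠ 0 := by
  obtain ⟨u₀, a₀, b₀, c₀⟩ := hX
  obtain ⟨u₁, a₁, b₁, c₁⟩ := ha
  obtain ⟨u₂, a₂, b₂, c₂⟩ := hb
  obtain ⟨u₃, a₃, b₃, c₃⟩ := hc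
  obtain ⟨u₄, a₄, b₄, c₄⟩ := ha'
  obtain ⟨u₅, a₅, b₅, c₅⟩ := hb'
  obtain ⟨u₆, a₆, b₆, c₆⟩ := hc'
  let U : E → ℂ × ℂ := fun y => solveVec (u₀ y) (u₁ y) (u₂ y) (u₃ y) (u₄ y) (u₅ y) (u₆ y)
  have hU : ContDiffAt ℝ ((⊤ : ℕ∞) : WithTop ℕ∞) U x :=
    ((((contDiffAt_br a₅ a₆).mul (contDiffAt_br a₁ a₂)).mul (contDiffAt_br a₃ a₀)).smul a₄).add
      ((((contDiffAt_br a₂ a₃).mul (contDiffAt_br a₀ a₁)).mul (contDiffAt_br a₄ a₅)).smul a₆)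
  have hev : ∀ᶠ y in 𝓝 x, ∃ s : ℂ, s ≠ 0 ∧
      DeligneMumford.solve (X y) (a y) (b y) (c y) (a' y) (b' y) (c' y) = s • U y := by
    filter_upwards [c₀, c₁, c₂, c₃, c₄, c₅, c₆, a₀.continuousAt.eventually_ne b₀,
      a₁.continuousAt.eventually_ne b₁, a₂.continuousAt.eventually_ne b₂,
      a₃.continuousAt.eventually_ne b₃, a₄.continuousAt.eventually_ne b₄,
      a₅.continuousAt.eventually_ne b₅, a₆.continuousAt.eventually_ne b₆]
      with y d₀ d₁ d₂ d₃ d₄ d₅ d₆ e₀ e₁ e₂ e₃ e₄ e₅ e₆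
    rw [d₀, d₁, d₂, d₃, d₄, d₅, d₆]
    exact solve_point e₀ e₁ e₂ e₃ e₄ e₅ e₆
  have hx : U x ≠ 0 := by
    obtain ⟨s, hs, e⟩ := hev.self_of_nhds
    rw [e] at h
    exact (smul_ne_zero_iff.mp h).2
  refine ⟨⟨U, hU, hx, ?_⟩, ?_⟩
  · filter_upwards [hev] with y hy
    obtain ⟨s, hs, e⟩ := hy
    rw [e, point_smul hs]
  · filter_upwards [hev, hU.continuousAt.eventually_ne hx] with y hy h0
    obtain ⟨s, hs, e⟩ := hy
    rw [e]
    exact smul_ne_zero hs h0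

/-- The four-term relation is linear in the homogeneous coordinates of `P' d`; it says that their
determinant with the vector `solve` vanishes. -/
theorem Related.eq_point_solve {L : Type*} {P P' : L → OnePoint ℂ} (h : Related P P') (a b c d : L)
    (h0 : solve (P d) (P a) (P b) (P c) (P' a) (P' b) (P' c) ≠ 0) :
    P' d = point (solve (P d) (P a) (P b) (P c) (P' a) (P' b) (P' c)) := by
  have h1 := h.four_term a b c d
  refine (point_homog (P' d)).symm.trans ((point_eq_iff (homog_ne _) h0).mpr ?_)
  simp only [← br_homog] at h1
  simp only [solve, solveVec]
  simp only [br, Prod.fst_add, Prod.snd_add, Prod.smul_fst, Prod.smul_snd, smul_eq_mul] at h1 ⊢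
  linear_combination -h1

/-- In the Moebius case any three separated labels do. In the rank one case at least two labels sit
at the node `n`, so `hX` gives `X ≠ n`; with `a`, `c` distinct and off `n` in the first view and `b`
off `n'` in the second, the solution is a nonzero multiple of `n'`. -/
theorem Related.exists_solve_ne_zero {L : Type*} {P P' : L → OnePoint ℂ} (h : Related P P')
    (hP : ∃ a b c, Distinct3 (P a) (P b) (P c)) (hP' : ∃ a b c, Distinct3 (P' a) (P' b) (P' c))
    {X : OnePoint ℂ} (hX : ∀ u v, P u = X → P v = X → u = v) :
    ∃ a b c, solve X (P a) (P b) (P c) (P' a) (P' b) (P' c) ≠ 0 := by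
  rcases h with ⟨g, hg⟩ | ⟨n, n', hn⟩
  · obtain ⟨a, b, c, hd⟩ := hP
    refine ⟨a, b, c, fun h0 => ?_⟩
    have hinj := MulAction.injective (β := OnePoint ℂ) g
    have e1 : br (solve X (P a) (P b) (P c) (P' a) (P' b) (P' c)) (homog (P' c)) = 0 := by
      rw [h0]; simp [br]
    have e2 : br (homog (P' a)) (solve X (P a) (P b) (P c) (P' a) (P' b) (P' c)) = 0 := by
      rw [h0]; simp [br]
    have e1' : homogSub (P' b) (P' c) * homogSub (P a) (P b) * homogSub (P c) X *
        homogSub (P' a) (P' c) = 0 := by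
      rw [← e1]
      simp only [solve, solveVec, ← br_homog]
      simp only [br, Prod.fst_add, Prod.snd_add, Prod.smul_fst, Prod.smul_snd, smul_eq_mul]
      ring
    have e2' : homogSub (P b) (P c) * homogSub X (P a) * homogSub (P' a) (P' b) *
        homogSub (P' a) (P' c) = 0 := by
      rw [← e2]
      simp only [solve, solveVec, ← br_homog]
      simp only [br, Prod.fst_add, Prod.snd_add, Prod.smul_fst, Prod.smul_snd, smul_eq_mul]
      ring
    simp only [mul_eq_zero, homogSub_eq_zero_iff, hg, hinj.eq_iff] at e1' e2'
    obtain ⟨h1, h2, h3⟩ := hd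
    have h4 : P c = X := by tauto
    have h5 : X = P a := by tauto
    exact h3 (h4.trans h5).symm
  · have hXn : X ≠ n := by
      rintro rfl
      obtain ⟨a, b, c, hd⟩ := hP'
      obtain ⟨l, l', h1, h2, h3⟩ := hd.exists_pair_ne n'
      exact h3 (congrArg P' (hX l l' ((hn l).resolve_right h1) ((hn l').resolve_right h2)))
    obtain ⟨_, _, _, hd⟩ := hP
    obtain ⟨a, c, ha, hc, hac⟩ := hd.exists_pair_ne n
    obtain ⟨_, _, _, hd'⟩ := hP'
    obtain ⟨b, hb, -⟩ := hd'.exists_ne n' n'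
    have ha' := (hn a).resolve_left ha
    have hc' := (hn c).resolve_left hc
    have hb' := (hn b).resolve_right hb
    refine ⟨a, b, c, fun h0 => ?_⟩
    have e : solve X (P a) (P b) (P c) (P' a) (P' b) (P' c) =
        (-(homogSub (P' b) n' * homogSub (P a) (P c) * homogSub X n)) • homog n' := by
      rw [ha', hc', hb']
      simp only [solve, solveVec, ← br_homog, ← add_smul]
      congr 1
      simp only [br]
      ring
    rw [e, smul_eq_zero, neg_eq_zero] at h0
    simp only [mul_eq_zero, homogSub_eq_zero_iff, homog_ne, or_false] at h0
    tauto

end Smooth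

end

section

/-! ### Splits of a curve and of the curve with one label less -/

section

variable {k : ℕ}

theorem view_eq_of_view_eq_zero {x : DM k} {a b c d a' b' c' : Fin k} (h : Distinct3 a b c)
    (h' : Distinct3 a' b' c') (h0 : view x a b c d = ((0 : ℂ) : OnePoint ℂ))
    (hne : view x a' b' c' b ≠ view x a' b' c' c) : view x a' b' c' a = view x a' b' c' d := by
  by_contra h1
  have hn : NoThree (view x a' b' c' a) (view x a' b' c' b) (view x a' b' c' c)
      (view x a' b' c' d) := by
    unfold NoThree
    grind
  rw [view_eq x h h' hn, hn.cr_eq_zero_iff] at h0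
  tauto

theorem view_eq_zero_swap {x : DM k} {a b c d : Fin k} (h : Distinct3 a b c)
    (h' : Distinct3 d b c) (h0 : view x a b c d = ((0 : ℂ) : OnePoint ℂ)) :
    view x d b c a = ((0 : ℂ) : OnePoint ℂ) := by
  have hn : NoThree (view x a b c d) (view x a b c b) (view x a b c c) (view x a b c a) := by
    rw [h0, view_left x h, view_mid x h, view_right x h]
    refine ⟨?_, ?_, ?_, ?_⟩ <;> simp
  rw [view_eq x h' h hn, hn.cr_eq_zero_iff, h0, view_left x h]
  exact Or.inr rfl

/-- The new position `X` is not occupied, except by the label `a` if `B` holds. -/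
def Free (B : Prop) (y : DM k) (a b c : Fin k) (X : OnePoint ℂ) : Prop :=
  ∀ l, (B → l ≠ a) → X ≠ view y a b c l

theorem Free.unique {B : Prop} {y : DM k} {a b c : Fin k} {X : OnePoint ℂ} (h : Free B y a b c X)
    {u v : Fin k} (hu : view y a b c u = X) (hv : view y a b c v = X) : u = v := by
  have h1 : u = a := by
    by_contra h1
    exact h u (fun _ => h1) hu.symm
  have h2 : v = a := by
    by_contra h2
    exact h v (fun _ => h2) hv.symm
  rw [h1, h2]

/-- The set `A` contains at least two of the three labels. -/
def Majority (a b c : Fin k) (A : Set (Fin k)) : Prop :=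
  (a ∈ A ∧ b ∈ A) ∨ (b ∈ A ∧ c ∈ A) ∨ (a ∈ A ∧ c ∈ A)

theorem Majority.exists_pair {a b c : Fin k} {A : Set (Fin k)} (h : Majority a b c A)
    {X : Type*} {f : Fin k → X} (hd : Distinct3 (f a) (f b) (f c)) :
    ∃ u ∈ A, ∃ v ∈ A, f u ≠ f v := by
  rcases h with h | h | h
  · exact ⟨a, h.1, b, h.2, hd.1⟩
  · exact ⟨b, h.1, c, h.2, hd.2.1⟩
  · exact ⟨a, h.1, c, h.2, hd.2.2⟩

theorem majority_compl {a b c : Fin k} {A : Set (Fin k)} :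
    Majority a b c Aᶜ ↔ ¬ Majority a b c A := by
  simp only [Majority, mem_compl_iff]
  tauto

/-- A set of labels is extended by the new label `j` if it contains the majority of `a`, `b`, `c`. -/
def lift (j : Fin (k + 1)) (a b c : Fin k) (A : Set (Fin k)) : Set (Fin (k + 1)) :=
  {l | (j.insertNth (Majority a b c A) (fun l => l ∈ A) : Fin (k + 1) → Prop) l}

@[simp] theorem mem_lift_self {j : Fin (k + 1)} {a b c : Fin k} {A : Set (Fin k)} :
    j ∈ lift j a b c A ↔ Majority a b c A := by
  simp [lift]

@[simp] theorem mem_lift_succAbove {j : Fin (k + 1)} {a b c l : Fin k} {A : Set (Fin k)} :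
    j.succAbove l ∈ lift j a b c A ↔ l ∈ A := by
  simp [lift]

theorem ext_succAbove {j : Fin (k + 1)} {A B : Set (Fin (k + 1))} (h : j ∈ A ↔ j ∈ B)
    (h' : ∀ l, j.succAbove l ∈ A ↔ j.succAbove l ∈ B) : A = B := by
  ext l
  rcases eq_or_eq_succAbove j l with rfl | ⟨l, rfl⟩
  · exact h
  · exact h' l

theorem lift_compl {j : Fin (k + 1)} {a b c : Fin k} {A : Set (Fin k)} :
    lift j a b c Aᶜ = (lift j a b c A)ᶜ :=
  ext_succAbove (j := j) (by rw [mem_compl_iff, mem_lift_self, mem_lift_self, majority_compl])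
    fun l => by rw [mem_compl_iff, mem_lift_succAbove, mem_lift_succAbove, mem_compl_iff]

theorem lift_injective {j : Fin (k + 1)} {a b c : Fin k} :
    Function.Injective (lift j a b c) := by
  intro A B h
  ext l
  rw [← mem_lift_succAbove (j := j) (a := a) (b := b) (c := c), h, mem_lift_succAbove]

variable (hk : 3 ≤ k) {j : Fin (k + 1)} {x : DM (k + 1)} {a b c : Fin k} (habc : Distinct3 a b c)
  {B : Prop} (hfree : Free B (forget hk j.succAboveEmb x) a b c
    (view x (j.succAbove a) (j.succAbove b) (j.succAbove c) j))

theorem view_forget_succAbove {a b c : Fin k} (habc : Distinct3 a b c) (l : Fin k) :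
    view (forget hk j.succAboveEmb x) a b c l =
      view x (j.succAbove a) (j.succAbove b) (j.succAbove c) (j.succAbove l) :=
  view_forget hk _ x l habc

include habc hfree

/-- The restriction can fail only if one side is `{l, j}` for an old label `l`. Then `l` sits at the
position of `j` in the view of `a`, `b`, `c`, and freeness leaves only `l = a`. -/
theorem IsSplit.restrict_or {A : Set (Fin (k + 1))} (hA : IsSplit x A) :
    IsSplit (forget hk j.succAboveEmb x) (j.succAbove ⁻¹' A) ∨
      (B ∧ (A = {j.succAbove a, j} ∨ Aᶜ = {j.succAbove a, j})) := by
  have hinj := Fin.succAbove_right_injective (p := j)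
  have key : ∀ A : Set (Fin (k + 1)), IsSplit x A →
      (∃ u ∈ j.succAbove ⁻¹' A, ∃ v ∈ j.succAbove ⁻¹' A, u ≠ v) ∨
        (B ∧ A = {j.succAbove a, j}) := by
    intro A hA
    by_contra! h1
    obtain ⟨h1, h2⟩ := h1
    obtain ⟨u, hu, v, hv, huv⟩ := hA.left
    have h3 : ∃ l, j.succAbove l ∈ A ∧ j ∈ A := by
      rcases eq_or_eq_succAbove j u with rfl | ⟨u, rfl⟩
      · rcases eq_or_eq_succAbove j v with rfl | ⟨v, rfl⟩
        · exact absurd rfl huv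
        · exact ⟨v, hv, hu⟩
      · rcases eq_or_eq_succAbove j v with rfl | ⟨v, rfl⟩
        · exact ⟨u, hu, hv⟩
        · exact absurd (congrArg _ (h1 u hu v hv)) huv
    obtain ⟨l, hl, hj⟩ := h3
    have h4 : ∀ m, j.succAbove m ∈ A → m = l := fun m hm => h1 m hm l hl
    have h5 : Majority a b c ({l}ᶜ : Set (Fin k)) := by
      simp only [Majority, mem_compl_iff, mem_singleton_iff]
      obtain ⟨e1, e2, e3⟩ := habc
      grind
    obtain ⟨s, hs, t, ht, hst⟩ := h5.exists_pair
      (f := fun l => view x (j.succAbove a) (j.succAbove b) (j.succAbove c) (j.succAbove l))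
      (view_distinct x (habc.map hinj))
    have hst' : s ≠ t := fun e => hst (e ▸ rfl)
    have h6 := hA.view_eq_zero (j.succAbove l) hl j hj (j.succAbove s) (fun h => hs (h4 s h))
      (j.succAbove t) (fun h => ht (h4 t h)) (Fin.succAbove_ne j l) (hinj.ne hst')
    have h7 := view_eq_of_view_eq_zero
      (Distinct3.map hinj ⟨Ne.symm hs, hst', Ne.symm ht⟩) (habc.map hinj) h6 hst
    rw [← view_forget_succAbove hk habc] at h7
    by_cases h8 : B ∧ l = a
    · obtain ⟨hB, rfl⟩ := h8
      refine h2 hB (ext_succAbove (j := j) (by simp [hj]) fun m => ?_)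
      simp only [mem_insert_iff, hinj.eq_iff, mem_singleton_iff, Fin.succAbove_ne, or_false]
      exact ⟨h4 m, fun e => e ▸ hl⟩
    · exact hfree l (fun hB e => h8 ⟨hB, e⟩) h7.symm
  rcases key A hA with h1 | h1
  · rcases key _ hA.compl with h2 | h2
    · refine Or.inl ⟨h1, h2, fun i hi i' hi' m hm m' hm' hii hmm => ?_⟩
      have hd : Distinct3 i m m' := ⟨fun e => hm (e ▸ hi), hmm, fun e => hm' (e ▸ hi)⟩
      rw [view_forget_succAbove hk hd]
      exact hA.view_eq_zero _ hi _ hi' _ hm _ hm' (hinj.ne hii) (hinj.ne hmm)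
    · exact Or.inr ⟨h2.1, Or.inr h2.2⟩
  · exact Or.inr ⟨h1.1, Or.inl h1.2⟩

/-- The view of `a`, `b`, `c` collapses the minority side to a point. With `j` on that side, at
least two old labels would occupy the position of `j`, against freeness. -/
theorem IsSplit.mem_of_majority {A : Set (Fin (k + 1))} (hA : IsSplit x A)
    (h : IsSplit (forget hk j.succAboveEmb x) (j.succAbove ⁻¹' A))
    (hm : Majority a b c (j.succAbove ⁻¹' A)) : j ∈ A := by
  by_contra hj
  have hinj := Fin.succAbove_right_injective (p := j)
  obtain ⟨s, hs, t, ht, hst⟩ := hm.exists_pair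
    (f := fun l => view x (j.succAbove a) (j.succAbove b) (j.succAbove c) (j.succAbove l))
    (view_distinct x (habc.map hinj))
  have hst' : s ≠ t := fun e => hst (e ▸ rfl)
  have h1 : ∀ u ∉ j.succAbove ⁻¹' A, view (forget hk j.succAboveEmb x) a b c u =
      view x (j.succAbove a) (j.succAbove b) (j.succAbove c) j := by
    intro u hu
    have h2 := hA.compl.view_eq_zero (j.succAbove u) hu j hj (j.succAbove s) (not_not.mpr hs)
      (j.succAbove t) (not_not.mpr ht) (Fin.succAbove_ne j u) (hinj.ne hst')
    rw [view_forget_succAbove hk habc]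
    exact view_eq_of_view_eq_zero (Distinct3.map hinj ⟨fun e => hu (e ▸ hs), hst',
      fun e => hu (e ▸ ht)⟩) (habc.map hinj) h2 hst
  obtain ⟨u, hu, v, hv, huv⟩ := h.right
  exact huv (hfree.unique (h1 u hu) (h1 v hv))

theorem IsSplit.eq_lift_or {A : Set (Fin (k + 1))} (hA : IsSplit x A) :
    (IsSplit (forget hk j.succAboveEmb x) (j.succAbove ⁻¹' A) ∧
      A = lift j a b c (j.succAbove ⁻¹' A)) ∨
      (B ∧ (A = {j.succAbove a, j} ∨ Aᶜ = {j.succAbove a, j})) := by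
  refine (hA.restrict_or hk habc hfree).imp_left fun h => ⟨h, ?_⟩
  refine ext_succAbove (j := j) ?_ fun l => by simp
  rw [mem_lift_self]
  refine ⟨fun hj => ?_, hA.mem_of_majority hk habc hfree h⟩
  by_contra hm
  rw [← majority_compl] at hm
  exact hA.compl.mem_of_majority hk habc hfree h.compl hm hj

/-- The labels outside `A`, at least two, share a point in the view of `a`, `b`, `c`, and by
freeness `j` is not there. Hence a view that separates two of them sees `j` at the node, together
with `A`. -/
theorem IsSplit.lift_of_majority {A : Set (Fin k)}
    (h : IsSplit (forget hk j.succAboveEmb x) A) (hm : Majority a b c A) :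
    IsSplit x (lift j a b c A) := by
  have hinj := Fin.succAbove_right_injective (p := j)
  obtain ⟨s, hs, t, ht, hst⟩ := hm.exists_pair
    (f := fun l => view x (j.succAbove a) (j.succAbove b) (j.succAbove c) (j.succAbove l))
    (view_distinct x (habc.map hinj))
  have hst' : s ≠ t := fun e => hst (e ▸ rfl)
  have key : ∀ u ∈ A, ∀ v ∉ A, ∀ v' ∉ A, v ≠ v' →
      view x (j.succAbove u) (j.succAbove v) (j.succAbove v') j = ((0 : ℂ) : OnePoint ℂ) := by
    intro u hu v hv v' hv' hvv
    have hd : ∀ u ∈ A, Distinct3 u v v' := fun u hu => ⟨fun e => hv (e ▸ hu), hvv, fun e => hv' (e ▸ hu)⟩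
    have h1 := h.compl.view_eq_zero v hv v' hv' s (not_not.mpr hs) t (not_not.mpr ht) hvv hst'
    have hd1 : Distinct3 v s t := ⟨fun e => hv (e ▸ hs), hst', fun e => hv (e ▸ ht)⟩
    rw [view_forget_succAbove hk hd1] at h1
    have h2 := view_eq_of_view_eq_zero (hd1.map hinj) (habc.map hinj) h1 hst
    have h3 : view x (j.succAbove a) (j.succAbove b) (j.succAbove c) j ≠
        view x (j.succAbove a) (j.succAbove b) (j.succAbove c) (j.succAbove v) := by
      intro e
      rw [← view_forget_succAbove hk habc, ← view_forget_succAbove hk habc] at h2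
      rw [← view_forget_succAbove hk habc] at e
      exact hvv (hfree.unique e.symm (h2.symm.trans e.symm))
    have hdu := (hd u hu).map hinj
    have h4 := view_distinct x hdu
    rcases view_related x (habc.map hinj) hdu with ⟨g, hg⟩ | ⟨n, n', hn⟩
    · exact absurd (by rw [hg, hg, h2]) h4.2.1
    · have hvn : view x (j.succAbove a) (j.succAbove b) (j.succAbove c) (j.succAbove v) = n := by
        by_contra hvn
        have e1 := (hn (j.succAbove v)).resolve_left hvn
        have e2 := (hn (j.succAbove v')).resolve_left (h2 ▸ hvn)
        exact h4.2.1 (e1.trans e2.symm)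
      have h5 := (hn j).resolve_left (hvn ▸ h3)
      have h6 : ∃ w ∈ A, view x (j.succAbove a) (j.succAbove b) (j.succAbove c)
          (j.succAbove w) ≠ n := by
        by_contra! h6
        exact hst ((h6 s hs).trans (h6 t ht).symm)
      obtain ⟨w, hw, hwn⟩ := h6
      have h7 := (hn (j.succAbove w)).resolve_left hwn
      rw [h5, ← h7]
      by_cases huw : u = w
      · subst huw
        rw [view_left x hdu]
      · rw [← view_forget_succAbove hk (hd u hu)]
        exact h.view_eq_zero u hu w hw v hv v' hv' huw hvv
  refine ⟨?_, ?_, ?_⟩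
  · obtain ⟨u, hu, v, hv, huv⟩ := h.left
    exact ⟨_, mem_lift_succAbove.mpr hu, _, mem_lift_succAbove.mpr hv, hinj.ne huv⟩
  · obtain ⟨u, hu, v, hv, huv⟩ := h.right
    exact ⟨_, mem_lift_succAbove.not.mpr hu, _, mem_lift_succAbove.not.mpr hv, hinj.ne huv⟩
  · intro i hi i' hi' m hm' m' hm'' hii hmm
    rcases eq_or_eq_succAbove j m with rfl | ⟨m, rfl⟩
    · exact absurd (mem_lift_self.mpr hm) hm'
    rcases eq_or_eq_succAbove j m' with rfl | ⟨m', rfl⟩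
    · exact absurd (mem_lift_self.mpr hm) hm''
    rw [mem_lift_succAbove] at hm' hm''
    have hmm' : m ≠ m' := fun e => hmm (e ▸ rfl)
    rcases eq_or_eq_succAbove j i with rfl | ⟨i, rfl⟩
    · rcases eq_or_eq_succAbove j i' with rfl | ⟨i', rfl⟩
      · exact absurd rfl hii
      rw [mem_lift_succAbove] at hi'
      exact view_eq_zero_swap
        (Distinct3.map hinj ⟨fun e => hm' (e ▸ hi'), hmm', fun e => hm'' (e ▸ hi')⟩)
        ⟨(Fin.succAbove_ne _ _).symm, hmm, (Fin.succAbove_ne _ _).symm⟩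
        (key i' hi' m hm' m' hm'' hmm')
    · rw [mem_lift_succAbove] at hi
      rcases eq_or_eq_succAbove j i' with rfl | ⟨i', rfl⟩
      · exact key i hi m hm' m' hm'' hmm'
      · rw [mem_lift_succAbove] at hi'
        have hd : Distinct3 i m m' := ⟨fun e => hm' (e ▸ hi), hmm', fun e => hm'' (e ▸ hi)⟩
        rw [← view_forget_succAbove hk hd]
        exact h.view_eq_zero i hi i' hi' m hm' m' hm'' (fun e => hii (e ▸ rfl)) hmm'

theorem isSplit_lift_iff {A : Set (Fin k)} :
    IsSplit x (lift j a b c A) ↔ IsSplit (forget hk j.succAboveEmb x) A := by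
  have hpre : ∀ A, j.succAbove ⁻¹' (lift j a b c A) = A := fun A => by ext l; simp
  have hno : ∀ A, lift j a b c A ≠ {j.succAbove a, j} := by
    intro A h
    have h1 : Majority a b c A := by
      rw [← mem_lift_self (j := j), h]
      simp
    have h2 : ∀ l, l ∈ A → l = a := by
      intro l hl
      rw [← mem_lift_succAbove (j := j) (a := a) (b := b) (c := c), h] at hl
      simpa using hl
    obtain ⟨s, hs, t, ht, hst⟩ := h1.exists_pair (f := id) habc
    exact hst ((h2 s hs).trans (h2 t ht).symm)
  constructor
  · intro h
    rcases h.restrict_or hk habc hfree with h1 | ⟨-, h1 | h1⟩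
    · rwa [hpre] at h1
    · exact absurd h1 (hno A)
    · rw [← lift_compl] at h1
      exact absurd h1 (hno _)
  · intro h
    by_cases hm : Majority a b c A
    · exact h.lift_of_majority hk habc hfree hm
    · rw [← majority_compl] at hm
      have h1 := (h.compl.lift_of_majority hk habc hfree hm).compl
      rwa [lift_compl, compl_compl] at h1

/-- When `j` is at `0`, freeness keeps all labels except `a` away from `0`, so the vanishing for the
pair `b`, `c` carries over to every pair `l`, `l'`. -/
theorem isSplit_pair_iff : IsSplit x {j.succAbove a, j} ↔
    view x (j.succAbove a) (j.succAbove b) (j.succAbove c) j = ((0 : ℂ) : OnePoint ℂ) := by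
  have hinj := Fin.succAbove_right_injective (p := j)
  have hmem : ∀ {l}, j.succAbove l ∈ ({j.succAbove a, j} : Set (Fin (k + 1))) ↔ l = a := by
    intro l
    simp
  constructor
  · intro h
    exact h.view_eq_zero _ (by simp) _ (by simp) _ (hmem.not.mpr habc.1.symm) _
      (hmem.not.mpr habc.2.2.symm) (Fin.succAbove_ne j a) (hinj.ne habc.2.1)
  · intro h0
    have key : ∀ l l', l ≠ a → l' ≠ a → l ≠ l' →
        view x (j.succAbove a) (j.succAbove l) (j.succAbove l') j = ((0 : ℂ) : OnePoint ℂ) := by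
      intro l l' hl hl' hll
      have hd : Distinct3 a l l' := ⟨hl.symm, hll, hl'.symm⟩
      have hd' := hd.map hinj
      have e := view_left x (habc.map hinj)
      have e' := view_left x hd'
      rcases view_related x (habc.map hinj) hd' with ⟨g, hg⟩ | ⟨n, n', hn⟩
      · have h1 := hg (j.succAbove a)
        rw [e', e] at h1
        rw [hg, h0]
        exact h1.symm
      · have hn0 : n ≠ ((0 : ℂ) : OnePoint ℂ) := by
          rintro rfl
          have h1 : ∀ l, l ≠ a → view x (j.succAbove a) (j.succAbove b) (j.succAbove c)
              (j.succAbove l) ≠ ((0 : ℂ) : OnePoint ℂ) := by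
            intro l hl h2
            rw [← h0, ← view_forget_succAbove hk habc] at h2
            exact hfree l (fun _ => hl) h2.symm
          have e1 := (hn (j.succAbove l)).resolve_left (h1 l hl)
          have e2 := (hn (j.succAbove l')).resolve_left (h1 l' hl')
          exact (view_distinct x hd').2.1 (e1.trans e2.symm)
        have e1 := (hn j).resolve_left (by rw [h0]; exact hn0.symm)
        have e2 := (hn (j.succAbove a)).resolve_left (by rw [e]; exact hn0.symm)
        rw [e1, ← e2, e']
    refine ⟨⟨_, Or.inl rfl, j, by simp, Fin.succAbove_ne j a⟩, ⟨j.succAbove b,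
      hmem.not.mpr habc.1.symm, j.succAbove c, hmem.not.mpr habc.2.2.symm, hinj.ne habc.2.1⟩, ?_⟩
    intro i hi i' hi' m hm m' hm' hii hmm
    rcases eq_or_eq_succAbove j m with rfl | ⟨m, rfl⟩
    · exact absurd (by simp) hm
    rcases eq_or_eq_succAbove j m' with rfl | ⟨m', rfl⟩
    · exact absurd (by simp) hm'
    rw [hmem] at hm hm'
    have hmm' : m ≠ m' := fun e => hmm (e ▸ rfl)
    have h1 := key m m' hm hm' hmm'
    rcases hi with rfl | hi
    · rcases hi' with rfl | hi'
      · exact absurd rfl hii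
      · rw [mem_singleton_iff.mp hi']
        exact h1
    · rw [mem_singleton_iff] at hi
      subst hi
      rcases hi' with rfl | hi'
      · exact view_eq_zero_swap (Distinct3.map hinj ⟨Ne.symm hm, hmm', Ne.symm hm'⟩)
          ⟨(Fin.succAbove_ne _ _).symm, hmm, (Fin.succAbove_ne _ _).symm⟩ h1
      · exact absurd (mem_singleton_iff.mp hi').symm hii

end

end

section

/-! ### Adding a coordinate to a cross ratio chart -/

/-- A chart by `d` cross ratios around a point of the Deligne-Mumford space; for `d = k - 3` this is a
cross ratio chart. -/
structure LocalChart (k d : ℕ) where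
  center : DM k
  chart : OpenPartialHomeomorph (DM k) (Fin d → ℂ)
  center_mem : center ∈ chart.source
  quad : Fin d → (Fin 4 ↪ Fin k)
  chart_eq : ∀ x ∈ chart.source, ∀ m, crossRatioMap k x (quad m) = ((chart x m : ℂ) : OnePoint ℂ)
  smooth : ∀ q, IsSmoothToSphereOn (fun v => crossRatioMap k (chart.symm v) q) chart.target
  gluing : Set (Fin d)
  edge : Fin d → Set (Set (Fin k))
  edge_bijOn : BijOn edge gluing center.edges
  edges_subset : ∀ x ∈ chart.source, x.edges ⊆ center.edges
  gluing_eq_zero_iff : ∀ m ∈ gluing, ∀ x ∈ chart.source,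
    crossRatioMap k x (quad m) = ((0 : ℂ) : OnePoint ℂ) ↔ edge m ∈ x.edges
  generic : ∀ m, m ∉ gluing → ∀ x ∈ chart.source,
    crossRatioMap k x (quad m) ∉
      ({((0 : ℂ) : OnePoint ℂ), ((1 : ℂ) : OnePoint ℂ), OnePoint.infty} : Set (OnePoint ℂ))

/-- The cross ratio chart given by a local chart with `k - 3` coordinates. -/
def LocalChart.toCrossRatioChart {k : ℕ} (c : LocalChart k (k - 3)) : CrossRatioChart k :=
  { c with }

theorem continuousOn_affineChart : ContinuousOn affineChart {OnePoint.infty}ᶜ := by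
  refine affineChart.continuousOn.mono fun w hw => ?_
  have h1 : ((affineChart w : ℂ) : OnePoint ℂ) ∈ affineChart.source :=
    affineChart.map_target (x := affineChart w) (by
      simp [affineChart, IsOpenEmbedding.toOpenPartialHomeomorph])
  rwa [coe_affineChart hw] at h1

section

variable {k : ℕ}

/-- At most one of the four labels is `j`. Three others serve as base, and on their own view they
are always distinct. -/
theorem exists_old_triple (j : Fin (k + 1)) (q : Fin 4 ↪ Fin (k + 1)) :
    ∃ u v w : Fin k, Distinct3 u v w ∧ ∀ x : DM (k + 1),
      NoThree (view x (j.succAbove u) (j.succAbove v) (j.succAbove w) (q 0))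
        (view x (j.succAbove u) (j.succAbove v) (j.succAbove w) (q 1))
        (view x (j.succAbove u) (j.succAbove v) (j.succAbove w) (q 2))
        (view x (j.succAbove u) (j.succAbove v) (j.succAbove w) (q 3)) := by
  have hinj := Fin.succAbove_right_injective (p := j)
  have hq := q.injective
  have key : ∀ i₁ i₂ i₃ : Fin 4, i₁ ≠ i₂ → i₂ ≠ i₃ → i₁ ≠ i₃ → q i₁ ≠ j → q i₂ ≠ j → q i₃ ≠ j →
      ∃ u v w : Fin k, Distinct3 u v w ∧ ∀ x : DM (k + 1), Distinct3
        (view x (j.succAbove u) (j.succAbove v) (j.succAbove w) (q i₁))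
        (view x (j.succAbove u) (j.succAbove v) (j.succAbove w) (q i₂))
        (view x (j.succAbove u) (j.succAbove v) (j.succAbove w) (q i₃)) := by
    intro i₁ i₂ i₃ h12 h23 h13 h1 h2 h3
    obtain ⟨u, hu⟩ := Fin.exists_succAbove_eq h1
    obtain ⟨v, hv⟩ := Fin.exists_succAbove_eq h2
    obtain ⟨w, hw⟩ := Fin.exists_succAbove_eq h3
    rw [← hu, ← hv, ← hw]
    have hd : Distinct3 u v w :=
      ⟨fun e => h12 (hq (by rw [← hu, ← hv, e])), fun e => h23 (hq (by rw [← hv, ← hw, e])),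
        fun e => h13 (hq (by rw [← hu, ← hw, e]))⟩
    exact ⟨u, v, w, hd, fun x => view_distinct x (hd.map hinj)⟩
  have hne : ∀ {i i' : Fin 4}, q i = j → i' ≠ i → q i' ≠ j := fun h h' e =>
    h' (hq (e.trans h.symm))
  by_cases h0 : q 0 = j
  · obtain ⟨u, v, w, hd, h⟩ := key 1 2 3 (by decide) (by decide) (by decide)
      (hne h0 (by decide)) (hne h0 (by decide)) (hne h0 (by decide))
    refine ⟨u, v, w, hd, fun x => ?_⟩
    have h := h x
    unfold Distinct3 at h
    unfold NoThree
    grind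
  by_cases h1 : q 1 = j
  · obtain ⟨u, v, w, hd, h⟩ := key 0 2 3 (by decide) (by decide) (by decide)
      (hne h1 (by decide)) (hne h1 (by decide)) (hne h1 (by decide))
    refine ⟨u, v, w, hd, fun x => ?_⟩
    have h := h x
    unfold Distinct3 at h
    unfold NoThree
    grind
  by_cases h2 : q 2 = j
  · obtain ⟨u, v, w, hd, h⟩ := key 0 1 3 (by decide) (by decide) (by decide)
      (hne h2 (by decide)) (hne h2 (by decide)) (hne h2 (by decide))
    refine ⟨u, v, w, hd, fun x => ?_⟩
    have h := h x
    unfold Distinct3 at h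
    unfold NoThree
    grind
  · obtain ⟨u, v, w, hd, h⟩ := key 0 1 2 (by decide) (by decide) (by decide) h0 h1 h2
    refine ⟨u, v, w, hd, fun x => ?_⟩
    have h := h x
    unfold Distinct3 at h
    unfold NoThree
    grind

/-- The vector that gives the position of the new label in the view of `u`, `v`, `w` if it is at `X` in
the view of `a`, `b`, `c`; it is computed from the positions of the three labels `t`. -/
def newVec (y : DM k) (a b c : Fin k) (X : OnePoint ℂ) (u v w : Fin k)
    (t : Fin k × Fin k × Fin k) : ℂ × ℂ :=
  solve X (view y a b c t.1) (view y a b c t.2.1) (view y a b c t.2.2) (view y u v w t.1)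
    (view y u v w t.2.1) (view y u v w t.2.2)

theorem view_new (hk : 3 ≤ k) {j : Fin (k + 1)} {x : DM (k + 1)} {a b c u v w : Fin k}
    (habc : Distinct3 a b c) (huvw : Distinct3 u v w) {t : Fin k × Fin k × Fin k}
    (h : newVec (forget hk j.succAboveEmb x) a b c
      (view x (j.succAbove a) (j.succAbove b) (j.succAbove c) j) u v w t ≠ 0) :
    view x (j.succAbove u) (j.succAbove v) (j.succAbove w) j =
      point (newVec (forget hk j.succAboveEmb x) a b c
        (view x (j.succAbove a) (j.succAbove b) (j.succAbove c) j) u v w t) := by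
  have hinj := Fin.succAbove_right_injective (p := j)
  simp only [newVec, view_forget_succAbove hk habc, view_forget_succAbove hk huvw] at h ⊢
  exact (view_related x (habc.map hinj) (huvw.map hinj)).eq_point_solve _ _ _ j h

/-- Injectivity of the extended coordinates: `X` and the old curve determine `j` in every view based
on old labels, and such views suffice for all cross ratios. -/
theorem eq_of_forget_eq (hk : 3 ≤ k) {j : Fin (k + 1)} {x x' : DM (k + 1)} {a b c : Fin k}
    (habc : Distinct3 a b c) (hy : forget hk j.succAboveEmb x = forget hk j.succAboveEmb x')
    (hX : view x (j.succAbove a) (j.succAbove b) (j.succAbove c) j =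
      view x' (j.succAbove a) (j.succAbove b) (j.succAbove c) j)
    (t : Fin k → Fin k → Fin k → Fin k × Fin k × Fin k)
    (h : ∀ u v w, Distinct3 u v w → newVec (forget hk j.succAboveEmb x) a b c
      (view x (j.succAbove a) (j.succAbove b) (j.succAbove c) j) u v w (t u v w) ≠ 0) : x = x' := by
  refine crossRatioMap_injective (funext fun q => ?_)
  obtain ⟨u, v, w, hd, hn⟩ := exists_old_triple j q
  have hinj := Fin.succAbove_right_injective (p := j)
  have key : ∀ l, view x (j.succAbove u) (j.succAbove v) (j.succAbove w) l =
      view x' (j.succAbove u) (j.succAbove v) (j.succAbove w) l := by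
    intro l
    rcases eq_or_eq_succAbove j l with rfl | ⟨l, rfl⟩
    · have h1 := h u v w hd
      rw [view_new hk habc hd h1]
      rw [hy, hX] at h1 ⊢
      rw [view_new hk habc hd h1]
    · rw [← view_forget_succAbove hk hd, ← view_forget_succAbove hk hd, hy]
  rw [crossRatioMap_eq_view, crossRatioMap_eq_view,
    view_eq x (distinct3_quad q) (hd.map hinj) (hn x),
    view_eq x' (distinct3_quad q) (hd.map hinj) (hn x'), key, key, key, key]

theorem LocalChart.smoothAt_view {d : ℕ} (c : LocalChart k d) {v : Fin d → ℂ}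
    (hv : v ∈ c.chart.target) (u₁ u₂ u₃ l : Fin k) :
    SmoothAt (fun v => view (c.chart.symm v) u₁ u₂ u₃ l) v := by
  unfold view
  split_ifs
  · exact (isSmoothToSphereOn_iff c.chart.open_target).mp (c.smooth _) v hv
  all_goals exact smoothAt_const _ _

theorem contDiff_tail {d : ℕ} {n : WithTop ℕ∞} :
    ContDiff ℝ n fun v : Fin (d + 1) → ℂ => (Fin.tail v : Fin d → ℂ) :=
  contDiff_pi.mpr fun i => contDiff_apply ℝ ℂ i.succ

/-- The inductive step. The new coordinate `X` is a gluing parameter exactly if `B` holds, that is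
if `j` bubbles off together with `a` at the centre; the other coordinates are pulled back by the
forgetful map. -/
theorem exists_localChart_succ {d : ℕ} (hk : 3 ≤ k) (j : Fin (k + 1)) (x₀ : DM (k + 1))
    {a b c : Fin k} (habc : Distinct3 a b c) (B : Prop)
    (hfree : Free B (forget hk j.succAboveEmb x₀) a b c
      (view x₀ (j.succAbove a) (j.succAbove b) (j.succAbove c) j))
    (hB : B → view x₀ (j.succAbove a) (j.succAbove b) (j.succAbove c) j =
      ((0 : ℂ) : OnePoint ℂ))
    (φ : LocalChart k d) (hφ : φ.center = forget hk j.succAboveEmb x₀) :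
    ∃ φ' : LocalChart (k + 1) (d + 1), φ'.center = x₀ := by
  have hinj := Fin.succAbove_right_injective (p := j)
  -- For each view these are three labels whose solution vector is nonzero at the centre; they stay
  -- fixed on the whole chart. The value at repeated labels is a dummy.
  have ht : ∀ u v w, ∃ t : Fin k × Fin k × Fin k, Distinct3 u v w →
      newVec (forget hk j.succAboveEmb x₀) a b c
        (view x₀ (j.succAbove a) (j.succAbove b) (j.succAbove c) j) u v w t ≠ 0 := by
    intro u v w
    by_cases hd : Distinct3 u v w
    · obtain ⟨t₁, t₂, t₃, h⟩ := (view_related (forget hk j.succAboveEmb x₀) habc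
        hd).exists_solve_ne_zero ⟨a, b, c, view_distinct _ habc⟩ ⟨u, v, w, view_distinct _ hd⟩
        (fun u v => hfree.unique)
      exact ⟨(t₁, t₂, t₃), fun _ => h⟩
    · exact ⟨(a, b, c), fun h => absurd h hd⟩
  choose t ht using ht
  let X : DM (k + 1) → OnePoint ℂ := fun x =>
    view x (j.succAbove a) (j.succAbove b) (j.succAbove c) j
  let π : DM (k + 1) → DM k := forget hk j.succAboveEmb
  let V : Set (Fin (d + 1) → ℂ) := {v | Fin.tail v ∈ φ.chart.target ∧
    Free B (φ.chart.symm (Fin.tail v)) a b c (v 0 : ℂ) ∧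
    ∀ u₁ u₂ u₃, Distinct3 u₁ u₂ u₃ →
      newVec (φ.chart.symm (Fin.tail v)) a b c (v 0 : ℂ) u₁ u₂ u₃ (t u₁ u₂ u₃) ≠ 0}
  have hsm : ∀ v : Fin (d + 1) → ℂ, Fin.tail v ∈ φ.chart.target → ∀ u₁ u₂ u₃ l,
      SmoothAt (fun v : Fin (d + 1) → ℂ => view (φ.chart.symm (Fin.tail v)) u₁ u₂ u₃ l) v :=
    fun v hv u₁ u₂ u₃ l => (φ.smoothAt_view hv u₁ u₂ u₃ l).comp v contDiff_tail.contDiffAt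
  have hsm0 : ∀ v : Fin (d + 1) → ℂ,
      SmoothAt (fun v : Fin (d + 1) → ℂ => ((v 0 : ℂ) : OnePoint ℂ)) v :=
    fun v => smoothAt_coe (contDiff_apply ℝ ℂ 0).contDiffAt
  have hsolve : ∀ v ∈ V, ∀ u₁ u₂ u₃, Distinct3 u₁ u₂ u₃ →
      SmoothAt (fun v : Fin (d + 1) → ℂ => point (newVec (φ.chart.symm (Fin.tail v)) a b c
        (v 0 : ℂ) u₁ u₂ u₃ (t u₁ u₂ u₃))) v ∧ ∀ᶠ v' in 𝓝 v,
        newVec (φ.chart.symm (Fin.tail v')) a b c (v' 0 : ℂ) u₁ u₂ u₃ (t u₁ u₂ u₃) ≠ 0 :=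
    fun v hv u₁ u₂ u₃ hd => (hsm0 v).solve (hsm v hv.1 _ _ _ _) (hsm v hv.1 _ _ _ _)
      (hsm v hv.1 _ _ _ _) (hsm v hv.1 _ _ _ _) (hsm v hv.1 _ _ _ _) (hsm v hv.1 _ _ _ _)
      (hv.2.2 u₁ u₂ u₃ hd)
  have hVopen : IsOpen V := by
    rw [isOpen_iff_mem_nhds]
    intro v hv
    have h1 : ∀ᶠ v' in 𝓝 v, (Fin.tail v' : Fin d → ℂ) ∈ φ.chart.target :=
      (contDiff_tail (n := 0)).continuous.continuousAt.eventually
        (φ.chart.open_target.mem_nhds hv.1)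
    have h2 : ∀ᶠ v' in 𝓝 v, Free B (φ.chart.symm (Fin.tail v')) a b c (v' 0 : ℂ) := by
      refine Filter.eventually_all.mpr fun l => ?_
      by_cases hl : B → l ≠ a
      · filter_upwards [((hsm0 v).continuousAt.prodMk
          (hsm v hv.1 a b c l).continuousAt).eventually
          (isClosed_diagonal.isOpen_compl.mem_nhds (hv.2.1 l hl))] with v' hv' _ using hv'
      · exact Filter.Eventually.of_forall fun _ h => absurd h hl
    have h3 : ∀ᶠ v' in 𝓝 v, ∀ u₁ u₂ u₃, Distinct3 u₁ u₂ u₃ →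
        newVec (φ.chart.symm (Fin.tail v')) a b c (v' 0 : ℂ) u₁ u₂ u₃ (t u₁ u₂ u₃) ≠ 0 := by
      refine Filter.eventually_all.mpr fun u₁ => Filter.eventually_all.mpr fun u₂ =>
        Filter.eventually_all.mpr fun u₃ => ?_
      by_cases hd : Distinct3 u₁ u₂ u₃
      · filter_upwards [(hsolve v hv u₁ u₂ u₃ hd).2] with v' hv' _ using hv'
      · exact Filter.Eventually.of_forall fun _ h => absurd h hd
    filter_upwards [h1, h2, h3] with v' e1 e2 e3 using ⟨e1, e2, e3⟩
  -- `Free` says that `v 0` is unoccupied or is only the position `0` of `a`, which are the two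
  -- cases of `exists_add_label`. Outside `V` the value `x₀` is a dummy.
  have hE : ∀ v, ∃ x : DM (k + 1), v ∈ V → π x = φ.chart.symm (Fin.tail v) ∧
      X x = ((v 0 : ℂ) : OnePoint ℂ) := by
    intro v
    by_cases hv : v ∈ V
    · obtain ⟨x, hx⟩ := exists_add_label hk j (φ.chart.symm (Fin.tail v)) habc (v 0 : ℂ) (by
        by_contra! h
        obtain ⟨⟨l, hl⟩, h0⟩ := h
        have hla : l = a := by
          by_contra hla
          exact hv.2.1 l (fun _ => hla) hl
        rw [hla, view_left _ habc] at hl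
        exact h0 hl)
      exact ⟨x, fun _ => hx⟩
    · exact ⟨x₀, fun h => absurd h hv⟩
  choose E hE using hE
  let f : DM (k + 1) → (Fin (d + 1) → ℂ) := fun x =>
    Fin.cons (affineChart (X x)) (φ.chart (π x))
  let S : Set (DM (k + 1)) := {x | π x ∈ φ.chart.source ∧ X x ≠ OnePoint.infty}
  have hS : IsOpen S := (φ.chart.open_source.preimage (continuous_forget hk _)).inter
    (isOpen_compl_singleton.preimage (continuous_view j))
  have hf : ContinuousOn f S := by
    refine continuousOn_pi.mpr fun i => ?_
    refine Fin.cases ?_ (fun i => ?_) i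
    · exact continuousOn_affineChart.comp (continuous_view j).continuousOn fun x hx => hx.2
    · exact (continuous_apply i).comp_continuousOn (φ.chart.continuousOn.comp
        (continuous_forget hk _).continuousOn fun x hx => hx.1)
  have hf0 : ∀ x ∈ S, ((f x 0 : ℂ) : OnePoint ℂ) = X x := fun x hx => coe_affineChart hx.2
  have hft : ∀ x ∈ S, φ.chart.symm (Fin.tail (f x)) = π x := fun x hx => φ.chart.left_inv hx.1
  have hES : ∀ v ∈ V, E v ∈ S := fun v hv => ⟨by
    rw [(hE v hv).1]; exact φ.chart.map_target hv.1, by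
    rw [(hE v hv).2]; exact OnePoint.coe_ne_infty _⟩
  have hfE : ∀ v ∈ V, f (E v) = v := by
    intro v hv
    have h1 := hE v hv
    refine funext fun i => ?_
    refine Fin.cases ?_ (fun i => ?_) i
    · simp only [f, Fin.cons_zero, h1.2, affineChart_coe]
    · simp only [f, Fin.cons_succ, h1.1, φ.chart.right_inv hv.1]
      rfl
  have hEf : ∀ x ∈ S, f x ∈ V → E (f x) = x := by
    intro x hx hv
    have h1 := hE (f x) hv
    have h2 := hv.2.2
    rw [hft x hx, hf0 x hx] at h1
    rw [hft x hx, hf0 x hx] at h2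
    exact (eq_of_forget_eq hk habc h1.1.symm h1.2.symm t h2).symm
  have hview : ∀ v ∈ V, ∀ u₁ u₂ u₃, Distinct3 u₁ u₂ u₃ → ∀ l, SmoothAt (fun v =>
      view (E v) (j.succAbove u₁) (j.succAbove u₂) (j.succAbove u₃) l) v := by
    intro v hv u₁ u₂ u₃ hd l
    rcases eq_or_eq_succAbove j l with rfl | ⟨l, rfl⟩
    · refine (hsolve v hv u₁ u₂ u₃ hd).1.congr ?_
      filter_upwards [hVopen.mem_nhds hv] with v' hv'
      have h1 := hE v' hv'
      have h2 := hv'.2.2 u₁ u₂ u₃ hd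
      rw [← h1.1, ← h1.2] at h2 ⊢
      exact view_new hk habc hd h2
    · refine (hsm v hv.1 u₁ u₂ u₃ l).congr ?_
      filter_upwards [hVopen.mem_nhds hv] with v' hv'
      rw [← (hE v' hv').1]
      exact (view_forget_succAbove hk hd l).symm
  have hsmooth : ∀ q, ∀ v ∈ V, SmoothAt (fun v => crossRatioMap (k + 1) (E v) q) v := by
    intro q v hv
    obtain ⟨u₁, u₂, u₃, hd, hn⟩ := exists_old_triple j q
    refine ((hview v hv u₁ u₂ u₃ hd (q 0)).cr (hview v hv u₁ u₂ u₃ hd (q 1))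
      (hview v hv u₁ u₂ u₃ hd (q 2)) (hview v hv u₁ u₂ u₃ hd (q 3)) (hn _)).congr
      (Filter.Eventually.of_forall fun v' => ?_)
    dsimp only
    rw [crossRatioMap_eq_view]
    exact view_eq _ (distinct3_quad q) (hd.map hinj) (hn _)
  have hEcont : ContinuousOn E V := by
    rw [crossRatioMap_isEmbedding.continuousOn_iff]
    exact continuousOn_pi.mpr fun q v hv => (hsmooth q v hv).continuousAt.continuousWithinAt
  let ch : OpenPartialHomeomorph (DM (k + 1)) (Fin (d + 1) → ℂ) :=
    { toFun := f
      invFun := E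
      source := S ∩ f ⁻¹' V
      target := V
      map_source' := fun x hx => hx.2
      map_target' := fun v hv => ⟨hES v hv, by rw [mem_preimage, hfE v hv]; exact hv⟩
      left_inv' := fun x hx => hEf x hx.1 hx.2
      right_inv' := hfE
      open_source := hf.isOpen_inter_preimage hS hVopen
      open_target := hVopen
      continuousOn_toFun := hf.mono inter_subset_left
      continuousOn_invFun := hEcont }
  have hfr : ∀ x ∈ ch.source, Free B (π x) a b c (X x) := by
    intro x hx
    have h1 := hx.2.2.1
    rwa [hft x hx.1, hf0 x hx.1] at h1
  -- The label `c ≠ a` occupies `∞`.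
  have hX0 : X x₀ ≠ OnePoint.infty := by
    have h1 := hfree c fun _ => habc.2.2.symm
    rwa [view_right _ habc] at h1
  have hx₀S : x₀ ∈ S := ⟨by change forget _ _ _ ∈ _; rw [← hφ]; exact φ.center_mem, hX0⟩
  have hx₀ : x₀ ∈ ch.source := by
    refine ⟨hx₀S, ⟨φ.chart.map_source hx₀S.1, ?_, ?_⟩⟩
    · rw [hft _ hx₀S, hf0 _ hx₀S]; exact hfree
    · rw [hft _ hx₀S, hf0 _ hx₀S]; exact ht
  have hq₀ : Function.Injective ![j.succAbove a, j.succAbove b, j.succAbove c, j] :=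
    injective_four (habc.map hinj) (Fin.succAbove_ne _ _).symm (Fin.succAbove_ne _ _).symm
      (Fin.succAbove_ne _ _).symm
  have hXq : ∀ x, crossRatioMap (k + 1) x ⟨_, hq₀⟩ = X x := fun x => crossRatioMap_eq_view x _
  have hqs : ∀ x q, crossRatioMap (k + 1) x (q.trans j.succAboveEmb) = crossRatioMap k (π x) q :=
    fun x q => (crossRatioMap_forget hk _ x q).symm
  -- The only possible new edge cuts off `a` and `j`; all others are lifts, in which `j` joins the
  -- side with the majority of `a`, `b`, `c`.
  let e₀ : Set (Set (Fin (k + 1))) := {{j.succAbove a, j}, {j.succAbove a, j}ᶜ}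
  let Lf : Set (Set (Fin k)) → Set (Set (Fin (k + 1))) := fun e => lift j a b c '' e
  have hLf : ∀ A : Set (Fin k), Lf {A, Aᶜ} = {lift j a b c A, (lift j a b c A)ᶜ} := by
    intro A
    simp only [Lf, image_pair, lift_compl]
  have hedge : ∀ {m : ℕ} {x : DM m} {A : Set (Fin m)},
      ({A, Aᶜ} : Set (Set (Fin m))) ∈ x.edges ↔ IsSplit x A := by
    intro m x A
    rw [DM.mem_edges_iff]
    constructor
    · rintro ⟨A', h1, h2⟩
      exact (h2.of_mem h1 (Or.inl rfl)).1
    · exact fun h => ⟨A, rfl, h⟩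
  have hLfedge : ∀ x ∈ ch.source, ∀ e ∈ φ.center.edges, Lf e ∈ x.edges ↔ e ∈ (π x).edges := by
    intro x hx e he
    obtain ⟨A, rfl, -⟩ := DM.mem_edges_iff.mp he
    rw [hLf, hedge, hedge]
    exact isSplit_lift_iff hk habc (hfr x hx)
  have he₀edge : ∀ x ∈ ch.source, e₀ ∈ x.edges ↔ X x = ((0 : ℂ) : OnePoint ℂ) := by
    intro x hx
    rw [hedge]
    exact isSplit_pair_iff hk habc (hfr x hx)
  have hcases : ∀ x ∈ ch.source, ∀ e ∈ x.edges, (∃ e' ∈ (π x).edges, e = Lf e') ∨ (B ∧ e = e₀) := by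
    intro x hx e he
    obtain ⟨A, rfl, hA⟩ := DM.mem_edges_iff.mp he
    rcases hA.eq_lift_or hk habc (hfr x hx) with ⟨h1, h2⟩ | ⟨h1, h2 | h2⟩
    · refine Or.inl ⟨_, hedge.mpr h1, ?_⟩
      rw [hLf, ← h2]
    · refine Or.inr ⟨h1, ?_⟩
      rw [h2]
    · refine Or.inr ⟨h1, ?_⟩
      rw [← compl_compl A, h2, compl_compl, pair_comm]
  have hLfinj : Function.Injective Lf := Set.image_injective.mpr lift_injective
  have hLfne : ∀ e, Lf e ≠ e₀ := by
    intro e h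
    have h1 : ({j.succAbove a, j} : Set (Fin (k + 1))) ∈ Lf e := by
      rw [h]; exact Or.inl rfl
    obtain ⟨A, -, hA⟩ := h1
    have h2 : Majority a b c A := by
      rw [← mem_lift_self (j := j), hA]
      simp
    have h3 : ∀ l, l ∈ A → l = a := by
      intro l hl
      rw [← mem_lift_succAbove (j := j) (a := a) (b := b) (c := c), hA] at hl
      simpa using hl
    obtain ⟨s, hs, t, ht, hst⟩ := h2.exists_pair (f := id) habc
    exact hst ((h3 s hs).trans (h3 t ht).symm)
  refine ⟨{
    center := x₀
    chart := ch
    center_mem := hx₀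
    quad := Fin.cons ⟨_, hq₀⟩ fun m => (φ.quad m).trans j.succAboveEmb
    chart_eq := fun x hx m => ?_
    smooth := fun q => (isSmoothToSphereOn_iff hVopen).mpr (hsmooth q)
    gluing := {m | (Fin.cons B fun m => m ∈ φ.gluing : Fin (d + 1) → Prop) m}
    edge := Fin.cons e₀ fun m => Lf (φ.edge m)
    edge_bijOn := ?_
    edges_subset := fun x hx e he => ?_
    gluing_eq_zero_iff := fun m => ?_
    generic := fun m => ?_ }, rfl⟩
  · refine Fin.cases ?_ (fun m => ?_) m
    · rw [Fin.cons_zero, hXq]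
      exact (hf0 x hx.1).symm
    · rw [Fin.cons_succ, hqs]
      exact φ.chart_eq _ hx.1.1 m
  · have hcenter : ∀ e, e ∈ φ.center.edges → (Lf e ∈ x₀.edges) := by
      intro e he
      rw [hLfedge x₀ hx₀ e he, show π x₀ = φ.center from hφ.symm]
      exact he
    refine ⟨fun m => ?_, fun m hm m' hm' => ?_, fun e he => ?_⟩
    · refine Fin.cases (fun hm => ?_) (fun m hm => ?_) m
      · simp only [mem_ofPred_eq, Fin.cons_zero] at hm ⊢
        exact (he₀edge x₀ hx₀).mpr (hB hm)
      · simp only [mem_ofPred_eq, Fin.cons_succ] at hm ⊢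
        exact hcenter _ (φ.edge_bijOn.mapsTo hm)
    · revert hm hm'
      refine Fin.cases ?_ (fun m => ?_) m <;> refine Fin.cases ?_ (fun m' => ?_) m' <;>
        simp only [mem_ofPred_eq, Fin.cons_zero, Fin.cons_succ] <;> intro hm hm' h
      · trivial
      · exact absurd h.symm (hLfne _)
      · exact absurd h (hLfne _)
      · exact congrArg _ (φ.edge_bijOn.injOn hm hm' (hLfinj h))
    · rcases hcases x₀ hx₀ e he with ⟨e', he', rfl⟩ | ⟨h1, rfl⟩
      · rw [show π x₀ = φ.center from hφ.symm] at he'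
        obtain ⟨m, hm, rfl⟩ := φ.edge_bijOn.surjOn he'
        exact ⟨m.succ, by simpa using hm, by simp⟩
      · exact ⟨0, by simpa using h1, by simp⟩
  · rcases hcases x hx e he with ⟨e', he', rfl⟩ | ⟨h1, rfl⟩
    · have h2 := φ.edges_subset _ hx.1.1 he'
      rw [hLfedge x₀ hx₀ e' h2, show π x₀ = φ.center from hφ.symm]
      exact h2
    · exact (he₀edge x₀ hx₀).mpr (hB h1)
  · refine Fin.cases (fun hm x hx => ?_) (fun m hm x hx => ?_) m
    · rw [Fin.cons_zero, Fin.cons_zero, hXq]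
      exact (he₀edge x hx).symm
    · simp only [mem_ofPred_eq, Fin.cons_succ] at hm
      rw [Fin.cons_succ, Fin.cons_succ, hqs, φ.gluing_eq_zero_iff m hm _ hx.1.1,
        hLfedge x hx _ (φ.edge_bijOn.mapsTo hm)]
  · refine Fin.cases (fun hm x hx => ?_) (fun m hm x hx => ?_) m
    · simp only [mem_ofPred_eq, Fin.cons_zero] at hm
      rw [Fin.cons_zero, hXq]
      have h1 := fun l => hfr x hx l fun h => absurd h hm
      have ha := h1 a
      have hb := h1 b
      rw [view_left _ habc] at ha
      rw [view_mid _ habc] at hb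
      simp only [mem_insert_iff, mem_singleton_iff, not_or]
      exact ⟨ha, hb, hx.1.2⟩
    · simp only [mem_ofPred_eq, Fin.cons_succ] at hm
      rw [Fin.cons_succ, hqs]
      exact φ.generic m hm _ hx.1.1

end

end

/-! ### Existence of a cross-ratio chart at every point -/

section

variable {k : ℕ}

/-- On every stable curve with at least four marked points there is a marked point that is alone,
or alone with one other marked point, on some component where there are at least two more special
points. -/
theorem StableCurve.exists_isolated (hk : 4 ≤ k) (C : StableCurve k) :
    ∃ (α : Fin C.n) (j a b c : Fin k), Distinct3 (C.proj α a) (C.proj α b) (C.proj α c) ∧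
      j ≠ a ∧ j ≠ b ∧ j ≠ c ∧ ((∀ l, l ≠ j → C.proj α l ≠ C.proj α j) ∨
        (C.proj α j = C.proj α a ∧ ∀ l, l ≠ j → l ≠ a → C.proj α l ≠ C.proj α j)) := by
  by_cases hE : ∃ α β, C.tree.Adj α β
  · obtain ⟨γ₀, δ₀, h₀⟩ := hE
    -- A side that is minimal under inclusion belongs to an end `δ` of the tree: two labels that
    -- coincide on `δ` would lie beyond a further node, and minimality would put the whole side
    -- there.
    obtain ⟨A, ⟨γ, δ, h, rfl⟩, hmin⟩ := (Set.toFinite {A | ∃ γ δ, C.tree.Adj γ δ ∧ C.side γ δ = A}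
      ).exists_minimal ⟨_, γ₀, δ₀, h₀, rfl⟩
    have hmem : ∀ l, l ∈ C.side γ δ ↔ C.proj δ l ≠ C.node δ γ := fun l => by
      rw [Ne, C.proj_eq_node_iff h.symm, ← C.side_compl h, mem_compl_iff, not_not]
    obtain ⟨i, i', hi, hi', hii'⟩ := C.isFamily.exists_pair_ne δ (C.node δ γ)
    have hinj : ∀ l ∈ C.side γ δ, ∀ l', l' ≠ l → C.proj δ l' ≠ C.proj δ l := by
      intro l hl l' hne heq
      obtain ⟨ε, hε, h1, h2, h3⟩ := C.exists_side_of_proj_eq hne heq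
      have h4 : C.side δ ε ⊆ C.side γ δ := fun m hm => by
        rw [hmem, C.proj_of_mem_side hε hm, h1, heq]
        exact (hmem l).mp hl
      have h5 : C.side γ δ ⊆ C.side δ ε := hmin ⟨δ, ε, hε, rfl⟩ h4
      refine hii' ?_
      rw [C.proj_of_mem_side hε (h5 ((hmem i).mpr hi)), C.proj_of_mem_side hε (h5 ((hmem i').mpr hi'))]
    -- With a third label on the end component, `i` is alone at its position and `δ` keeps three
    -- special points without it.
    by_cases h3 : ∃ e ∈ C.side γ δ, e ≠ i ∧ e ≠ i'
    · obtain ⟨e, he, hei, hei'⟩ := h3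
      obtain ⟨r, hr⟩ := C.exists_mem_side h.symm
      have hr' := C.proj_of_mem_side h.symm hr
      refine ⟨δ, i, i', e, r, ⟨?_, ?_, ?_⟩, ?_, hei.symm, ?_,
        Or.inl (hinj i ((hmem i).mpr hi))⟩
      · exact hinj e he _ hei'.symm
      · rw [hr']; exact (hmem e).mp he
      · rw [hr']; exact hi'
      · rintro rfl; exact hii' rfl
      · rintro rfl; exact hi hr'
    -- Here forgetting `i` contracts `δ`, so the view is taken from the neighbour `γ`, where exactly
    -- `i` and `i'` share the node.
    · push Not at h3
      obtain ⟨b, c, hb, hc, hbc⟩ := C.isFamily.exists_pair_ne γ (C.node γ δ)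
      have e1 := C.proj_of_mem_side h ((hmem i).mpr hi)
      have e2 := C.proj_of_mem_side h ((hmem i').mpr hi')
      refine ⟨γ, i, i', b, c, ⟨?_, hbc, ?_⟩, ?_, ?_, ?_, Or.inr ⟨e1.trans e2.symm, ?_⟩⟩
      · rw [e2]; exact hb.symm
      · rw [e2]; exact hc.symm
      · rintro rfl; exact hii' rfl
      · rintro rfl; exact hb e1
      · rintro rfl; exact hc e1
      · intro l hl hl' heq
        rw [e1, C.proj_eq_node_iff h] at heq
        exact hl' (h3 l heq hl)
  · have hinj : ∀ α, Function.Injective (C.proj α) := by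
      intro α l l' heq
      by_contra hne
      obtain ⟨ε, hε, -⟩ := C.exists_side_of_proj_eq hne heq
      exact hE ⟨_, _, hε⟩
    obtain ⟨a, b, c, habc⟩ := C.proj_three (C.comp ⟨0, by omega⟩)
    have : ∃ j, j ∉ ({a, b, c} : Finset (Fin k)) := by
      by_contra! hall
      have h1 : (Finset.univ : Finset (Fin k)).card ≤ ({a, b, c} : Finset (Fin k)).card :=
        Finset.card_le_card fun j _ => hall j
      have h2 := Finset.card_le_three (a := a) (b := b) (c := c)
      rw [Finset.card_univ, Fintype.card_fin] at h1
      omega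
    obtain ⟨j, hj⟩ := this
    simp only [Finset.mem_insert, Finset.mem_singleton, not_or] at hj
    exact ⟨_, j, a, b, c, habc, hj.1, hj.2.1, hj.2.2, Or.inl fun l hl e => hl (hinj _ e)⟩

theorem exists_free (hk : 3 ≤ k) (x : DM (k + 1)) : ∃ (j : Fin (k + 1)) (a b c : Fin k) (B : Prop),
    Distinct3 a b c ∧ Free B (forget hk j.succAboveEmb x) a b c
      (view x (j.succAbove a) (j.succAbove b) (j.succAbove c) j) ∧
    (B → view x (j.succAbove a) (j.succAbove b) (j.succAbove c) j = ((0 : ℂ) : OnePoint ℂ)) := by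
  obtain ⟨C, rfl⟩ := x.exists_rep
  obtain ⟨α, j, a, b, c, habc, ha, hb, hc, h⟩ := C.exists_isolated (by omega)
  obtain ⟨a, rfl⟩ := (eq_or_eq_succAbove j a).resolve_left ha
  obtain ⟨b, rfl⟩ := (eq_or_eq_succAbove j b).resolve_left hb
  obtain ⟨c, rfl⟩ := (eq_or_eq_succAbove j c).resolve_left hc
  have habc' : Distinct3 a b c := Distinct3.of_map (f := fun l => C.proj α (j.succAbove l)) habc
  obtain ⟨g, hg⟩ := exists_view_eq_smul habc
  rcases h with h | ⟨h0, h⟩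
  · refine ⟨j, a, b, c, False, habc', fun l _ heq => ?_, False.elim⟩
    rw [view_forget hk _ _ _ habc'] at heq
    simp only [Fin.succAboveEmb_apply, hg] at heq
    exact h _ (Fin.succAbove_ne j l) (MulAction.injective g heq).symm
  · refine ⟨j, a, b, c, True, habc', fun l hl heq => ?_, fun _ => ?_⟩
    · rw [view_forget hk _ _ _ habc'] at heq
      simp only [Fin.succAboveEmb_apply, hg] at heq
      exact h _ (Fin.succAbove_ne j l) (fun e => hl trivial (Fin.succAbove_right_injective e))
        (MulAction.injective g heq).symm
    · rw [hg, h0, ← hg, view_left _ habc.of_map]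

theorem not_embedding_three (q : Fin 4 ↪ Fin 3) : False := by
  simpa using Fintype.card_le_of_embedding q

instance subsingleton_DM_three : Subsingleton (DM 3) :=
  ⟨fun _ _ => crossRatioMap_injective (funext fun q => (not_embedding_three q).elim)⟩

theorem edges_eq_empty_of_three (x : DM 3) : x.edges = ∅ := by
  refine eq_empty_of_forall_notMem fun e he => ?_
  obtain ⟨A, -, hA⟩ := DM.mem_edges_iff.mp he
  obtain ⟨a, ha, a', ha', haa⟩ := hA.left
  obtain ⟨b, hb, b', hb', hbb⟩ := hA.right
  have h1 : ∀ {u v : Fin 3}, u ∈ A → v ∉ A → u ≠ v := fun hu hv e => hv (e ▸ hu)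
  have := h1 ha hb
  have := h1 ha' hb
  have := h1 ha hb'
  have := h1 ha' hb'
  -- Two labels on each side would make four.
  omega

theorem exists_localChart_three (x : DM 3) : ∃ φ : LocalChart 3 0, φ.center = x := by
  have e : DM 3 ≃ₜ (Fin 0 → ℂ) :=
    { toFun := fun _ => 0
      invFun := fun _ => x
      left_inv := fun _ => Subsingleton.elim _ _
      right_inv := fun _ => Subsingleton.elim _ _
      continuous_toFun := continuous_const
      continuous_invFun := continuous_const }
  exact ⟨{ center := x
           chart := e.toOpenPartialHomeomorph
           center_mem := trivial
           quad := fun m => m.elim0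
           chart_eq := fun _ _ m => m.elim0
           smooth := fun q => (not_embedding_three q).elim
           gluing := ∅
           edge := fun m => m.elim0
           edge_bijOn := by rw [edges_eq_empty_of_three]; exact bijOn_empty _
           edges_subset := fun y _ => by rw [edges_eq_empty_of_three]; exact empty_subset _
           gluing_eq_zero_iff := fun m => m.elim0
           generic := fun m => m.elim0 }, rfl⟩

theorem exists_localChart (d : ℕ) : ∀ x : DM (d + 3), ∃ φ : LocalChart (d + 3) d, φ.center = x := by
  induction d with
  | zero => exact exists_localChart_three
  | succ d ih =>
    intro x
    obtain ⟨j, a, b, c, B, habc, hfree, hB⟩ := exists_free (k := d + 3) (by omega) x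
    obtain ⟨φ, hφ⟩ := ih (forget (by omega) j.succAboveEmb x)
    exact exists_localChart_succ _ j x habc B hfree hB φ hφ

theorem exists_crossRatioChart (hk : 3 ≤ k) (x : DM k) : ∃ c : CrossRatioChart k, c.center = x := by
  obtain ⟨d, rfl⟩ : ∃ d, k = d + 3 := ⟨k - 3, by omega⟩
  obtain ⟨φ, hφ⟩ := exists_localChart d x
  exact ⟨φ.toCrossRatioChart, hφ⟩

end

section

variable {k : ℕ}

/-! ### Cross ratios as monomials in the gluing parameters -/

/-- Two edges are compatible. -/
theorem IsSplit.subset_or {x : DM k} {A B : Set (Fin k)} (hA : IsSplit x A) (hB : IsSplit x B)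
    {a d : Fin k} (haA : a ∈ A) (haB : a ∈ B) (hdA : d ∉ A) (hdB : d ∉ B) : A ⊆ B ∨ B ⊆ A := by
  by_contra! h
  obtain ⟨⟨b, hbA, hbB⟩, ⟨c, hcB, hcA⟩⟩ := h.imp not_subset.mp not_subset.mp
  have e : ∀ {S : Set (Fin k)} {u v : Fin k}, u ∈ S → v ∉ S → u ≠ v := fun hu hv h => hv (h ▸ hu)
  -- In the view of `a`, `c`, `d`, the split `A` puts `b` at the position `0` of `a`; then `B` puts
  -- `c` there too, although `c` is at `1`.
  have h1 := hA.view_eq_zero a haA b hbA c hcA d hdA (e haB hbB) (e hcB hdB)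
  have h2 := hB.view_eq_zero a haB c hcB b hbB d hdB (e haA hcA) (e hbA hdA)
  have h3 : Distinct3 a c d := ⟨e haA hcA, e hcB hdB, e haA hdA⟩
  have h4 := view_eq_of_view_eq_zero ⟨e haB hbB, e hbA hdA, e haA hdA⟩ h3 h2 (by
    rw [h1, view_right x h3]; exact OnePoint.coe_ne_infty _)
  rw [view_left x h3, view_mid x h3, OnePoint.coe_eq_coe] at h4
  exact zero_ne_one h4

/-- The cocycle identity for cross ratios with a common pair of labels. -/
theorem view_mul {x : DM k} {a b c d s : Fin k} (h : Distinct3 a b c) (h' : Distinct3 a s c)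
    (h1 : view x a b c s ≠ OnePoint.infty) (h2 : view x a s c d ≠ OnePoint.infty) :
    affineChart (view x a b c d) = affineChart (view x a s c d) * affineChart (view x a b c s) := by
  have key := (view_related x h h').four_term a s c d
  rw [view_left x h, view_right x h, view_left x h', view_mid x h', view_right x h',
    ← coe_affineChart h1, ← coe_affineChart h2] at key
  -- At the value `∞` the relation would equate a unit with zero.
  by_cases h3 : view x a b c d = OnePoint.infty
  · rw [h3] at key
    simp [homogSub, homog] at key
  · rw [← coe_affineChart h3] at key
    simp [homogSub, homog] at key
    linear_combination key

section

variable {E : Type*} [NormedAddCommGroup E] [NormedSpace ℝ E]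

/-- `f` and `g` differ locally by a smooth factor that does not vanish. -/
def UnitMultiple (v : E) (f g : E → ℂ) : Prop :=
  ∃ u : E → ℂ, ContDiffAt ℝ ((⊤ : ℕ∞) : WithTop ℕ∞) u v ∧ u v ≠ 0 ∧ ∀ᶠ y in 𝓝 v, f y = g y * u y

theorem UnitMultiple.symm {v : E} {f g : E → ℂ} (h : UnitMultiple v f g) : UnitMultiple v g f := by
  obtain ⟨u, h1, h2, h3⟩ := h
  refine ⟨fun y => (u y)⁻¹, h1.inv h2, inv_ne_zero h2, ?_⟩
  filter_upwards [h3, h1.continuousAt.eventually_ne h2] with y h4 h5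
  rw [h4, mul_inv_cancel_right₀ h5]

theorem UnitMultiple.trans {v : E} {f g h : E → ℂ} (h₁ : UnitMultiple v f g)
    (h₂ : UnitMultiple v g h) : UnitMultiple v f h := by
  obtain ⟨u, h1, h2, h3⟩ := h₁
  obtain ⟨w, h4, h5, h6⟩ := h₂
  refine ⟨fun y => w y * u y, h4.mul h1, mul_ne_zero h5 h2, ?_⟩
  filter_upwards [h3, h6] with y e1 e2
  rw [e1, e2, mul_assoc]

theorem UnitMultiple.mul {v : E} {f g f' g' : E → ℂ} (h₁ : UnitMultiple v f g)
    (h₂ : UnitMultiple v f' g') : UnitMultiple v (fun y => f y * f' y) (fun y => g y * g' y) := by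
  obtain ⟨u, h1, h2, h3⟩ := h₁
  obtain ⟨w, h4, h5, h6⟩ := h₂
  refine ⟨fun y => u y * w y, h1.mul h4, mul_ne_zero h2 h5, ?_⟩
  filter_upwards [h3, h6] with y e1 e2
  rw [e1, e2]; ring

theorem UnitMultiple.congr {v : E} {f g f' g' : E → ℂ} (h : UnitMultiple v f g)
    (hf : ∀ᶠ y in 𝓝 v, f' y = f y) (hg : ∀ᶠ y in 𝓝 v, g' y = g y) : UnitMultiple v f' g' := by
  obtain ⟨u, h1, h2, h3⟩ := h
  refine ⟨u, h1, h2, ?_⟩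
  filter_upwards [h3, hf, hg] with y e1 e2 e3
  rw [e2, e3, e1]

/-- With brackets of homogeneous coordinates, the cross ratio of `0`, `β`, `γ`, `δ` is `δ` times
`[βγ] / ([0β] [γδ])`, and the hypotheses say that these three brackets do not vanish. -/
theorem SmoothAt.cr_unitMultiple {β γ δ : E → OnePoint ℂ} {v : E} (hβ : SmoothAt β v)
    (hγ : SmoothAt γ v) (hδ : SmoothAt δ v) (h1 : β v ≠ γ v) (h2 : ((0 : ℂ) : OnePoint ℂ) ≠ β v)
    (h3 : γ v ≠ δ v) (h4 : δ v ≠ OnePoint.infty) :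
    UnitMultiple v (fun y => affineChart (DeligneMumford.cr ((0 : ℂ) : OnePoint ℂ) (β y) (γ y) (δ y)))
      (fun y => affineChart (δ y)) := by
  have hδ' := hδ.contDiffAt h4
  have hδc := hδ.continuousAt
  obtain ⟨B, hB, hB0, hBe⟩ := hβ
  obtain ⟨C, hC, hC0, hCe⟩ := hγ
  set z : E → ℂ := fun y => affineChart (δ y) with hz
  have hδz : ∀ᶠ y in 𝓝 v, δ y = (z y : OnePoint ℂ) := by
    filter_upwards [hδc.eventually_ne h4] with y hy using (coe_affineChart hy).symm
  have hD : ContDiffAt ℝ ((⊤ : ℕ∞) : WithTop ℕ∞) (fun y => ((z y, 1) : ℂ × ℂ)) v :=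
    hδ'.prodMk contDiffAt_const
  have hpt : ∀ w : ℂ, point (w, 1) = (w : OnePoint ℂ) := fun w => toSphere_one _
  have hne : ∀ w : ℂ, ((w, 1) : ℂ × ℂ) ≠ 0 := fun w => ne_zero_prod_iff.mpr (Or.inr one_ne_zero)
  have e1 : br (B v) (C v) ≠ 0 := by
    rwa [Ne, ← point_eq_iff hB0 hC0, ← hBe.self_of_nhds, ← hCe.self_of_nhds]
  have e2 : br (0, 1) (B v) ≠ 0 := by
    rwa [Ne, ← point_eq_iff (hne 0) hB0, ← hBe.self_of_nhds, hpt]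
  have e3 : br (C v) (z v, 1) ≠ 0 := by
    rwa [Ne, ← point_eq_iff hC0 (hne _), ← hCe.self_of_nhds, hpt, ← hδz.self_of_nhds]
  have d2 : ContDiffAt ℝ ((⊤ : ℕ∞) : WithTop ℕ∞) (fun y => br (0, 1) (B y)) v :=
    contDiffAt_br contDiffAt_const hB
  have d3 : ContDiffAt ℝ ((⊤ : ℕ∞) : WithTop ℕ∞) (fun y => br (C y) (z y, 1)) v :=
    contDiffAt_br hC hD
  refine ⟨fun y => br (B y) (C y) * (br (0, 1) (B y) * br (C y) (z y, 1))⁻¹,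
    (contDiffAt_br hB hC).mul ((d2.mul d3).inv (mul_ne_zero e2 e3)),
    mul_ne_zero e1 (inv_ne_zero (mul_ne_zero e2 e3)), ?_⟩
  filter_upwards [hBe, hCe, hδz, hB.continuousAt.eventually_ne hB0,
    hC.continuousAt.eventually_ne hC0, d2.continuousAt.eventually_ne e2,
    d3.continuousAt.eventually_ne e3] with y f1 f2 f3 f4 f5 f6 f7
  obtain ⟨s, hs, hs'⟩ := homog_point f4
  obtain ⟨t, ht, ht'⟩ := homog_point f5
  have hh : ∀ w : ℂ, homog (w : OnePoint ℂ) = (w, 1) := fun w => rfl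
  have g1 : homogSub (point (B y)) (point (C y)) = s * t * br (B y) (C y) := by
    rw [← br_homog, hs', ht', br_smul]
  have g2 : homogSub ((0 : ℂ) : OnePoint ℂ) (point (B y)) = s * br (0, 1) (B y) := by
    rw [← br_homog, hs', hh]; simp [br]
  have g3 : homogSub (point (C y)) (z y : OnePoint ℂ) = t * br (C y) (z y, 1) := by
    rw [← br_homog, ht', hh]; simp [br]; ring
  rw [DeligneMumford.cr, f1, f2, f3, g1, g2, g3, homogSub_coe, toSphere_of_ne
    (mul_ne_zero (mul_ne_zero hs f6) (mul_ne_zero ht f7)), affineChart_coe]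
  field_simp
  ring

end


theorem eq_or_eq_compl_of_pair_eq {X : Type*} {A B : Set X}
    (h : ({A, Aᶜ} : Set (Set X)) = {B, Bᶜ}) : A = B ∨ A = Bᶜ := by
  have : A ∈ ({B, Bᶜ} : Set (Set X)) := h ▸ mem_insert _ _
  simpa using this

namespace LocalChart

variable {d : ℕ} (φ : LocalChart k d)

/-- The cross ratio of four labels as a function of the coordinates. -/
def coord (a b c e : Fin k) (v : Fin d → ℂ) : ℂ := affineChart (view (φ.chart.symm v) a b c e)

open Classical in
/-- The gluing parameters of the edges of `x` that separate `a`, `e` from `b`, `c`. -/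
def separating (x : DM k) (a b c e : Fin k) : Finset (Fin d) := Finset.univ.filter fun m =>
  m ∈ φ.gluing ∧ ∃ A, IsSplit x A ∧ φ.edge m = {A, Aᶜ} ∧ a ∈ A ∧ e ∈ A ∧ b ∉ A ∧ c ∉ A

variable {φ}

theorem mem_separating {x : DM k} {a b c e : Fin k} {m : Fin d} : m ∈ φ.separating x a b c e ↔
    m ∈ φ.gluing ∧ ∃ A, IsSplit x A ∧ φ.edge m = {A, Aᶜ} ∧ a ∈ A ∧ e ∈ A ∧ b ∉ A ∧ c ∉ A := by
  simp [separating]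

theorem exists_edge_eq {x : DM k} (hx : x ∈ φ.chart.source) {A : Set (Fin k)} (hA : IsSplit x A) :
    ∃ m ∈ φ.gluing, φ.edge m = {A, Aᶜ} :=
  φ.edge_bijOn.surjOn (φ.edges_subset x hx (DM.mem_edges_iff.mpr ⟨A, rfl, hA⟩))

theorem coord_swap {v : Fin d → ℂ} {a b c e : Fin k} (h1 : Distinct3 a b c)
    (h2 : Distinct3 b a e) : φ.coord b a e c v = φ.coord a b c e v := by
  rw [coord, view_swap _ h1 h2, coord]

variable {v : Fin d → ℂ}

/-- In the view of `a`, `b`, `c` the label `e` is at `0` with `a`. Uniqueness of `A` for `b`, `c`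
keeps the labels outside `A` away from `0`, and uniqueness for `b'`, `c'` keeps these two apart, so
`SmoothAt.cr_unitMultiple` applies. -/
theorem unitMultiple_change_pair (hv : v ∈ φ.chart.target) {A : Set (Fin k)} (hA : IsSplit (φ.chart.symm v) A)
    {a b c e b' c' : Fin k} (ha : a ∈ A) (he : e ∈ A) (hb : b ∉ A) (hc : c ∉ A) (hb' : b' ∉ A)
    (hc' : c' ∉ A) (hae : a ≠ e) (hbc : b ≠ c) (hbc' : b' ≠ c')
    (h : ∀ G, IsSplit (φ.chart.symm v) G → a ∈ G → e ∈ G → b ∉ G → c ∉ G → G = A)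
    (h' : ∀ G, IsSplit (φ.chart.symm v) G → a ∈ G → e ∈ G → b' ∉ G → c' ∉ G → G = A) :
    UnitMultiple v (φ.coord a b' c' e) (φ.coord a b c e) := by
  have hne : ∀ {S : Set (Fin k)} {u v : Fin k}, u ∈ S → v ∉ S → u ≠ v :=
    fun hu hv h => hv (h ▸ hu)
  have habc : Distinct3 a b c := ⟨hne ha hb, hbc, hne ha hc⟩
  have habc' : Distinct3 a b' c' := ⟨hne ha hb', hbc', hne ha hc'⟩
  have h0 := hA.view_eq_zero a ha e he b hb c hc hae hbc
  have h1 : ∀ l, l ∉ A → ((0 : ℂ) : OnePoint ℂ) ≠ view (φ.chart.symm v) a b c l := by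
    intro l hl hl0
    obtain ⟨G, hG, haG, hlG, hbG, hcG⟩ := (view_eq_zero_iff habc (hne ha hl).symm).mp hl0.symm
    rcases hA.subset_or hG ha haG hb hbG with hs | hs
    · exact hl (h G hG haG (hs he) hbG hcG ▸ hlG)
    · exact hl (hs hlG)
  have h2 : view (φ.chart.symm v) a b c b' ≠ view (φ.chart.symm v) a b c c' := by
    intro heq
    -- Used for `f = c` or `f = b`, whichever is away from the supposed common position of `b'` and
    -- `c'`: the edge that cuts off `b'`, `c'` from `a`, `f` is incompatible with `A` or a second
    -- edge separating `a`, `e` from `b'`, `c'`.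
    have key : ∀ f, f ∉ A → view (φ.chart.symm v) a b c f ≠ view (φ.chart.symm v) a b c b' →
        ((0 : ℂ) : OnePoint ℂ) ≠ view (φ.chart.symm v) a b c f → False := by
      intro f hf hfb hf0
      have hd : Distinct3 b' a f :=
        ⟨(hne ha hb').symm, hne ha hf, fun e => hfb (e ▸ rfl)⟩
      have h3 : view (φ.chart.symm v) b' a f c' = ((0 : ℂ) : OnePoint ℂ) := by
        have hn : NoThree (view (φ.chart.symm v) a b c b') (view (φ.chart.symm v) a b c a)
            (view (φ.chart.symm v) a b c f) (view (φ.chart.symm v) a b c c') := by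
          have := h1 b' hb'
          rw [view_left _ habc, ← heq]
          unfold NoThree
          grind
        rw [view_eq _ hd habc hn, hn.cr_eq_zero_iff]
        exact Or.inr heq
      obtain ⟨G, hG, hbG, hcG, haG, hfG⟩ := (view_eq_zero_iff hd hbc'.symm).mp h3
      have haG' : a ∈ Gᶜ := haG
      have hbG' : b' ∉ Gᶜ := fun h => h hbG
      have hcG' : c' ∉ Gᶜ := fun h => h hcG
      rcases hA.subset_or hG.compl ha haG' hb' hbG' with hs | hs
      · have := h' _ hG.compl haG' (hs he) hbG' hcG'
        exact hf (this ▸ hfG)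
      · exact hf (hs hfG)
    by_cases hbb : view (φ.chart.symm v) a b c b = view (φ.chart.symm v) a b c b'
    · refine key c hc ?_ (h1 c hc)
      rw [← hbb, view_mid _ habc, view_right _ habc]
      exact OnePoint.infty_ne_coe _
    · exact key b hb hbb (h1 b hb)
  have hsm := φ.smoothAt_view hv a b c
  refine (SmoothAt.cr_unitMultiple (hsm b') (hsm c') (hsm e) h2 (h1 b' hb') ?_ ?_).congr ?_
    (Filter.Eventually.of_forall fun _ => rfl)
  · rw [h0]; exact (h1 c' hc').symm
  · rw [h0]; exact OnePoint.coe_ne_infty _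
  · filter_upwards [((hsm b').continuousAt.prodMk (hsm c').continuousAt).eventually
        (isClosed_diagonal.isOpen_compl.mem_nhds h2),
      (hsm b').continuousAt.eventually_ne (h1 b' hb').symm,
      (hsm c').continuousAt.eventually_ne (h1 c' hc').symm] with y e1 e2 e3
    rw [coord, view_eq _ habc' habc, view_left _ habc]
    rw [view_left _ habc]
    exact noThree_of_distinct e2.symm e1 e3.symm _

/-- The pair `b`, `c` is changed first, then `a`, `e`; `coord_swap` exchanges the roles of the two
pairs. By compatibility with `A`, uniqueness also holds for the intermediate quadruple. -/
theorem unitMultiple_of_unique (hv : v ∈ φ.chart.target) {A : Set (Fin k)} (hA : IsSplit (φ.chart.symm v) A)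
    {a b c e a' b' c' e' : Fin k} (ha : a ∈ A) (he : e ∈ A) (hb : b ∉ A) (hc : c ∉ A)
    (ha' : a' ∈ A) (he' : e' ∈ A) (hb' : b' ∉ A) (hc' : c' ∉ A)
    (hae : a ≠ e) (hbc : b ≠ c) (hae' : a' ≠ e') (hbc' : b' ≠ c')
    (h : ∀ G, IsSplit (φ.chart.symm v) G → a ∈ G → e ∈ G → b ∉ G → c ∉ G → G = A)
    (h' : ∀ G, IsSplit (φ.chart.symm v) G → a' ∈ G → e' ∈ G → b' ∉ G → c' ∉ G → G = A) :
    UnitMultiple v (φ.coord a b c e) (φ.coord a' b' c' e') := by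
  have hne : ∀ {u v : Fin k}, u ∈ A → v ∉ A → u ≠ v := fun hu hv h => hv (h ▸ hu)
  have hm : ∀ G, IsSplit (φ.chart.symm v) G → a ∈ G → e ∈ G → b' ∉ G → c' ∉ G → G = A := by
    intro G hG haG heG hbG hcG
    rcases hA.subset_or hG ha haG hb' hbG with hs | hs
    · exact h' G hG (hs ha') (hs he') hbG hcG
    · exact h G hG haG heG (fun hh => hb (hs hh)) (fun hh => hc (hs hh))
  have h1 := unitMultiple_change_pair hv hA ha he hb hc hb' hc' hae hbc hbc' h hm
  have hcompl : ∀ {u w : Fin k}, (∀ G, IsSplit (φ.chart.symm v) G → u ∈ G → w ∈ G → b' ∉ G →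
      c' ∉ G → G = A) → ∀ G, IsSplit (φ.chart.symm v) G → b' ∈ G → c' ∈ G → u ∉ G → w ∉ G →
      G = Aᶜ := by
    intro u w hu G hG h1 h2 h3 h4
    rw [← hu Gᶜ hG.compl h3 h4 (fun h => h h1) (fun h => h h2), compl_compl]
  have h2 := unitMultiple_change_pair hv hA.compl (a := b') (e := c') hb' hc' (fun h => h ha)
    (fun h => h he) (fun h => h ha') (fun h => h he') hbc' hae hae' (hcompl hm) (hcompl h')
  refine h1.symm.trans (UnitMultiple.congr h2.symm ?_ ?_)
  · refine Filter.Eventually.of_forall fun y => (coord_swap ?_ ?_).symm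
    · exact ⟨hne ha hb', hbc', hne ha hc'⟩
    · exact ⟨(hne ha hb').symm, hae, (hne he hb').symm⟩
  · refine Filter.Eventually.of_forall fun y => (coord_swap ?_ ?_).symm
    · exact ⟨hne ha' hb', hbc', hne ha' hc'⟩
    · exact ⟨(hne ha' hb').symm, hae', (hne he' hb').symm⟩

theorem gluing_eq_zero_iff' (hv : v ∈ φ.chart.target) {m : Fin d}
    (hm : m ∈ φ.gluing) : v m = 0 ↔ φ.edge m ∈ (φ.chart.symm v).edges := by
  have hx := φ.chart.map_target hv
  rw [← φ.gluing_eq_zero_iff m hm _ hx, φ.chart_eq _ hx, φ.chart.right_inv hv, OnePoint.coe_eq_coe]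

/-- At `v`, the cross ratio that is the gluing parameter of an edge is separated by this edge only. -/
theorem edge_eq_of_separates (hv : v ∈ φ.chart.target) {m : Fin d} {G : Set (Fin k)}
    (hG : IsSplit (φ.chart.symm v) G) (h0 : φ.quad m 0 ∈ G) (h3 : φ.quad m 3 ∈ G)
    (h1 : φ.quad m 1 ∉ G) (h2 : φ.quad m 2 ∉ G) : φ.edge m = {G, Gᶜ} := by
  obtain ⟨m', hm', he⟩ := exists_edge_eq (φ.chart.map_target hv) hG
  by_cases hmm : m' = m
  · rw [← hmm, he]
  exfalso
  -- If the edge belonged to another parameter `m'`, it would persist while coordinate `m` alone is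
  -- varied, and would force this coordinate to vanish even where it is chosen nonzero.
  have hc : Continuous fun ε : ℂ => Function.update v m ε := continuous_const.update m continuous_id
  have hc' : ∀ᶠ ε in 𝓝 (v m), Function.update v m ε ∈ φ.chart.target := by
    refine hc.continuousAt.eventually (φ.chart.open_target.mem_nhds ?_)
    simpa using hv
  obtain ⟨ε, hε, hne⟩ : ∃ ε, Function.update v m ε ∈ φ.chart.target ∧ ε ≠ 0 := by
    by_cases hvm : v m = 0
    · rw [hvm] at hc'
      obtain ⟨ε, h1, h2⟩ := ((hc'.filter_mono nhdsWithin_le_nhds).and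
        (self_mem_nhdsWithin : ({0}ᶜ : Set ℂ) ∈ 𝓝[≠] 0)).exists
      exact ⟨ε, h1, h2⟩
    · exact ⟨v m, by rwa [Function.update_eq_self], hvm⟩
  have hx := φ.chart.map_target hε
  have h4 : v m' = 0 :=
    (gluing_eq_zero_iff' hv hm').mpr (by rw [he]; exact DM.mem_edges_iff.mpr ⟨G, rfl, hG⟩)
  have h5 := (gluing_eq_zero_iff' hε hm').mp (by rw [Function.update_of_ne hmm, h4])
  rw [he] at h5
  obtain ⟨A, hAG, hA⟩ := DM.mem_edges_iff.mp h5
  have hG' : IsSplit (φ.chart.symm (Function.update v m ε)) G := by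
    rcases eq_or_eq_compl_of_pair_eq hAG with rfl | rfl
    · exact hA
    · exact hA.compl
  have h6 := hG'.view_eq_zero _ h0 _ h3 _ h1 _ h2 (by simp) (by simp)
  rw [← crossRatioMap_eq_view, φ.chart_eq _ hx, φ.chart.right_inv hε, Function.update_self,
    OnePoint.coe_eq_coe] at h6
  exact hne h6

theorem coord_quad (hv : v ∈ φ.chart.target) (m : Fin d) :
    φ.coord (φ.quad m 0) (φ.quad m 1) (φ.quad m 2) (φ.quad m 3) v = v m := by
  rw [coord, ← crossRatioMap_eq_view, φ.chart_eq _ (φ.chart.map_target hv),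
    φ.chart.right_inv hv, affineChart_coe]

/-- The gluing parameter `m` is itself a cross ratio separated at `v` by its own edge only, so
`unitMultiple_of_unique` compares the two. Either orientation of the edge may occur, hence two
cases. -/
theorem unitMultiple_of_separating_eq_singleton (hv : v ∈ φ.chart.target) {a b c e : Fin k} (habc : Distinct3 a b c)
    (hea : e ≠ a) {m : Fin d} (h : φ.separating (φ.chart.symm v) a b c e = {m}) :
    UnitMultiple v (φ.coord a b c e) (fun y => y m) := by
  have hx := φ.chart.map_target hv
  obtain ⟨hm, A, hA, hmA, ha, he, hb, hc⟩ := mem_separating.mp (h ▸ Finset.mem_singleton_self m)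
  have hu : ∀ G, IsSplit (φ.chart.symm v) G → a ∈ G → e ∈ G → b ∉ G → c ∉ G → G = A := by
    intro G hG h1 h2 h3 h4
    obtain ⟨m', hm', he'⟩ := exists_edge_eq hx hG
    have h5 : m' ∈ φ.separating (φ.chart.symm v) a b c e :=
      mem_separating.mpr ⟨hm', G, hG, he', h1, h2, h3, h4⟩
    rw [h, Finset.mem_singleton] at h5
    rw [h5, hmA] at he'
    exact (eq_or_eq_compl_of_pair_eq he'.symm).resolve_right fun e => (e ▸ h1 : a ∈ Aᶜ) ha
  set q := φ.quad m with hq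
  have hq3 := distinct3_quad q
  have hq30 : q 3 ≠ q 0 := by simp
  have hvm : v m = 0 :=
    (gluing_eq_zero_iff' hv hm).mpr (by rw [hmA]; exact DM.mem_edges_iff.mpr ⟨A, rfl, hA⟩)
  have h0 : view (φ.chart.symm v) (q 0) (q 1) (q 2) (q 3) = ((0 : ℂ) : OnePoint ℂ) := by
    rw [← crossRatioMap_eq_view, φ.chart_eq _ hx, φ.chart.right_inv hv, hvm]
  obtain ⟨G, hG, g0, g3, g1, g2⟩ := (view_eq_zero_iff hq3 hq30).mp h0
  have hcoord : ∀ᶠ y in 𝓝 v, y m = φ.coord (q 0) (q 1) (q 2) (q 3) y := by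
    filter_upwards [φ.chart.open_target.mem_nhds hv] with y hy using (coord_quad hy m).symm
  have huG : ∀ H, IsSplit (φ.chart.symm v) H → q 0 ∈ H → q 3 ∈ H → q 1 ∉ H → q 2 ∉ H → H = A ∨ H = Aᶜ :=
    fun H hH i0 i3 i1 i2 => eq_or_eq_compl_of_pair_eq
      ((edge_eq_of_separates hv hH i0 i3 i1 i2).symm.trans hmA)
  refine UnitMultiple.congr ?_ (Filter.Eventually.of_forall fun _ => rfl) hcoord
  rcases huG G hG g0 g3 g1 g2 with rfl | rfl
  · refine unitMultiple_of_unique hv hA ha he hb hc g0 g3 g1 g2 hea.symm habc.2.1 hq30.symm hq3.2.1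
      hu fun H hH i0 i3 i1 i2 => ?_
    exact (huG H hH i0 i3 i1 i2).resolve_right fun e => (e ▸ i0 : q 0 ∈ Gᶜ) g0
  · have g1' := not_not.mp g1
    have g2' := not_not.mp g2
    refine UnitMultiple.congr (unitMultiple_of_unique hv hA ha he hb hc g1' g2' g0 g3 hea.symm
      habc.2.1 hq3.2.1 hq30.symm hu fun H hH i0 i3 i1 i2 => ?_)
      (Filter.Eventually.of_forall fun _ => rfl)
      (Filter.Eventually.of_forall fun y => (coord_swap hq3 ⟨hq3.1.symm, hq30.symm, by simp⟩).symm)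
    rcases huG Hᶜ hH.compl i1 i2 (fun h => h i0) (fun h => h i3) with e | e
    · exact absurd g1' (e ▸ (fun h => h i0 : q 1 ∉ Hᶜ))
    · exact compl_injective e

/-- Induction on the number of separating edges. Without any, the cross ratio is a unit. Given two,
their sides that contain `a` are nested; a label `s` between them and the cocycle identity
`view_mul` split the cross ratio into two factors, and each separating edge goes to one factor
according to the side of `s`. -/
theorem unitMultiple_prod (hv : v ∈ φ.chart.target) {a b c e : Fin k} (habc : Distinct3 a b c) (hea : e ≠ a)
    (hfin : view (φ.chart.symm v) a b c e ≠ OnePoint.infty) :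
    UnitMultiple v (φ.coord a b c e)
      (fun y => ∏ m ∈ φ.separating (φ.chart.symm v) a b c e, y m) := by
  classical
  have hx := φ.chart.map_target hv
  induction hn : (φ.separating (φ.chart.symm v) a b c e).card using Nat.strong_induction_on
    generalizing a b c e with
  | _ n ih =>
  rcases Nat.lt_trichotomy n 1 with h1 | h1 | h1
  · have h2 : φ.separating (φ.chart.symm v) a b c e = ∅ := Finset.card_eq_zero.mp (by omega)
    rw [h2]
    refine ⟨φ.coord a b c e, (φ.smoothAt_view hv a b c e).contDiffAt hfin, fun h0 => ?_,
      Filter.Eventually.of_forall fun y => by simp⟩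
    have h3 : view (φ.chart.symm v) a b c e = ((0 : ℂ) : OnePoint ℂ) := by
      rw [← coe_affineChart hfin]; exact congrArg _ h0
    obtain ⟨A, hA, i1, i2, i3, i4⟩ := (view_eq_zero_iff habc hea).mp h3
    obtain ⟨m, hm, hmA⟩ := exists_edge_eq hx hA
    have := mem_separating.mpr ⟨hm, A, hA, hmA, i1, i2, i3, i4⟩
    rw [h2] at this
    simp at this
  · obtain ⟨m, hm⟩ := Finset.card_eq_one.mp (hn.trans h1)
    simp only [hm, Finset.prod_singleton]
    exact unitMultiple_of_separating_eq_singleton hv habc hea hm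
  · obtain ⟨m, hm, m', hm', hmm⟩ := Finset.one_lt_card.mp (hn ▸ h1)
    have hmem := hm
    have hmem' := hm'
    obtain ⟨hm, A, hA, hmA, ha, he, hb, hc⟩ := mem_separating.mp hm
    obtain ⟨hm', A', hA', hmA', ha', he', hb', hc'⟩ := mem_separating.mp hm'
    have hAA : A ≠ A' := by
      rintro rfl
      exact hmm (φ.edge_bijOn.injOn hm hm' (hmA.trans hmA'.symm))
    wlog hsub : A ⊆ A' generalizing m m' A A'
    · exact this m' hmem' m hmem hmm.symm hmem' hmem hm' A' hA' hmA' ha' he' hb' hc' hm A hA hmA ha he hb hc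
        hAA.symm ((hA.subset_or hA' ha ha' hb hb').resolve_left hsub)
    obtain ⟨s, hs', hs⟩ := exists_of_ssubset (hsub.ssubset_of_ne hAA)
    have hne : ∀ {S : Set (Fin k)} {u v : Fin k}, u ∈ S → v ∉ S → u ≠ v :=
      fun hu hv h => hv (h ▸ hu)
    have hasc : Distinct3 a s c := ⟨hne ha hs, hne hs' hc', hne ha hc⟩
    have hsa : s ≠ a := (hne ha hs).symm
    have hf1 : view (φ.chart.symm v) a s c e ≠ OnePoint.infty := by
      rw [hA.view_eq_zero a ha e he s hs c hc hea.symm hasc.2.1]; exact OnePoint.coe_ne_infty _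
    have hf2 : view (φ.chart.symm v) a b c s ≠ OnePoint.infty := by
      rw [hA'.view_eq_zero a ha' s hs' b hb' c hc' hsa.symm habc.2.1]
      exact OnePoint.coe_ne_infty _
    have hdisj : Disjoint (φ.separating (φ.chart.symm v) a s c e)
        (φ.separating (φ.chart.symm v) a b c s) := by
      rw [Finset.disjoint_left]
      intro g hg hg'
      obtain ⟨-, G, hG, hgG, i1, i2, i3, i4⟩ := mem_separating.mp hg
      obtain ⟨-, G', hG', hgG', j1, j2, j3, j4⟩ := mem_separating.mp hg'
      rcases eq_or_eq_compl_of_pair_eq (hgG.symm.trans hgG') with rfl | rfl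
      · exact i3 j2
      · exact i1 j1
    have hunion : φ.separating (φ.chart.symm v) a b c e = φ.separating (φ.chart.symm v) a s c e ∪
        φ.separating (φ.chart.symm v) a b c s := by
      ext g
      rw [Finset.mem_union]
      constructor
      · intro hg
        obtain ⟨hg, G, hG, hgG, i1, i2, i3, i4⟩ := mem_separating.mp hg
        by_cases hsG : s ∈ G
        · exact Or.inr (mem_separating.mpr ⟨hg, G, hG, hgG, i1, hsG, i3, i4⟩)
        · exact Or.inl (mem_separating.mpr ⟨hg, G, hG, hgG, i1, i2, hsG, i4⟩)
      · rintro (hg | hg)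
        · obtain ⟨hg, G, hG, hgG, i1, i2, i3, i4⟩ := mem_separating.mp hg
          refine mem_separating.mpr ⟨hg, G, hG, hgG, i1, i2, fun hbG => ?_, i4⟩
          rcases hG.subset_or hA' i1 ha' i4 hc' with hh | hh
          · exact hb' (hh hbG)
          · exact i3 (hh hs')
        · obtain ⟨hg, G, hG, hgG, i1, i2, i3, i4⟩ := mem_separating.mp hg
          refine mem_separating.mpr ⟨hg, G, hG, hgG, i1, ?_, i3, i4⟩
          rcases hG.subset_or hA i1 ha i4 hc with hh | hh
          · exact absurd (hh i2) hs
          · exact hh he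
    have hpos1 : 0 < (φ.separating (φ.chart.symm v) a s c e).card :=
      Finset.card_pos.mpr ⟨m, mem_separating.mpr ⟨hm, A, hA, hmA, ha, he, hs, hc⟩⟩
    have hpos2 : 0 < (φ.separating (φ.chart.symm v) a b c s).card :=
      Finset.card_pos.mpr ⟨m', mem_separating.mpr ⟨hm', A', hA', hmA', ha', hs', hb', hc'⟩⟩
    have hcard : (φ.separating (φ.chart.symm v) a s c e).card +
        (φ.separating (φ.chart.symm v) a b c s).card = n := by
      rw [← hn, hunion, Finset.card_union_of_disjoint hdisj]
    have u1 := ih _ (by omega) hasc hea hf1 rfl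
    have u2 := ih _ (by omega) habc hsa hf2 rfl
    refine (u1.mul u2).congr ?_ (Filter.Eventually.of_forall fun y => ?_)
    · filter_upwards [(φ.smoothAt_view hv a s c e).continuousAt.eventually_ne hf1,
        (φ.smoothAt_view hv a b c s).continuousAt.eventually_ne hf2] with y e1 e2
      exact view_mul habc hasc e2 e1
    · rw [hunion, Finset.prod_union hdisj]

end LocalChart

end

section

/-! ### The reparametrization -/

theorem psi_zero (r : ℝ) : psi r 0 = 0 := by simp [psi]

theorem psi_eq_zero_iff {r : ℝ} (hr : 0 < r) {z : ℂ} : psi r z = 0 ↔ z = 0 := by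
  rw [← norm_eq_zero, norm_psi hr, Real.rpow_eq_zero (norm_nonneg _) hr.ne', norm_eq_zero]

theorem psi_mul (r : ℝ) (z w : ℂ) : psi r (z * w) = psi r z * psi r w := by
  rw [psi, psi, psi, norm_mul, Real.mul_rpow (norm_nonneg _) (norm_nonneg _)]
  push_cast
  ring

theorem psi_one (r : ℝ) : psi r 1 = 1 := by simp [psi]

theorem psi_prod {ι : Type*} (r : ℝ) (s : Finset ι) (f : ι → ℂ) :
    psi r (∏ i ∈ s, f i) = ∏ i ∈ s, psi r (f i) := by
  classical
  induction s using Finset.induction_on with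
  | empty => simp [psi_one]
  | insert i s hi ih => rw [Finset.prod_insert hi, Finset.prod_insert hi, psi_mul, ih]

theorem contDiffAt_psi (r : ℝ) {z : ℂ} (hz : z ≠ 0) {n : WithTop ℕ∞} : ContDiffAt ℝ n (psi r) z := by
  have h1 : ContDiffAt ℝ n (fun z : ℂ => ‖z‖ ^ (r - 1)) z :=
    (contDiffAt_norm ℝ hz).rpow_const_of_ne (norm_ne_zero_iff.mpr hz)
  exact (Complex.ofRealCLM.contDiff.contDiffAt.comp z h1).mul contDiffAt_id

/-- The bound `p > 2` enters through the factor `‖z‖ ^ (p - 1)`, which is `C¹` at `0` because `p - 1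
> 1`. -/
theorem contDiff_psi {p : ℝ} (hp : 2 < p) : ContDiff ℝ 1 (psi p) :=
  (Complex.ofRealCLM.contDiff.comp (contDiff_norm_rpow (by linarith : (1 : ℝ) < p - 1))).mul
    contDiff_id

/-! ### Stratified smoothness at a point -/

section

variable {ι : Type} [Fintype ι] {A : Set ι} {E F : Type*} [NormedAddCommGroup E] [NormedSpace ℝ E]
  [NormedAddCommGroup F] [NormedSpace ℝ F]

/-- The map `f` is `C¹` at `v`, and it is smooth along the stratum of `v`. -/
def SSAt (A : Set ι) (f : (ι → ℂ) → E) (v : ι → ℂ) : Prop :=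
  ContDiffAt ℝ 1 f v ∧
    ContDiffWithinAt ℝ ((⊤ : ℕ∞) : WithTop ℕ∞) f (stratum A (stratumIndex A v)) v

theorem ssAt_of_contDiffAt {f : (ι → ℂ) → E} {v : ι → ℂ}
    (h : ContDiffAt ℝ ((⊤ : ℕ∞) : WithTop ℕ∞) f v) : SSAt A f v :=
  ⟨h.of_le (by exact_mod_cast le_top), h.contDiffWithinAt⟩

theorem SSAt.comp {f : (ι → ℂ) → E} {g : E → F} {v : ι → ℂ}
    (hg : ContDiffAt ℝ ((⊤ : ℕ∞) : WithTop ℕ∞) g (f v)) (h : SSAt A f v) :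
    SSAt A (fun y => g (f y)) v :=
  ⟨(hg.of_le (by exact_mod_cast le_top)).comp v h.1, hg.comp_contDiffWithinAt v h.2⟩

theorem SSAt.mul {f g : (ι → ℂ) → ℂ} {v : ι → ℂ} (hf : SSAt A f v) (hg : SSAt A g v) :
    SSAt A (fun y => f y * g y) v := ⟨hf.1.mul hg.1, hf.2.mul hg.2⟩

theorem SSAt.congr {f g : (ι → ℂ) → E} {v : ι → ℂ} (h : SSAt A f v) (hg : ∀ᶠ y in 𝓝 v, g y = f y) :
    SSAt A g v :=
  ⟨h.1.congr_of_eventuallyEq hg,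
    h.2.congr_of_eventuallyEq (hg.filter_mono nhdsWithin_le_nhds) hg.self_of_nhds⟩

theorem ssAt_apply (i : ι) (v : ι → ℂ) : SSAt A (fun y => y i) v :=
  ssAt_of_contDiffAt (contDiff_apply ℝ ℂ i).contDiffAt

/-- Along a stratum a gluing coordinate is identically zero or nowhere zero, so the lack of
smoothness of `ψ` at `0` does no harm. -/
theorem ssAt_psi_apply {p : ℝ} (hp : 2 < p) {i : ι} (hi : i ∈ A) (v : ι → ℂ) :
    SSAt A (fun y => psi p (y i)) v := by
  refine ⟨((contDiff_psi hp).comp (contDiff_apply ℝ ℂ i)).contDiffAt, ?_⟩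
  by_cases h : v i = 0
  · refine (contDiffWithinAt_const (c := (0 : ℂ))).congr (fun y hy => ?_) (by rw [h, psi_zero])
    have h1 : (⟨i, hi⟩ : A) ∉ stratumIndex A y := by
      rw [show stratumIndex A y = stratumIndex A v from hy]
      exact fun h2 => h2 h
    rw [show y i = 0 from not_not.mp h1, psi_zero]
  · exact ((contDiffAt_psi p h).comp v (contDiff_apply ℝ ℂ i).contDiffAt).contDiffWithinAt

theorem Psi_apply_of_mem {ι : Type} {A : Set ι} {p : ℝ} {hp : 0 < p} {i : ι} (hi : i ∈ A) (v : ι → ℂ) :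
    Psi p hp A v i = psi p (v i) := by
  simp only [Psi, Homeomorph.piCongrRight_apply, if_pos hi]
  rfl

theorem Psi_apply_of_notMem {ι : Type} {A : Set ι} {p : ℝ} {hp : 0 < p} {i : ι} (hi : i ∉ A) (v : ι → ℂ) :
    Psi p hp A v i = v i := by
  simp only [Psi, Homeomorph.piCongrRight_apply, if_neg hi]
  rfl

theorem Psi_symm_apply_of_mem {ι : Type} {A : Set ι} {p : ℝ} {hp : 0 < p} {i : ι} (hi : i ∈ A) (v : ι → ℂ) :
    (Psi p hp A).symm v i = psi p⁻¹ (v i) := by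
  obtain ⟨w, rfl⟩ := (Psi p hp A).surjective v
  rw [Homeomorph.symm_apply_apply, Psi_apply_of_mem hi]
  exact ((psiHomeo p hp).symm_apply_apply _).symm

theorem Psi_symm_apply_of_notMem {ι : Type} {A : Set ι} {p : ℝ} {hp : 0 < p} {i : ι} (hi : i ∉ A) (v : ι → ℂ) :
    (Psi p hp A).symm v i = v i := by
  obtain ⟨w, rfl⟩ := (Psi p hp A).surjective v
  rw [Homeomorph.symm_apply_apply, Psi_apply_of_notMem hi]

theorem ssAt_Psi {p : ℝ} (hp : 2 < p) (v : ι → ℂ) :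
    SSAt A (fun y => Psi p (two_pos.trans hp) A y) v := by
  have h : ∀ i, SSAt A (fun y => Psi p (two_pos.trans hp) A y i) v := fun i => by
    by_cases hi : i ∈ A
    · simp only [Psi_apply_of_mem hi]; exact ssAt_psi_apply hp hi v
    · simp only [Psi_apply_of_notMem hi]; exact ssAt_apply i v
  exact ⟨contDiffAt_pi.mpr fun i => (h i).1, contDiffWithinAt_pi.mpr fun i => (h i).2⟩

/-- Stratified smoothness can be checked in coordinates. -/
theorem isC1SSOn_of_coord {κ : Type} [Fintype κ] {B : Set κ} {f : (ι → ℂ) → κ → ℂ}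
    {U : Set (ι → ℂ)} (h : ∀ m, ∀ v ∈ U, SSAt A (fun y => f y m) v)
    (hB : ∀ m ∈ B, ∃ R ⊆ A, ∀ v ∈ U, f v m ≠ 0 ↔ ∀ i ∈ R, v i ≠ 0) : IsC1SSOn A B f U where
  contDiffOn v hv := (contDiffAt_pi.mpr fun m => (h m v hv).1).contDiffWithinAt
  stratified := by
    choose! R hRA hR using hB
    -- A target coordinate `m` is nonzero exactly when all coordinates in `R m` are, so the target
    -- stratum depends on `T` alone and grows with it.
    refine ⟨fun T => {m | ∀ i : A, (i : ι) ∈ R m → i ∈ T}, fun T T' hT m hm i hi => hT (hm i hi), ?_⟩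
    rintro T v ⟨hv, rfl⟩
    ext ⟨m, hm⟩
    refine (hR m hm v hv).trans ⟨fun h i hi => h i hi, fun h i hi => ?_⟩
    exact h ⟨i, hRA m hm hi⟩ hi
  smooth T v hv := by
    obtain ⟨hv, rfl⟩ := hv
    exact (contDiffWithinAt_pi.mpr fun m => (h m v hv).2).mono inter_subset_right

end

/-! ### Coordinates of the sphere and tame maps -/

/-- The Moebius transformation that moves the special point of the chart to `0`. -/
def moebius : SphereKind → OnePoint ℂ → OnePoint ℂ
  | .zero => id
  | .one => sphereFlip
  | .infty => sphereInv
  | .generic => id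

theorem sphereFlip_coe (z : ℂ) : sphereFlip (z : OnePoint ℂ) = ((1 - z : ℂ) : OnePoint ℂ) := rfl

theorem sphereFlip_sphereFlip (w : OnePoint ℂ) : sphereFlip (sphereFlip w) = w := by
  induction w using OnePoint.rec with
  | infty => rfl
  | coe z => rw [sphereFlip_coe, sphereFlip_coe, sub_sub_cancel]

theorem moebius_moebius (κ : SphereKind) (w : OnePoint ℂ) : moebius κ (moebius κ w) = w := by
  cases κ
  · rfl
  · exact sphereFlip_sphereFlip w
  · exact sphereInv_involutive w
  · rfl

open Classical in
/-- The coordinate given by a chart of the sphere, wherever it is finite. -/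
def sphereCoord (p : ℝ) (κ : SphereKind) (w : OnePoint ℂ) : ℂ :=
  if κ = .generic then affineChart w else psi p⁻¹ (affineChart (moebius κ w))

/-- The maps from the model space to the sphere that are stratified smooth in all coordinates of the
sphere. -/
structure Tame {ι : Type} [Fintype ι] (p : ℝ) (A : Set ι) (w : (ι → ℂ) → OnePoint ℂ)
    (U : Set (ι → ℂ)) : Prop where
  continuousAt : ∀ v ∈ U, ContinuousAt w v
  regular : ∀ v ∈ U, w v ≠ OnePoint.infty → SSAt A (fun y => affineChart (w y)) v
  special : ∀ κ ≠ .generic, ∀ v ∈ U, moebius κ (w v) = ((0 : ℂ) : OnePoint ℂ) →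
    SSAt A (fun y => psi p⁻¹ (affineChart (moebius κ (w y)))) v
  strata : ∀ κ ≠ .generic, ∃ R ⊆ A, ∀ v ∈ U,
    moebius κ (w v) ≠ ((0 : ℂ) : OnePoint ℂ) ↔ ∀ i ∈ R, v i ≠ 0

theorem affineChart_eq_zero_iff {w : OnePoint ℂ} (hw : w ≠ OnePoint.infty) :
    affineChart w = 0 ↔ w = ((0 : ℂ) : OnePoint ℂ) := by
  rw [← OnePoint.coe_eq_coe, coe_affineChart hw]

section

variable {ι : Type} [Fintype ι] {p : ℝ} {A : Set ι} {w : (ι → ℂ) → OnePoint ℂ} {U : Set (ι → ℂ)}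

theorem SSAt.moebius {v : ι → ℂ} (hc : ContinuousAt w v)
    (h : w v ≠ OnePoint.infty → SSAt A (fun y => affineChart (w y)) v) (κ : SphereKind)
    (h1 : moebius κ (w v) ≠ OnePoint.infty)
    (h0 : DeligneMumford.moebius κ (w v) ≠ ((0 : ℂ) : OnePoint ℂ)) :
    SSAt A (fun y => affineChart (DeligneMumford.moebius κ (w y))) v := by
  have hw : w v ≠ OnePoint.infty := by
    cases κ with
    | zero => exact h1
    | one => exact fun e => h1 (by rw [e]; rfl)
    | infty => exact fun e => h0 (by rw [e]; rfl)
    | generic => exact h1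
  have h2 := h hw
  have h3 := hc.eventually_ne hw
  cases κ with
  | zero => exact h2
  | generic => exact h2
  | one =>
    refine (SSAt.comp (g := fun z : ℂ => 1 - z) (contDiffAt_const.sub contDiffAt_id) h2).congr ?_
    filter_upwards [h3] with y hy
    obtain ⟨z, hz⟩ := OnePoint.ne_infty_iff_exists.mp hy
    rw [← hz, affineChart_coe]
    exact affineChart_coe _
  | infty =>
    have hw0 : w v ≠ ((0 : ℂ) : OnePoint ℂ) := fun e => h1 (by
      rw [e]; exact sphereInv_zero)
    refine (SSAt.comp (g := fun z : ℂ => z⁻¹) (contDiffAt_id.inv ?_) h2).congr ?_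
    · exact (affineChart_eq_zero_iff hw).not.mpr hw0
    · filter_upwards [h3, hc.eventually_ne hw0] with y hy hy0
      obtain ⟨z, hz⟩ := OnePoint.ne_infty_iff_exists.mp hy
      rw [← hz] at hy0 ⊢
      have hz0 : z ≠ 0 := fun e => hy0 (by rw [e])
      rw [affineChart_coe]
      exact (congrArg affineChart (sphereInv_coe hz0)).trans (affineChart_coe _)

/-- The field `special` is needed only at zeros of the coordinate; elsewhere `ψ⁻¹` is smooth. -/
theorem Tame.ssAt_sphereCoord (h : Tame p A w U) (κ : SphereKind) {v : ι → ℂ} (hv : v ∈ U)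
    (hκ : moebius κ (w v) ≠ OnePoint.infty) : SSAt A (fun y => sphereCoord p κ (w y)) v := by
  unfold sphereCoord
  split_ifs with hg
  · subst hg; exact h.regular v hv hκ
  · by_cases h0 : moebius κ (w v) = ((0 : ℂ) : OnePoint ℂ)
    · exact h.special κ hg v hv h0
    · exact (SSAt.moebius (h.continuousAt v hv) (h.regular v hv) κ hκ h0).comp
        (contDiffAt_psi _ ((affineChart_eq_zero_iff hκ).not.mpr h0))

/-- All claims of stratified smoothness are instances of this one: the charts of both spaces consist
of functions `sphereCoord` of sphere factors, with `j` selecting the factors. -/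
theorem isC1SSOn_sphereCoord (hp : 0 < p) {μ κ : Type} [Fintype κ] {w : (ι → ℂ) → μ → OnePoint ℂ}
    {j : κ → μ} (h : ∀ q, Tame p A (fun v => w v q) U) (τ : κ → SphereKind) {U' : Set (ι → ℂ)}
    (hU : U' ⊆ U) (hU' : ∀ v ∈ U', ∀ m, moebius (τ m) (w v (j m)) ≠ OnePoint.infty)
    {f : (ι → ℂ) → κ → ℂ} (hf : ∀ v m, f v m = sphereCoord p (τ m) (w v (j m))) :
    IsC1SSOn A {m | τ m ≠ .generic} f U' := by
  refine isC1SSOn_of_coord (fun m v hv => ?_) (fun m hm => ?_)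
  · simp only [hf]
    exact (h (j m)).ssAt_sphereCoord (τ m) (hU hv) (hU' v hv m)
  · obtain ⟨R, hRA, hR⟩ := (h (j m)).strata (τ m) hm
    refine ⟨R, hRA, fun v hv => ?_⟩
    rw [← hR v (hU hv), hf, sphereCoord, if_neg hm, Ne, psi_eq_zero_iff (inv_pos.mpr hp),
      affineChart_eq_zero_iff (hU' v hv m)]

end

end

section

/-! ### The charts of the sphere -/

theorem continuous_moebius (κ : SphereKind) : Continuous (moebius κ) := by
  cases κ
  · exact continuous_id
  · exact sphereFlip.continuous
  · exact continuous_sphereInv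
  · exact continuous_id

theorem mem_source_affineChart {w : OnePoint ℂ} : w ∈ affineChart.source ↔ w ≠ OnePoint.infty := by
  rw [OnePoint.ne_infty_iff_exists]
  simp [affineChart]

theorem sphereNewChart_apply {p : ℝ} (hp : 0 < p) (κ : SphereKind) (w : OnePoint ℂ) :
    sphereNewChart p hp κ w = sphereCoord p κ w := by
  cases κ <;> simp [sphereCoord] <;> rfl

theorem sphereFlip_symm (w : OnePoint ℂ) : sphereFlip.symm w = sphereFlip w := by
  rw [Homeomorph.symm_apply_eq, sphereFlip_sphereFlip]

theorem sphereNewChart_symm {p : ℝ} (hp : 0 < p) {κ : SphereKind} (hκ : κ ≠ .generic) (z : ℂ) :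
    (sphereNewChart p hp κ).symm z = moebius κ (psi p z : OnePoint ℂ) := by
  cases κ
  · rfl
  · exact sphereFlip_symm _
  · rfl
  · exact absurd rfl hκ

theorem sphereNewChart_generic_symm {p : ℝ} (hp : 0 < p) (z : ℂ) :
    (sphereNewChart p hp .generic).symm z = (z : OnePoint ℂ) := rfl

theorem moebius_ne_infty_of_mem_source {p : ℝ} (hp : 0 < p) {κ : SphereKind} {w : OnePoint ℂ}
    (hw : w ∈ (sphereNewChart p hp κ).source) : moebius κ w ≠ OnePoint.infty := by
  rw [← mem_source_affineChart]
  cases κ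
  · exact hw.1
  · exact hw.1.2
  · exact hw.1.2
  · exact hw.1

theorem psi_ne_one_of_mem_target {p : ℝ} (hp : 0 < p) {κ : SphereKind} (hκ : κ ≠ .generic) {z : ℂ}
    (hz : z ∈ (sphereNewChart p hp κ).target) : psi p z ≠ 1 := by
  cases κ
  · exact hz.1
  · exact hz.1
  · exact hz.1
  · exact absurd rfl hκ

theorem mem_target_generic {p : ℝ} (hp : 0 < p) {z : ℂ}
    (hz : z ∈ (sphereNewChart p hp .generic).target) : z ≠ 0 ∧ z ≠ 1 := by
  have h : z ∉ ({0, 1} : Set ℂ) := hz.1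
  simpa using h

theorem moebius_coe_ne_zero {κ : SphereKind} {z : ℂ} (h0 : z ≠ 0) (h1 : z ≠ 1) :
    moebius κ (z : OnePoint ℂ) ≠ ((0 : ℂ) : OnePoint ℂ) := by
  cases κ
  · simpa [moebius] using h0
  · intro h
    rw [show moebius .one (z : OnePoint ℂ) = _ from sphereFlip_coe z, OnePoint.coe_eq_coe,
      sub_eq_zero] at h
    exact h1 h.symm
  · intro h
    rw [show moebius .infty (z : OnePoint ℂ) = _ from sphereInv_coe h0, OnePoint.coe_eq_coe] at h
    exact inv_ne_zero h0 h
  · simpa [moebius] using h0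

/-- The involution of `κ` moves the special point of another kind `κ'` to `1` or `∞`, and the finite
point `z ≠ 1` is neither. -/
theorem moebius_moebius_ne_zero {κ κ' : SphereKind} (hκ : κ ≠ .generic) (hκ' : κ' ≠ .generic)
    (hne : κ' ≠ κ) {z : ℂ} (h1 : z ≠ 1) :
    moebius κ' (moebius κ (z : OnePoint ℂ)) ≠ ((0 : ℂ) : OnePoint ℂ) := by
  have hi : moebius κ' ((0 : ℂ) : OnePoint ℂ) ≠ moebius κ (z : OnePoint ℂ) := by
    have e1 : moebius .one ((0 : ℂ) : OnePoint ℂ) = ((1 : ℂ) : OnePoint ℂ) :=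
      (sphereFlip_coe 0).trans (by rw [sub_zero])
    have e2 : moebius .infty ((0 : ℂ) : OnePoint ℂ) = OnePoint.infty := sphereInv_zero
    intro h
    have h2 := congrArg (moebius κ) h
    rw [moebius_moebius] at h2
    have h3 : moebius κ (moebius κ' ((0 : ℂ) : OnePoint ℂ)) = OnePoint.infty ∨
        moebius κ (moebius κ' ((0 : ℂ) : OnePoint ℂ)) = ((1 : ℂ) : OnePoint ℂ) := by
      cases κ <;> cases κ' <;> try contradiction
      · exact Or.inr e1
      · exact Or.inl e2
      · exact Or.inr e1
      · rw [e2]; exact Or.inl rfl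
      · exact Or.inl e2
      · rw [e1]
        exact Or.inr ((sphereInv_coe one_ne_zero).trans (by rw [inv_one]))
    rw [h2] at h3
    rcases h3 with h3 | h3
    · exact OnePoint.coe_ne_infty _ h3
    · exact h1 (OnePoint.coe_eq_coe.mp h3)
  exact fun h => hi (by rw [← h, moebius_moebius])

/-- A chart contains at most its own special point. There `ψ⁻¹` undoes `ψ` and the coordinate is `v
i`; for the other special points the conditions are void. -/
theorem tame_sphereNewChart {ι : Type} [Fintype ι] {p : ℝ} (hp : 2 < p) (τ : ι → SphereKind) (i : ι) :
    Tame p {i | τ i ≠ .generic}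
      (fun v => (sphereNewChart p (two_pos.trans hp) (τ i)).symm (v i))
      {v | v i ∈ (sphereNewChart p (two_pos.trans hp) (τ i)).target} := by
  have hp0 : 0 < p := two_pos.trans hp
  by_cases hi : τ i = .generic
  · rw [hi]
    simp only [sphereNewChart_generic_symm]
    refine ⟨fun v _ => ?_, fun v _ _ => ?_, fun κ _ v hv h => ?_, fun κ _ => ⟨∅, empty_subset _, fun v hv => ?_⟩⟩
    · exact (OnePoint.continuous_coe.comp (continuous_apply i)).continuousAt
    · simp only [affineChart_coe]; exact ssAt_apply i v
    · have := mem_target_generic hp0 hv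
      exact absurd h (moebius_coe_ne_zero this.1 this.2)
    · have := mem_target_generic hp0 hv
      simpa using moebius_coe_ne_zero this.1 this.2
  · set A : Set ι := {i | τ i ≠ .generic} with hA
    have hiA : i ∈ A := hi
    generalize τ i = κ₀ at hi
    simp only [sphereNewChart_symm hp0 hi]
    have hcont : Continuous fun v : ι → ℂ => ((psi p (v i) : ℂ) : OnePoint ℂ) :=
      OnePoint.continuous_coe.comp ((continuous_psi hp0).comp (continuous_apply i))
    have hss : ∀ v : ι → ℂ, SSAt A (fun y => affineChart ((psi p (y i) : ℂ) : OnePoint ℂ)) v := by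
      intro v
      simp only [affineChart_coe]
      exact ssAt_psi_apply hp hiA v
    refine ⟨fun v _ => ((continuous_moebius _).comp hcont).continuousAt, fun v hv hw => ?_,
      fun κ hκ v hv h => ?_, fun κ hκ => ?_⟩
    · by_cases h0 : κ₀ = .zero
      · subst h0; exact hss v
      · refine SSAt.moebius hcont.continuousAt (fun _ => hss v) κ₀ hw ?_
        exact moebius_moebius_ne_zero (κ := .zero) (by simp) hi h0
          (psi_ne_one_of_mem_target hp0 hi hv)
    · by_cases hk : κ = κ₀
      · subst hk
        simp only [moebius_moebius, affineChart_coe,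
          psi_psi_inv hp0 (inv_mul_cancel₀ hp0.ne')]
        exact ssAt_apply i v
      · exact absurd h (moebius_moebius_ne_zero hi hκ hk (psi_ne_one_of_mem_target hp0 hi hv))
    · by_cases hk : κ = κ₀
      · subst hk
        refine ⟨{i}, singleton_subset_iff.mpr hiA, fun v _ => ?_⟩
        simp only [moebius_moebius, mem_singleton_iff, forall_eq, Ne, OnePoint.coe_eq_coe,
          psi_eq_zero_iff hp0]
      · refine ⟨∅, empty_subset _, fun v hv => ?_⟩
        simpa using moebius_moebius_ne_zero hi hκ hk (psi_ne_one_of_mem_target hp0 hi hv)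

theorem Tame.mono {ι : Type} [Fintype ι] {p : ℝ} {A : Set ι} {w : (ι → ℂ) → OnePoint ℂ}
    {U V : Set (ι → ℂ)} (h : Tame p A w U) (hV : V ⊆ U) : Tame p A w V where
  continuousAt v hv := h.continuousAt v (hV hv)
  regular v hv := h.regular v (hV hv)
  special κ hκ v hv := h.special κ hκ v (hV hv)
  strata κ hκ := by
    obtain ⟨R, hR, hR'⟩ := h.strata κ hκ
    exact ⟨R, hR, fun v hv => hR' v (hV hv)⟩

/-! ### The charts of the Deligne-Mumford space -/

variable {k : ℕ}

/-- This is the Plücker relation between the brackets of four points. -/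
theorem moebius_one_cr (a b c d : OnePoint ℂ) :
    moebius .one (cr a b c d) = cr b a c d := by
  by_cases h0 : homogSub a b * homogSub c d = 0
  · have h1 : homogSub b a * homogSub c d = 0 := by rw [homogSub_swap b a, neg_mul, h0, neg_zero]
    rw [cr, cr, h0, h1, toSphere_zero_right, toSphere_zero_right]
    rfl
  · have h1 : homogSub b a * homogSub c d ≠ 0 := by
      rwa [homogSub_swap b a, neg_mul, neg_ne_zero]
    rw [cr, cr, toSphere_of_ne h0, toSphere_of_ne h1]
    refine (sphereFlip_coe _).trans (congrArg _ ?_)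
    rw [one_sub_div h0, div_eq_div_iff h0 h1]
    unfold homogSub
    ring

theorem NoThree.moebius_infty_cr {a b c d : OnePoint ℂ} (h : NoThree a b c d) :
    moebius .infty (cr a b c d) = cr a d c b := by
  have e1 : homogSub d c * homogSub b a = homogSub a b * homogSub c d := by unfold homogSub; ring
  have e2 : homogSub a d * homogSub c b = homogSub b c * homogSub d a := by unfold homogSub; ring
  have h1 := h.ne_zero
  rw [cr, cr, e1, e2]
  change sphereInv _ = _
  generalize homogSub b c * homogSub d a = u at *
  generalize homogSub a b * homogSub c d = v at *
  by_cases hv : v = 0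
  · subst hv
    have hu : u ≠ 0 := by tauto
    rw [toSphere_zero_right, sphereInv_infty, toSphere_of_ne hu, zero_div]
  · by_cases hu : u = 0
    · subst hu
      rw [toSphere_of_ne hv, zero_div, sphereInv_zero, toSphere_zero_right]
    · rw [toSphere_of_ne hv, toSphere_of_ne hu, sphereInv_coe (div_ne_zero hu hv), inv_div]

/-- The Moebius transformations that permute `0`, `1`, `∞` permute the cross ratios. -/
theorem exists_moebius_crossRatioMap (κ : SphereKind) (q : Fin 4 ↪ Fin k) :
    ∃ q' : Fin 4 ↪ Fin k, ∀ x, moebius κ (crossRatioMap k x q) = crossRatioMap k x q' := by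
  cases κ
  · exact ⟨q, fun _ => rfl⟩
  · refine ⟨(Equiv.swap 0 1).toEmbedding.trans q, fun x => ?_⟩
    obtain ⟨C, rfl⟩ := x.exists_rep
    obtain ⟨α, hα⟩ := C.isFamily.exists_noThree q
    rw [crossRatioMap_eq hα, moebius_one_cr, crossRatioMap_eq (α := α)]
    · rfl
    · have e : ∀ i, ((Equiv.swap 0 1).toEmbedding.trans q) i = q (Equiv.swap 0 1 i) := fun _ => rfl
      simp only [e, show Equiv.swap (0 : Fin 4) 1 0 = 1 by decide,
        show Equiv.swap (0 : Fin 4) 1 1 = 0 by decide, show Equiv.swap (0 : Fin 4) 1 2 = 2 by decide,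
        show Equiv.swap (0 : Fin 4) 1 3 = 3 by decide]
      unfold NoThree at *
      grind
  · refine ⟨(Equiv.swap 1 3).toEmbedding.trans q, fun x => ?_⟩
    obtain ⟨C, rfl⟩ := x.exists_rep
    obtain ⟨α, hα⟩ := C.isFamily.exists_noThree q
    rw [crossRatioMap_eq hα, hα.moebius_infty_cr, crossRatioMap_eq (α := α)]
    · rfl
    · have e : ∀ i, ((Equiv.swap 1 3).toEmbedding.trans q) i = q (Equiv.swap 1 3 i) := fun _ => rfl
      simp only [e, show Equiv.swap (1 : Fin 4) 3 0 = 0 by decide,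
        show Equiv.swap (1 : Fin 4) 3 1 = 3 by decide, show Equiv.swap (1 : Fin 4) 3 2 = 2 by decide,
        show Equiv.swap (1 : Fin 4) 3 3 = 1 by decide]
      unfold NoThree at *
      grind
  · exact ⟨q, fun _ => rfl⟩

/-- The relevant indices `m` do not depend on `v`, so the zero locus is a union of coordinate
hyperplanes of gluing parameters; this makes cross ratios respect the strata. -/
theorem LocalChart.crossRatioMap_eq_zero_iff {d : ℕ} (φ : LocalChart k d) {v : Fin d → ℂ}
    (hv : v ∈ φ.chart.target) (q : Fin 4 ↪ Fin k) :
    crossRatioMap k (φ.chart.symm v) q = ((0 : ℂ) : OnePoint ℂ) ↔ ∃ m ∈ φ.gluing,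
      (∃ A, φ.edge m = {A, Aᶜ} ∧ q 0 ∈ A ∧ q 3 ∈ A ∧ q 1 ∉ A ∧ q 2 ∉ A) ∧ v m = 0 := by
  have hx := φ.chart.map_target hv
  rw [crossRatioMap_eq_view, view_eq_zero_iff (distinct3_quad q) (by simp)]
  constructor
  · rintro ⟨A, hA, h0, h3, h1, h2⟩
    obtain ⟨m, hm, hmA⟩ := exists_edge_eq hx hA
    refine ⟨m, hm, ⟨A, hmA, h0, h3, h1, h2⟩, (gluing_eq_zero_iff' hv hm).mpr ?_⟩
    rw [hmA]
    exact DM.mem_edges_iff.mpr ⟨A, rfl, hA⟩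
  · rintro ⟨m, hm, ⟨A, hmA, h0, h3, h1, h2⟩, hvm⟩
    have h4 := (gluing_eq_zero_iff' hv hm).mp hvm
    rw [hmA] at h4
    obtain ⟨B, hAB, hB⟩ := DM.mem_edges_iff.mp h4
    exact ⟨A, (hB.of_mem hAB (mem_insert A _)).1, h0, h3, h1, h2⟩

/-- At a zero the cross ratio is a monomial in the gluing parameters times a unit `u`.
Multiplicativity of `ψ⁻¹` cancels `Ψ` in the monomial, and `ψ⁻¹` is smooth at the value of `u`. -/
theorem LocalChart.tame {d : ℕ} (φ : LocalChart k d) {p : ℝ} (hp : 2 < p) (q : Fin 4 ↪ Fin k) :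
    Tame p φ.gluing
      (fun v => crossRatioMap k (φ.chart.symm (Psi p (two_pos.trans hp) φ.gluing v)) q)
      (Psi p (two_pos.trans hp) φ.gluing ⁻¹' φ.chart.target) := by
  have hp0 : 0 < p := two_pos.trans hp
  have hsm : ∀ q : Fin 4 ↪ Fin k, ∀ v ∈ φ.chart.target,
      SmoothAt (fun v => crossRatioMap k (φ.chart.symm v) q) v := fun q =>
    (isSmoothToSphereOn_iff φ.chart.open_target).mp (φ.smooth q)
  refine ⟨fun v hv => ?_, fun v hv hw => ?_, fun κ hκ v hv h0 => ?_, fun κ hκ => ?_⟩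
  · exact ContinuousAt.comp (g := fun v => crossRatioMap k (φ.chart.symm v) q) (hsm q _ hv).continuousAt (Psi p hp0 φ.gluing).continuous.continuousAt
  · exact SSAt.comp (g := fun y => affineChart (crossRatioMap k (φ.chart.symm y) q))
      ((hsm q _ hv).contDiffAt hw) (ssAt_Psi hp v)
  -- The special values `1` and `∞` become the value `0` of another cross ratio.
  · obtain ⟨q', hq'⟩ := exists_moebius_crossRatioMap κ q
    simp only [hq'] at h0 ⊢
    rw [crossRatioMap_eq_view] at h0
    obtain ⟨u, hu, hu0, he⟩ := unitMultiple_prod hv (e := q' 3) (distinct3_quad q') (by simp)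
      (by rw [h0]; exact OnePoint.coe_ne_infty _)
    set R := φ.separating (φ.chart.symm (Psi p hp0 φ.gluing v)) (q' 0) (q' 1) (q' 2) (q' 3)
    have h1 : SSAt φ.gluing (fun y : Fin d → ℂ => ∏ m ∈ R, y m) v :=
      ssAt_of_contDiffAt (contDiff_prod fun m _ => contDiff_apply ℝ ℂ m).contDiffAt
    have h2 : SSAt φ.gluing (fun y => psi p⁻¹ (u (Psi p hp0 φ.gluing y))) v :=
      SSAt.comp (g := fun y => psi p⁻¹ (u y)) ((contDiffAt_psi _ hu0).comp _ hu) (ssAt_Psi hp v)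
    refine (h1.mul h2).congr ?_
    filter_upwards [(Psi p hp0 φ.gluing).continuous.continuousAt.eventually he] with y hy
    rw [crossRatioMap_eq_view, show affineChart _ = _ from hy, psi_mul, psi_prod]
    congr 1
    refine Finset.prod_congr rfl fun m hm => ?_
    rw [Psi_apply_of_mem (mem_separating.mp hm).1, psi_psi_inv hp0 (inv_mul_cancel₀ hp0.ne')]
  · obtain ⟨q', hq'⟩ := exists_moebius_crossRatioMap κ q
    simp only [hq']
    refine ⟨{m | m ∈ φ.gluing ∧
      ∃ A, φ.edge m = {A, Aᶜ} ∧ q' 0 ∈ A ∧ q' 3 ∈ A ∧ q' 1 ∉ A ∧ q' 2 ∉ A}, fun m hm => hm.1,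
      fun v hv => ?_⟩
    rw [Ne, φ.crossRatioMap_eq_zero_iff hv]
    constructor
    · exact fun h m hm hvm => h ⟨m, hm.1, hm.2,
        by rw [Psi_apply_of_mem hm.1, hvm, psi_zero]⟩
    · rintro h ⟨m, hm, hA, hvm⟩
      rw [Psi_apply_of_mem hm, psi_eq_zero_iff hp0] at hvm
      exact h m ⟨hm, hA⟩ hvm


/-- A cross ratio chart as a local chart. -/
def CrossRatioChart.toLocalChart (c : CrossRatioChart k) : LocalChart k (k - 3) := { c with }

theorem CrossRatioChart.tame (c : CrossRatioChart k) {p : ℝ} (hp : 2 < p) (q : Fin 4 ↪ Fin k) :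
    Tame p (c.reparam p (two_pos.trans hp)).gluing
      (fun v => crossRatioMap k ((c.reparam p (two_pos.trans hp)).chart.symm v) q)
      (c.reparam p (two_pos.trans hp)).chart.target :=
  c.toLocalChart.tame hp q

open Classical in
/-- The kinds of the coordinates of a cross ratio chart. -/
def CrossRatioChart.kind (c : CrossRatioChart k) (m : Fin (k - 3)) : SphereKind :=
  if m ∈ c.gluing then .zero else .generic

theorem CrossRatioChart.setOf_kind (c : CrossRatioChart k) : {m | c.kind m ≠ .generic} = c.gluing := by
  ext m
  simp [kind]

theorem CrossRatioChart.moebius_kind (c : CrossRatioChart k) (m : Fin (k - 3)) (w : OnePoint ℂ) :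
    moebius (c.kind m) w = w := by
  unfold kind
  split_ifs <;> rfl

theorem CrossRatioChart.crossRatioMap_ne_infty (c : CrossRatioChart k) {x : DM k}
    (hx : x ∈ c.chart.source) (m : Fin (k - 3)) :
    crossRatioMap k x (c.quad m) ≠ OnePoint.infty := by
  rw [c.chart_eq x hx]; exact OnePoint.coe_ne_infty _

theorem CrossRatioChart.reparam_apply (c : CrossRatioChart k) {p : ℝ} (hp : 0 < p) {x : DM k}
    (hx : x ∈ c.chart.source) (m : Fin (k - 3)) :
    (c.reparam p hp).chart x m = sphereCoord p (c.kind m) (crossRatioMap k x (c.quad m)) := by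
  have h : (c.reparam p hp).chart x = (Psi p hp c.gluing).symm (c.chart x) := rfl
  rw [h, sphereCoord, c.moebius_kind, c.chart_eq x hx, affineChart_coe]
  by_cases hm : m ∈ c.gluing
  · rw [Psi_symm_apply_of_mem hm]
    simp [kind, hm]
  · rw [Psi_symm_apply_of_notMem hm]
    simp [kind, hm]

end

/-! ### The atlases and the submanifold structure -/

section

theorem IsC1SSOn.congr {ι κ : Type} [Fintype ι] [Fintype κ] {A : Set ι} {B : Set κ}
    {f g : (ι → ℂ) → κ → ℂ} {U : Set (ι → ℂ)} (h : IsC1SSOn A B f U) (hg : EqOn g f U) :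
    IsC1SSOn A B g U where
  contDiffOn := h.contDiffOn.congr hg
  stratified := by
    obtain ⟨F, hF, hm⟩ := h.stratified
    refine ⟨F, hF, fun T v hv => ?_⟩
    rw [hg hv.1]
    exact hm T hv
  smooth T := (h.smooth T).congr fun v hv => hg hv.1

theorem exists_mem_source_sphereNewChart {p : ℝ} (hp : 0 < p) (w : OnePoint ℂ) :
    ∃ κ, w ∈ (sphereNewChart p hp κ).source := by
  induction w using OnePoint.rec with
  | infty =>
    have h : sphereInv OnePoint.infty = ((0 : ℂ) : OnePoint ℂ) := sphereInv_infty
    refine ⟨.infty, ⟨trivial, ?_⟩, ?_⟩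
    · rw [mem_preimage, mem_source_affineChart]
      exact OnePoint.coe_ne_infty 0
    · change affineChart (sphereInv OnePoint.infty) ∉ ({1} : Set ℂ)
      rw [h, affineChart_coe]
      simp
  | coe z =>
    by_cases h1 : z = 1
    · refine ⟨.one, ⟨trivial, ?_⟩, ?_⟩
      · rw [mem_preimage, mem_source_affineChart]
        exact OnePoint.coe_ne_infty _
      · change affineChart (sphereFlip z) ∉ ({1} : Set ℂ)
        rw [sphereFlip_coe, affineChart_coe, h1]
        simp
    · refine ⟨.zero, mem_source_affineChart.mpr (OnePoint.coe_ne_infty z), ?_⟩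
      change affineChart z ∉ ({1} : Set ℂ)
      rw [affineChart_coe]
      exact h1

variable {p : ℝ} (hp : 2 < p) {ι : Type} [Fintype ι]

theorem sphereNewPow_tame (τ : ι → SphereKind) (i : ι) :
    Tame p {i | τ i ≠ .generic}
      (fun v => (OpenPartialHomeomorph.pi fun i => sphereNewChart p (two_pos.trans hp) (τ i)).symm v i)
      (OpenPartialHomeomorph.pi fun i => sphereNewChart p (two_pos.trans hp) (τ i)).target :=
  (tame_sphereNewChart hp τ i).mono fun _ hv => hv i trivial

theorem isC1SSAtlas_sphereNewPowAtlas :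
    IsC1SSAtlas (sphereNewPowAtlas p (two_pos.trans hp) ι) where
  cover x := by
    choose τ hτ using fun i => exists_mem_source_sphereNewChart (two_pos.trans hp) (x i)
    exact ⟨_, ⟨τ, rfl⟩, fun i _ => hτ i⟩
  transition := by
    rintro _ ⟨τ, rfl⟩ _ ⟨τ', rfl⟩
    refine isC1SSOn_sphereCoord (two_pos.trans hp) (j := id) (sphereNewPow_tame hp τ) τ'
      (fun v hv => hv.1) (fun v hv m => ?_) fun v m => sphereNewChart_apply _ _ _
    exact moebius_ne_infty_of_mem_source (two_pos.trans hp) (hv.2 m trivial)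

variable {k : ℕ}

theorem isC1SSAtlas_DMNewAtlas (hk : 3 ≤ k) : IsC1SSAtlas (DMNewAtlas k p (two_pos.trans hp)) where
  cover x := by
    obtain ⟨c, rfl⟩ := exists_crossRatioChart hk x
    exact ⟨_, ⟨c, rfl⟩, c.center_mem⟩
  transition := by
    rintro _ ⟨c, rfl⟩ _ ⟨c', rfl⟩
    have h := isC1SSOn_sphereCoord (two_pos.trans hp) (j := c'.quad) (c.tame hp) c'.kind
      (U' := ((c.reparam p (two_pos.trans hp)).chart.symm.trans
        (c'.reparam p (two_pos.trans hp)).chart).source) (fun v hv => hv.1)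
      (fun v hv m => by
        rw [c'.moebius_kind]
        exact c'.crossRatioMap_ne_infty hv.2 m) (fun v m => rfl)
    rw [c'.setOf_kind] at h
    exact h.congr fun v hv => funext fun m => c'.reparam_apply _ hv.2 m

theorem isC1SSMap_crossRatioMap : IsC1SSMap (DMNewAtlas k p (two_pos.trans hp))
    (sphereNewPowAtlas p (two_pos.trans hp) (Fin 4 ↪ Fin k)) (crossRatioMap k) := by
  rintro _ ⟨c, rfl⟩ _ ⟨τ, rfl⟩
  refine isC1SSOn_sphereCoord (two_pos.trans hp) (j := id) (c.tame hp) τ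
    (fun v hv => hv.1) (fun v hv m => ?_) fun v m => sphereNewChart_apply _ _ _
  exact moebius_ne_infty_of_mem_source (two_pos.trans hp) (hv.2 m trivial)

theorem isC1SSSubmanifold_crossRatioMap (hk : 3 ≤ k) : IsC1SSSubmanifold (crossRatioMap k)
    (sphereNewPowAtlas p (two_pos.trans hp) (Fin 4 ↪ Fin k)) (DMNewAtlas k p (two_pos.trans hp)) where
  isEmbedding := crossRatioMap_isEmbedding
  isC1SSAtlas := isC1SSAtlas_DMNewAtlas hp hk
  isC1SSMap := isC1SSMap_crossRatioMap hp
  extends_locally := by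
    rintro _ ⟨c, rfl⟩ y hy
    -- A chart coordinate is `sphereCoord` of a single sphere factor, so the same formula extends it
    -- to the open set where the factors in question are finite.
    refine ⟨{w | ∀ m, w (c.quad m) ≠ OnePoint.infty},
      fun w m => sphereCoord p (c.kind m) (w (c.quad m)), ?_,
      fun m => c.crossRatioMap_ne_infty hy m, ?_,
      fun y' hy' _ => funext fun m => (c.reparam_apply _ hy' m).symm⟩
    · rw [ofPred_forall]
      exact isOpen_iInter_of_finite fun m =>
        isOpen_compl_singleton.preimage (continuous_apply (c.quad m))
    · rintro _ ⟨τ, rfl⟩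
      have h := isC1SSOn_sphereCoord (two_pos.trans hp) (j := c.quad) (sphereNewPow_tame hp τ) c.kind
        (U' := (OpenPartialHomeomorph.pi fun i => sphereNewChart p (two_pos.trans hp) (τ i)).target ∩
          (OpenPartialHomeomorph.pi fun i => sphereNewChart p (two_pos.trans hp) (τ i)).symm ⁻¹'
            {w | ∀ m, w (c.quad m) ≠ OnePoint.infty})
        (fun v hv => hv.1) (fun v hv m => by rw [c.moebius_kind]; exact hv.2 m) (fun v m => rfl)
      rw [c.setOf_kind] at h
      exact h

end

end DeligneMumford

end

theorem proposition3p2 (k : ℕ) (hk : 3 ≤ k) (p : ℝ) (hp : 2 < p) :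
    DeligneMumford.IsC1SSAtlas
      (DeligneMumford.sphereNewPowAtlas p (two_pos.trans hp) (Fin 4 ↪ Fin k)) ∧
    (∀ x : DeligneMumford.DM k, ∃ c : DeligneMumford.CrossRatioChart k, c.center = x) ∧
    DeligneMumford.IsC1SSSubmanifold (DeligneMumford.crossRatioMap k)
      (DeligneMumford.sphereNewPowAtlas p (two_pos.trans hp) (Fin 4 ↪ Fin k))
      (DeligneMumford.DMNewAtlas k p (two_pos.trans hp)) :=
  ⟨DeligneMumford.isC1SSAtlas_sphereNewPowAtlas hp, DeligneMumford.exists_crossRatioChart hk,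
    DeligneMumford.isC1SSSubmanifold_crossRatioMap hp hk⟩
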